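/- Let $\mathcal D$ be a triangulated category, $\Lambda$ a free abelian group of finite rank, $\Lambda_{\mathbb R}=\mathbb R\otimes\Lambda$, and $v:K_0(\mathcal D)\to\Lambda$ a group homomorphism. A *slicing* $\mathcal P$ of $\mathcal D$ is a family of strictly full additive subcategories $\mathcal P(\phi)$, $\phi\in\mathbb R$, such that $\mathcal P(\phi+1)=\mathcal P(\phi)[1]$; $\operatorname{Hom}(A_1,A_2)=0$ for $A_i\in\mathcal P(\phi_i)$ with $\phi_1>\phi_2$; and every object $A$ has a Harder–Narasimhan filtration, i.e. there are objects $0=A_0,\dots,A_n=A$ and distinguished triangles $A_{i-1}\to A_i\to E_i\to A_{i-1}[1]$ with $0\neq E_i\in\mathcal P(\phi_i)$ and $\phi_1>\cdots>\phi_n$; for $A\ne0$ put $\phi^+_{\mathcal P}(A)=\phi_1$, $\phi^-_{\mathcal P}(A)=\phi_n$. The set of slicings carries the $[0,\infty]$-valued distance $$d(\mathcal P,\mathcal Q)=\sup_{A\neq0}\max\{|\phi^+_{\mathcal P}(A)-\phi^+_{\mathcal Q}(A)|,\ |\phi^-_{\mathcal P}(A)-\phi^-_{\mathcal Q}(A)|\}.$$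 A *stability precondition* is a pair $\sigma=(\mathcal P,Z)$ of a slicing and a homomorphism $Z:\Lambda\to\mathbb C$ with $Z(v(A))\in\mathbb R_{>0}e^{i\pi\phi}$ for every nonzero $A\in\mathcal P(\phi)$; such objects $A$ are called $\sigma$-semistable. It satisfies the *support property with respect to* a quadratic form $Q$ on $\Lambda_{\mathbb R}$ if $Q$ is negative definite on the kernel of $Z_{\mathbb R}:\Lambda_{\mathbb R}\to\mathbb C$ and $Q(v(A))\ge0$ for every $\sigma$-semistable $A$. A *stability condition* is a precondition satisfying the support property with respect to some $Q$. The set $\operatorname{Stab}(\mathcal D)$ of stability conditions is given the topology of a subspace of the product of the space of slicings with the finite-dimensional complex vector space $\operatorname{Hom}(\Lambda,\mathbb C)$; let $q:\operatorname{Stab}(\mathcal D)\to\operatorname{Hom}(\Lambda,\mathbb C)$, $(\mathcal P,Z)\mapsto Z$. **Theorem.** Let $Q$ be a quadratic form on $\Lambda_{\mathbb R}$ and let $\sigma\in\operatorname{Stab}(\mathcal D)$, with central charge $Z$, satisfy the support property with respect to $Q$. The set $\widetilde U$ of all $Z'\in\operatorname{Hom}(\Lambda,\mathbb C)$ such that $Q$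 is negative definite on the kernel of $Z'_{\mathbb R}$ is open. Let $U$ be the connected component of $\widetilde U$ containing $Z$, and $V$ the connected component of $q^{-1}(U)$ containing $\sigma$. Then: 1. $q$ restricts to a (surjective) covering map $V\to U$; 2. every stability condition in $V$ satisfies the support property with respect to $Q$. In particular, $\operatorname{Stab}(\mathcal D)$ is Hausdorff and has, compatibly with its topology, the structure of a complex manifold modelled on $\operatorname{Hom}(\Lambda,\mathbb C)$ (second countability not being required) for which $q$ is locally biholomorphic. -/

import Mathlib

open CategoryTheory CategoryTheory.Limits CategoryTheory.Pretriangulated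
open scoped TensorProduct ContDiff Manifold ENNReal

noncomputable section

namespace Bridgeland

universe w u

section Category

variable (C : Type u) [Category.{w} C] [HasZeroObject C] [HasShift C ℤ] [Preadditive C]
  [∀ n : ℤ, (shiftFunctor C n).Additive] [Pretriangulated C]

/-- The subgroup of relations `[Y] = [X] + [Z]`, one for each distinguished triangle
`X ⟶ Y ⟶ Z ⟶ X⟦1⟧`. -/
def K0Relations : AddSubgroup (FreeAbelianGroup C) :=
  AddSubgroup.closure {r | ∃ T ∈ distTriang C,
    r = FreeAbelianGroup.of T.obj₂ - (FreeAbelianGroup.of T.obj₁ + FreeAbelianGroup.of T.obj₃)}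

/-- The Grothendieck group of a triangulated category. -/
abbrev K0 : Type u := FreeAbelianGroup C ⧸ K0Relations C

variable {C}

/-- The class of an object in the Grothendieck group. -/
def K0.of (A : C) : K0 C := QuotientAddGroup.mk (FreeAbelianGroup.of A)

variable (C) in
/-- A Harder-Narasimhan filtration of `A` with respect to a family `P` of full subcategories
indexed by the real numbers. The filtered objects are `obj 0 = 0, obj 1, …, obj n ≅ A`
and the nonzero factors `factor 0, …, factor (n - 1)` have strictly decreasing phases. -/
structure HNFiltration (P : ℝ → ObjectProperty C) (A : C) where
  /-- The number of factors. -/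
  n : ℕ
  /-- The phases of the factors. -/
  phase : Fin n → ℝ
  /-- The filtered objects. -/
  obj : Fin (n + 1) → C
  /-- The factors. -/
  factor : Fin n → C
  phase_strictAnti : StrictAnti phase
  isZero_zero : IsZero (obj 0)
  /-- The last object is `A`. -/
  lastIso : obj (Fin.last n) ≅ A
  triangle : ∀ i : Fin n, ∃ (f : obj i.castSucc ⟶ obj i.succ) (g : obj i.succ ⟶ factor i)
    (h : factor i ⟶ (obj i.castSucc)⟦(1 : ℤ)⟧), Triangle.mk f g h ∈ distTriang C
  factor_mem : ∀ i, P (phase i) (factor i)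
  factor_nonzero : ∀ i, ¬ IsZero (factor i)

variable (C) in
/-- A slicing of a triangulated category: full additive strictly full subcategories `P φ`
with `P (φ + 1) = (P φ)[1]`, no nonzero morphisms from larger to smaller phases, and
Harder-Narasimhan filtrations. -/
structure Slicing where
  /-- The subcategory of objects of phase `φ` (semistable or zero). -/
  P : ℝ → ObjectProperty C
  closedUnderIso : ∀ φ, (P φ).IsClosedUnderIsomorphisms
  containsZero : ∀ φ, (P φ).ContainsZero
  closedUnderSums : ∀ φ, (P φ).IsClosedUnderBinaryProducts
  shift_iff : ∀ φ (A : C), P (φ + 1) (A⟦(1 : ℤ)⟧) ↔ P φ A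
  hom_eq_zero : ∀ {φ₁ φ₂ : ℝ} {A₁ A₂ : C}, φ₂ < φ₁ → P φ₁ A₁ → P φ₂ A₂ →
    ∀ f : A₁ ⟶ A₂, f = 0
  exists_hn : ∀ A : C, Nonempty (HNFiltration C P A)

namespace Slicing

/-- The largest phase `φ⁺(A)` in the Harder-Narasimhan filtration of `A`
(the filtration is unique; the value is only meaningful for `A ≠ 0`). -/
def phiPlus (S : Slicing C) (A : C) : ℝ :=
  let F := Classical.choice (S.exists_hn A)
  if h : 0 < F.n then F.phase ⟨0, h⟩ else 0

/-- The smallest phase `φ⁻(A)` in the Harder-Narasimhan filtration of `A`. -/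
def phiMinus (S : Slicing C) (A : C) : ℝ :=
  let F := Classical.choice (S.exists_hn A)
  if h : 0 < F.n then F.phase ⟨F.n - 1, Nat.sub_lt h Nat.one_pos⟩ else 0

/-- The generalized distance between slicings, with values in `[0, ∞]`: the supremum over
nonzero objects of the differences of the extreme phases. -/
instance : PseudoEMetricSpace (Slicing C) where
  edist S T := ⨆ (A : C) (_ : ¬ IsZero A),
    max (edist (S.phiPlus A) (T.phiPlus A)) (edist (S.phiMinus A) (T.phiMinus A))
  edist_self S := by simp
  edist_comm S T := by simp only [edist_comm]
  edist_triangle S T R := by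
    refine iSup₂_le fun A hA => max_le ?_ ?_
    · refine (edist_triangle _ (T.phiPlus A) _).trans (add_le_add ?_ ?_)
      · exact (le_max_left _ _).trans (le_iSup₂_of_le A hA le_rfl)
      · exact (le_max_left _ _).trans (le_iSup₂_of_le A hA le_rfl)
    · refine (edist_triangle _ (T.phiMinus A) _).trans (add_le_add ?_ ?_)
      · exact (le_max_right _ _).trans (le_iSup₂_of_le A hA le_rfl)
      · exact (le_max_right _ _).trans (le_iSup₂_of_le A hA le_rfl)

end Slicing

end Category

section CentralCharge

variable {Λ : Type*} [AddCommGroup Λ]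

/-- The real-linear extension `Λ_ℝ = ℝ ⊗ Λ → ℂ` of a group homomorphism `Λ → ℂ`. -/
def extendReal (Z : Λ →+ ℂ) : ℝ ⊗[ℤ] Λ →ₗ[ℝ] ℂ :=
  LinearMap.liftBaseChange ℝ Z.toIntLinearMap

/-- The quadratic form `Q` is negative definite on the kernel of `Z_ℝ`. -/
def NegDefOnKer (Q : QuadraticForm ℝ (ℝ ⊗[ℤ] Λ)) (Z : Λ →+ ℂ) : Prop :=
  ∀ x : ℝ ⊗[ℤ] Λ, extendReal Z x = 0 → x ≠ 0 → Q x < 0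

variable [Module.Free ℤ Λ]

variable (Λ) in
/-- Evaluation on a basis of `Λ`. -/
def evalBasis : (Λ →+ ℂ) →ₗ[ℂ] (Module.Free.ChooseBasisIndex ℤ Λ → ℂ) where
  toFun Z i := Z (Module.Free.chooseBasis ℤ Λ i)
  map_add' _ _ := rfl
  map_smul' _ _ := rfl

theorem evalBasis_injective : Function.Injective (evalBasis Λ) := by
  intro Z Z' h
  have : Z.toIntLinearMap = Z'.toIntLinearMap :=
    (Module.Free.chooseBasis ℤ Λ).ext fun i => congrFun h i
  ext x
  exact LinearMap.congr_fun this x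

variable [Module.Finite ℤ Λ]

/-- A norm on the finite-dimensional complex vector space `Hom(Λ, ℂ)` (all norms on it are
equivalent): the maximum of the absolute values on a basis of `Λ`. -/
instance : NormedAddCommGroup (Λ →+ ℂ) :=
  NormedAddCommGroup.induced (Λ →+ ℂ) (Module.Free.ChooseBasisIndex ℤ Λ → ℂ)
    (evalBasis Λ) evalBasis_injective

instance : NormedSpace ℂ (Λ →+ ℂ) :=
  NormedSpace.induced ℂ (Λ →+ ℂ) (Module.Free.ChooseBasisIndex ℤ Λ → ℂ) (evalBasis Λ)

end CentralCharge

section Stability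

variable {C : Type u} [Category.{w} C] [HasZeroObject C] [HasShift C ℤ] [Preadditive C]
  [∀ n : ℤ, (shiftFunctor C n).Additive] [Pretriangulated C]
  {Λ : Type*} [AddCommGroup Λ]

/-- A stability precondition whose central charge factors through `v : K₀(C) → Λ`. -/
structure StabPrecondition (v : K0 C →+ Λ) where
  /-- The slicing. -/
  slicing : Slicing C
  /-- The central charge, as a homomorphism on `Λ`. -/
  Z : Λ →+ ℂ
  compat : ∀ (φ : ℝ) (A : C), slicing.P φ A → ¬ IsZero A →
    ∃ m : ℝ, 0 < m ∧ Z (v (K0.of A)) = m * Complex.exp (Real.pi * φ * Complex.I)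

namespace StabPrecondition

variable {v : K0 C →+ Λ}

/-- The `σ`-semistable objects: the nonzero objects of the categories `P φ`. -/
def IsSemistable (σ : StabPrecondition v) (A : C) : Prop :=
  ¬ IsZero A ∧ ∃ φ : ℝ, σ.slicing.P φ A

/-- The support property with respect to the quadratic form `Q`. -/
def SupportWrt (σ : StabPrecondition v) (Q : QuadraticForm ℝ (ℝ ⊗[ℤ] Λ)) : Prop :=
  NegDefOnKer Q σ.Z ∧ ∀ A : C, σ.IsSemistable A → 0 ≤ Q ((1 : ℝ) ⊗ₜ[ℤ] v (K0.of A))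

end StabPrecondition

/-- The set `Stab(C)` of stability conditions whose central charge factors through `v`:
the preconditions that have the support property for some quadratic form. -/
structure Stab (v : K0 C →+ Λ) extends StabPrecondition v where
  support : ∃ Q : QuadraticForm ℝ (ℝ ⊗[ℤ] Λ), toStabPrecondition.SupportWrt Q

/-- The projection `q` from `Stab(C)` to `Hom(Λ, ℂ)`. -/
def Stab.charge {v : K0 C →+ Λ} (σ : Stab v) : Λ →+ ℂ := σ.Z

variable [Module.Free ℤ Λ] [Module.Finite ℤ Λ]

/-- `Stab(C)` carries the topology of a subspace of the product of the space of slicings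
with `Hom(Λ, ℂ)`. -/
instance (v : K0 C →+ Λ) : TopologicalSpace (Stab v) :=
  TopologicalSpace.induced (fun σ => (σ.slicing, σ.charge)) inferInstance

end Stability

end Bridgeland

end

open Bridgeland

set_option linter.unusedSectionVars false

/-! Two facts carry the theorem. The first is rigidity: stability conditions with the same central
charge whose slicings are at distance less than 1 coincide (`Stab.eq_of_edist_lt_one`). The second
is uniform deformation: if `Q` is negative definite on the kernel of `Z₀`, there is a radius
depending only on `Q`, `Z₀` and `ε` such that any stability condition supported by `Q` with charge
in this ball can be deformed to any other charge in the ball, moving its slicing by at most `ε` and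
keeping the support property for the same `Q` (`exists_deformation`). The radius does not depend on
the stability condition over the ball. This gives disjoint sheets over the ball, and it makes
support by `Q` an open and relatively closed condition, so it holds on the whole component. A
topological lemma (`isCoveringMap_restrict_connectedComponentIn`) turns this into the covering
statement.

For the deformation, first keep the imaginary part of the charge. Then the heart `P(0, 1]` can be
kept as well, and the new charge `W` still sends its nonzero objects to the upper half plane. The
support property bounds the norm of the class of a subobject in terms of its charge, so an object of
the heart has only finitely many classes of subobjects in a left half plane
(`IsSmallDeformation.isStabFun`). This finiteness gives maximal destabilizing subobjects and
Harder-Narasimhan filtrations, hence a new slicing. A general deformation is a composite of two such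
steps: change the real part, rotate by a quarter turn, change what has become the real part, and
rotate back.

The support property survives by convexity. Let `E` be semistable for `W`, and list the classes of
its old Harder-Narasimhan factors by increasing old argument. Whenever two neighbours are not in
strictly increasing order for `W`, some charge on the segment from `Z` to `W` puts them on one ray,
and since `Q` is negative definite on its kernel, their sum again has `Q ≥ 0`. Merging such
neighbours ends with a list that is strictly increasing for `W`. Its tails are classes of subobjects
of `E`, so semistability leaves just one entry, the class of `E` (`quadraticForm_sum_nonneg`). -/

namespace Bridgeland

universe w u

/-! ### Distinguished triangles and the Grothendieck group -/

section Triangles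

variable {C : Type u} [Category.{w} C] [HasZeroObject C] [HasShift C ℤ] [Preadditive C]
  [∀ n : ℤ, (shiftFunctor C n).Additive] [Pretriangulated C]

/-- There is a distinguished triangle with the given vertices. -/
def IsTri (X Y Z : C) : Prop :=
  ∃ (f : X ⟶ Y) (g : Y ⟶ Z) (h : Z ⟶ X⟦(1 : ℤ)⟧), Triangle.mk f g h ∈ distTriang C

namespace IsTri

variable {X Y Z X' Y' Z' : C}

theorem of_mem {T : Triangle C} (h : T ∈ distTriang C) : IsTri T.obj₁ T.obj₂ T.obj₃ :=
  ⟨T.mor₁, T.mor₂, T.mor₃, h⟩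

theorem rotate (h : IsTri X Y Z) : IsTri Y Z (X⟦(1 : ℤ)⟧) := by
  obtain ⟨f, g, h, H⟩ := h
  exact of_mem (rot_of_distTriang _ H)

theorem invRotate (h : IsTri X Y Z) : IsTri (Z⟦(-1 : ℤ)⟧) X Y := by
  obtain ⟨f, g, h, H⟩ := h
  exact of_mem (inv_rot_of_distTriang _ H)

theorem shift (h : IsTri X Y Z) (n : ℤ) : IsTri (X⟦n⟧) (Y⟦n⟧) (Z⟦n⟧) := by
  obtain ⟨f, g, h, H⟩ := h
  exact of_mem (Triangle.shift_distinguished _ H n)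

theorem of_iso (h : IsTri X Y Z) (e₁ : X ≅ X') (e₂ : Y ≅ Y') (e₃ : Z ≅ Z') :
    IsTri X' Y' Z' := by
  obtain ⟨f, g, h, H⟩ := h
  refine ⟨e₁.inv ≫ f ≫ e₂.hom, e₂.inv ≫ g ≫ e₃.hom, e₃.inv ≫ h ≫ e₁.hom⟦1⟧', ?_⟩
  refine isomorphic_distinguished _ H _ ?_
  exact Triangle.isoMk _ _ e₁.symm e₂.symm e₃.symm
    (by change (e₁.inv ≫ f ≫ e₂.hom) ≫ e₂.inv = e₁.inv ≫ f; simp)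
    (by change (e₂.inv ≫ g ≫ e₃.hom) ≫ e₃.inv = e₂.inv ≫ g; simp)
    (by change (e₃.inv ≫ h ≫ e₁.hom⟦1⟧') ≫ e₁.inv⟦1⟧' = e₃.inv ≫ h; simp [← Functor.map_comp])

theorem of_isZero_left (hX : IsZero X) (e : Y ≅ Z) : IsTri X Y Z := by
  have h := contractible_distinguished₁ Y
  exact (of_mem h).of_iso ((isZero_zero C).iso hX) (Iso.refl Y) e

theorem of_isZero_right (hZ : IsZero Z) (e : X ≅ Y) : IsTri X Y Z :=
  (of_mem (contractible_distinguished X)).of_iso (Iso.refl X) e ((isZero_zero C).iso hZ)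

theorem nonempty_iso_right (h : IsTri X Y Z) (hX : IsZero X) : Nonempty (Y ≅ Z) := by
  obtain ⟨f, g, h, H⟩ := h
  have : IsIso g := (Triangle.isZero₁_iff_isIso₂ _ H).1 hX
  exact ⟨asIso g⟩

theorem nonempty_iso_left (h : IsTri X Y Z) (hZ : IsZero Z) : Nonempty (X ≅ Y) := by
  obtain ⟨f, g, h, H⟩ := h
  have : IsIso f := (Triangle.isZero₃_iff_isIso₁ _ H).1 hZ
  exact ⟨asIso f⟩

theorem hom_to_mid_eq_zero {T : C} (h : IsTri X Y Z) (h₁ : ∀ f : T ⟶ X, f = 0)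
    (h₂ : ∀ f : T ⟶ Z, f = 0) (f : T ⟶ Y) : f = 0 := by
  obtain ⟨a, b, c, H⟩ := h
  obtain ⟨g, rfl⟩ := Triangle.coyoneda_exact₂ _ H f (h₂ _)
  exact (congrArg (· ≫ a) (h₁ g)).trans zero_comp

theorem hom_from_mid_eq_zero {T : C} (h : IsTri X Y Z) (h₁ : ∀ f : X ⟶ T, f = 0)
    (h₂ : ∀ f : Z ⟶ T, f = 0) (f : Y ⟶ T) : f = 0 := by
  obtain ⟨a, b, c, H⟩ := h
  obtain ⟨g, rfl⟩ := Triangle.yoneda_exact₂ _ H f (h₁ _)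
  exact (congrArg (b ≫ ·) (h₂ g)).trans comp_zero

/-- If both outer morphisms into and out of the middle term vanish in the required degrees, the
first term of a distinguished triangle is zero. -/
theorem isZero_left (h : IsTri X Y Z) (h₁ : ∀ f : X ⟶ Y, f = 0)
    (h₂ : ∀ f : X ⟶ Z⟦(-1 : ℤ)⟧, f = 0) : IsZero X := by
  rw [IsZero.iff_id_eq_zero]
  exact h.invRotate.hom_to_mid_eq_zero h₂ h₁ _

theorem isZero_right (h : IsTri X Y Z) (h₁ : ∀ f : Y ⟶ Z, f = 0)
    (h₂ : ∀ f : X⟦(1 : ℤ)⟧ ⟶ Z, f = 0) : IsZero Z := by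
  rw [IsZero.iff_id_eq_zero]
  exact h.rotate.hom_from_mid_eq_zero h₁ h₂ _

variable [IsTriangulated C]

/-- A subobject of a subobject: the octahedron of `X' ⟶ X ⟶ Y`. -/
theorem comp_left {A B : C} (h : IsTri A X B) (h' : IsTri X Y Z) :
    ∃ W, IsTri A Y W ∧ IsTri B W Z := by
  obtain ⟨f, g, k, H⟩ := h
  obtain ⟨f', g', k', H'⟩ := h'
  obtain ⟨W, a, b, H''⟩ := distinguished_cocone_triangle (f ≫ f')
  have o := Triangulated.someOctahedron rfl H H' H''
  exact ⟨W, ⟨_, _, _, H''⟩, ⟨_, _, _, o.mem⟩⟩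

/-- A quotient of a quotient: the octahedron of `Y ⟶ Z ⟶ Z'`. -/
theorem comp_right {A B : C} (h : IsTri X Y Z) (h' : IsTri A Z B) :
    ∃ W, IsTri W Y B ∧ IsTri X W A := by
  obtain ⟨f, g, k, H⟩ := h
  obtain ⟨f', g', k', H'⟩ := h'
  obtain ⟨W, a, b, H''⟩ := distinguished_cocone_triangle₁ (g ≫ g')
  have o := Triangulated.someOctahedron' rfl H H' H''
  exact ⟨W, ⟨_, _, _, H''⟩, ⟨_, _, _, o.mem⟩⟩

/-- A morphism into the middle term which dies in the third term lifts to the first one; the cones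
form a distinguished triangle. -/
theorem lift {A B : C} (h : IsTri X Y Z) (h' : IsTri A Y B) (h₀ : ∀ f : A ⟶ Z, f = 0) :
    ∃ W, IsTri A X W ∧ IsTri W B Z := by
  obtain ⟨f, g, k, H⟩ := h
  obtain ⟨f', g', k', H'⟩ := h'
  obtain ⟨l, hl⟩ := Triangle.coyoneda_exact₂ _ H f' (h₀ _)
  obtain ⟨W, a, b, H''⟩ := distinguished_cocone_triangle l
  have o := Triangulated.someOctahedron hl.symm H'' H H'
  exact ⟨W, ⟨_, _, _, H''⟩, ⟨_, _, _, o.mem⟩⟩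

end IsTri

/-- A morphism `f : X ⟶ Y` whose cone is an extension of `Q` by `K⟦1⟧` factors through an object
`I` with `I ⟶ Y ⟶ Q` and `K ⟶ X ⟶ I` distinguished. -/
theorem exists_image_factorization [IsTriangulated C] {X Y Z K' Q : C} {f : X ⟶ Y} {g : Y ⟶ Z}
    {h : Z ⟶ X⟦(1 : ℤ)⟧} (H : Triangle.mk f g h ∈ distTriang C) (hZ : IsTri K' Z Q) :
    ∃ (I : C) (p : X ⟶ I) (i : I ⟶ Y), p ≫ i = f ∧ IsTri I Y Q ∧ IsTri X I K' := by
  obtain ⟨a, b, c, H'⟩ := hZ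
  obtain ⟨I, i, k, H''⟩ := distinguished_cocone_triangle₁ (g ≫ b)
  have o := Triangulated.someOctahedron' rfl H H' H''
  exact ⟨I, o.m₁, i, o.comm₁, ⟨_, _, _, H''⟩, ⟨_, _, _, o.mem⟩⟩

namespace K0

theorem of_add {X Y Z : C} (h : IsTri X Y Z) : K0.of Y = K0.of X + K0.of Z := by
  obtain ⟨f, g, k, H⟩ := h
  have : (FreeAbelianGroup.of Y - (FreeAbelianGroup.of X + FreeAbelianGroup.of Z)) ∈
      K0Relations C := AddSubgroup.subset_closure ⟨_, H, rfl⟩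
  rw [← QuotientAddGroup.eq_zero_iff] at this
  exact sub_eq_zero.1 this

theorem of_isZero {X : C} (h : IsZero X) : K0.of X = 0 := by
  have := of_add (IsTri.of_isZero_left h (Iso.refl X))
  simpa using this

theorem of_iso {X Y : C} (e : X ≅ Y) : K0.of X = K0.of Y := by
  have := of_add (IsTri.of_isZero_left (isZero_zero C) e)
  rw [this, of_isZero (isZero_zero C), zero_add]

theorem of_shift_one (X : C) : K0.of (X⟦(1 : ℤ)⟧) = -K0.of X := by
  have := of_add (IsTri.of_isZero_right (isZero_zero C) (Iso.refl X)).rotate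
  rw [of_isZero (isZero_zero C)] at this
  exact (neg_eq_of_add_eq_zero_right this.symm).symm

theorem of_shift (X : C) (n : ℤ) : K0.of (X⟦n⟧) = n.negOnePow • K0.of X := by
  induction n using Int.induction_on with
  | zero => simpa using of_iso ((shiftFunctorZero C ℤ).app X)
  | succ n ih =>
    rw [of_iso ((shiftFunctorAdd' C (n : ℤ) 1 (n + 1) rfl).app X)]
    simp only [Functor.comp_obj]
    rw [of_shift_one, ih, Int.negOnePow_succ, Units.neg_smul]
  | pred n ih =>
    have := of_iso ((shiftFunctorAdd' C (-(n : ℤ) - 1) 1 (-n) (by ring)).app X)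
    simp only [Functor.comp_obj] at this
    rw [of_shift_one, ih] at this
    rw [← neg_eq_iff_eq_neg.2 this, Int.negOnePow_sub, Int.negOnePow_one, mul_neg, mul_one,
      Units.neg_smul]

end K0

end Triangles

/-! ### Orthogonality and Harder-Narasimhan filtrations as an inductive predicate -/

section Filtrations

variable {C : Type u} [Category.{w} C] [HasZeroObject C] [HasShift C ℤ] [Preadditive C]
  [∀ n : ℤ, (shiftFunctor C n).Additive] [Pretriangulated C]

/-- The objects that receive no nonzero morphisms from the objects of phase in `I`. -/
def rOrth (P : ℝ → ObjectProperty C) (I : Set ℝ) (A : C) : Prop :=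
  ∀ φ ∈ I, ∀ X, P φ X → ∀ f : X ⟶ A, f = 0

/-- The objects without nonzero morphisms to the objects of phase in `I`. -/
def lOrth (P : ℝ → ObjectProperty C) (I : Set ℝ) (A : C) : Prop :=
  ∀ φ ∈ I, ∀ X, P φ X → ∀ f : A ⟶ X, f = 0

/-- Harder-Narasimhan filtrations as an inductive predicate: the phases are listed increasingly,
the head being the phase of the last factor. -/
inductive Filt (P : ℝ → ObjectProperty C) : List ℝ → C → Prop
  | zero {A : C} (h : IsZero A) : Filt P [] A
  | cons {A' A E : C} {φ : ℝ} {l : List ℝ} (h : IsTri A' A E) (hE : P φ E) (hE₀ : ¬ IsZero E)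
      (hφ : ∀ ψ ∈ l, φ < ψ) (hA' : Filt P l A') : Filt P (φ :: l) A

section Orth

variable {P : ℝ → ObjectProperty C} {I J : Set ℝ} {X Y Z : C}

theorem rOrth.mid (h : IsTri X Y Z) (hX : rOrth P I X) (hZ : rOrth P I Z) : rOrth P I Y :=
  fun φ hφ T hT => h.hom_to_mid_eq_zero (hX φ hφ T hT) (hZ φ hφ T hT)

theorem lOrth.mid (h : IsTri X Y Z) (hX : lOrth P I X) (hZ : lOrth P I Z) : lOrth P I Y :=
  fun φ hφ T hT => h.hom_from_mid_eq_zero (hX φ hφ T hT) (hZ φ hφ T hT)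

theorem rOrth.of_isZero (h : IsZero X) : rOrth P I X := fun _ _ _ _ _ => h.eq_of_tgt _ _

theorem lOrth.of_isZero (h : IsZero X) : lOrth P I X := fun _ _ _ _ _ => h.eq_of_src _ _

theorem rOrth.mono (h : rOrth P I X) (hJ : J ⊆ I) : rOrth P J X := fun φ hφ => h φ (hJ hφ)

theorem lOrth.mono (h : lOrth P I X) (hJ : J ⊆ I) : lOrth P J X := fun φ hφ => h φ (hJ hφ)

theorem rOrth.of_iso (h : rOrth P I X) (e : X ≅ Y) : rOrth P I Y :=
  rOrth.mid (IsTri.of_isZero_right (isZero_zero C) e) h (rOrth.of_isZero (isZero_zero C))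

theorem lOrth.of_iso (h : lOrth P I X) (e : X ≅ Y) : lOrth P I Y :=
  lOrth.mid (IsTri.of_isZero_right (isZero_zero C) e) h (lOrth.of_isZero (isZero_zero C))

end Orth

namespace Filt

variable {P : ℝ → ObjectProperty C} {l l₁ l₂ : List ℝ} {A B D : C}

theorem of_iso (h : Filt P l A) (e : A ≅ B) : Filt P l B := by
  cases h with
  | zero h => exact zero (h.of_iso e.symm)
  | cons h hE hE₀ hφ hA' => exact cons (h.of_iso (Iso.refl _) e (Iso.refl _)) hE hE₀ hφ hA'

theorem isZero_of_nil (h : Filt P [] A) : IsZero A := by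
  cases h; assumption

theorem singleton {φ : ℝ} (hA : P φ A) (h₀ : ¬ IsZero A) : Filt P [φ] A :=
  cons (IsTri.of_isZero_left (isZero_zero C) (Iso.refl A)) hA h₀ (by simp)
    (zero (isZero_zero C))

theorem rOrth_of_factors {P' : ℝ → ObjectProperty C} {I : Set ℝ} (h : Filt P l A)
    (hP : ∀ φ ∈ l, ∀ X, P φ X → rOrth P' I X) : rOrth P' I A := by
  induction h with
  | zero h => exact rOrth.of_isZero h
  | cons h hE hE₀ hφ hA' ih =>
    exact rOrth.mid h (ih fun ψ hψ => hP ψ (by simp [hψ])) (hP _ (by simp) _ hE)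

theorem lOrth_of_factors {P' : ℝ → ObjectProperty C} {I : Set ℝ} (h : Filt P l A)
    (hP : ∀ φ ∈ l, ∀ X, P φ X → lOrth P' I X) : lOrth P' I A := by
  induction h with
  | zero h => exact lOrth.of_isZero h
  | cons h hE hE₀ hφ hA' ih =>
    exact lOrth.mid h (ih fun ψ hψ => hP ψ (by simp [hψ])) (hP _ (by simp) _ hE)

/-- A property of classes that is closed under addition passes from the factors of a filtration
to the filtered object. -/
theorem class_induction {G : Type*} [AddCommGroup G] (c : K0 C →+ G) {D : G → Prop}
    (hD : ∀ x y, D x → D y → D (x + y)) (h : Filt P l A)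
    (hP : ∀ φ ∈ l, ∀ X, P φ X → ¬ IsZero X → D (c (K0.of X))) (hA : ¬ IsZero A) :
    D (c (K0.of A)) := by
  induction h with
  | zero h => exact absurd h hA
  | @cons A' A E φ l h hE hE₀ hφ hA' ih =>
    have hE' := hP _ (by simp) _ hE hE₀
    rw [K0.of_add h, map_add]
    by_cases h' : IsZero A'
    · rwa [K0.of_isZero h', map_zero, zero_add]
    · exact hD _ _ (ih (fun ψ hψ => hP ψ (by simp [hψ])) h') hE'

variable [IsTriangulated C]

/-- Induction on the filtration of the quotient: the octahedron of `B ⟶ D ⟶ E`, with `E` the last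
factor of `D`, presents `B` as an extension of `E` by an object `W`, which is itself an extension of
`D'` by `A`. -/
theorem append (h : IsTri A B D) (hA : Filt P l₂ A) (hD : Filt P l₁ D)
    (hl : ∀ φ ∈ l₁, ∀ ψ ∈ l₂, φ < ψ) : Filt P (l₁ ++ l₂) B := by
  induction hD generalizing B with
  | zero h₀ =>
    obtain ⟨e⟩ := h.nonempty_iso_left h₀
    exact hA.of_iso e
  | @cons D' D E φ l h' hE hE₀ hφ hD' ih =>
    obtain ⟨W, hW, hW'⟩ := h.comp_right h'
    refine cons hW hE hE₀ ?_ (ih hW' fun φ hφ => hl φ (by simp [hφ]))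
    intro ψ hψ
    rcases List.mem_append.1 hψ with hψ | hψ
    · exact hφ ψ hψ
    · exact hl φ (by simp) ψ hψ

/-- A filtration can be cut at any upper set of phases. -/
theorem split {U : Set ℝ} (hU : IsUpperSet U) (h : Filt P l A) :
    ∃ (l₁ l₂ : List ℝ) (T F : C), l = l₁ ++ l₂ ∧ (∀ φ ∈ l₁, φ ∉ U) ∧ (∀ φ ∈ l₂, φ ∈ U) ∧
      IsTri T A F ∧ Filt P l₂ T ∧ Filt P l₁ F := by
  induction h with
  | zero h => exact ⟨[], [], _, _, rfl, by simp, by simp, IsTri.of_isZero_left h (Iso.refl _),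
      zero h, zero h⟩
  | @cons A' A E φ l h hE hE₀ hφ hA' ih =>
    by_cases hU' : φ ∈ U
    · refine ⟨[], φ :: l, A, _, rfl, by simp, ?_, IsTri.of_isZero_right (isZero_zero C)
        (Iso.refl _), cons h hE hE₀ hφ hA', zero (isZero_zero C)⟩
      intro ψ hψ
      rcases List.mem_cons.1 hψ with rfl | hψ
      · exact hU'
      · exact hU (hφ ψ hψ).le hU'
    · obtain ⟨l₁, l₂, T, F, rfl, h₁, h₂, hT, hl₂, hl₁⟩ := ih
      obtain ⟨W, hW, hW'⟩ := hT.comp_left h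
      refine ⟨φ :: l₁, l₂, T, W, rfl, ?_, h₂, hW, hl₂,
        cons hW' hE hE₀ (fun ψ hψ => hφ ψ (by simp [hψ])) hl₁⟩
      intro ψ hψ
      rcases List.mem_cons.1 hψ with rfl | hψ
      · exact hU'
      · exact h₁ ψ hψ

end Filt

/-- The inductive form of a Harder-Narasimhan filtration. -/
theorem HNFiltration.exists_filt {P : ℝ → ObjectProperty C} {A : C} (F : HNFiltration C P A) :
    ∃ l, Filt P l A ∧ ∀ x, x ∈ l ↔ ∃ i, F.phase i = x := by
  have key : ∀ k (hk : k < F.n + 1), ∃ l, Filt P l (F.obj ⟨k, hk⟩) ∧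
      ∀ x, x ∈ l ↔ ∃ i : Fin F.n, i.1 < k ∧ F.phase i = x := by
    intro k
    induction k with
    | zero => exact fun hk => ⟨[], .zero F.isZero_zero, by simp⟩
    | succ k ih =>
      intro hk
      obtain ⟨l, hl, hl'⟩ := ih (by omega)
      have hk' : k < F.n := by omega
      refine ⟨F.phase ⟨k, hk'⟩ :: l, .cons (F.triangle ⟨k, hk'⟩) (F.factor_mem _)
        (F.factor_nonzero _) ?_ hl, ?_⟩
      · intro ψ hψ
        obtain ⟨i, hi, rfl⟩ := (hl' ψ).1 hψ
        exact F.phase_strictAnti hi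
      · intro x
        simp only [List.mem_cons, hl']
        constructor
        · rintro (rfl | ⟨i, hi, rfl⟩)
          · exact ⟨_, Nat.lt_succ_self k, rfl⟩
          · exact ⟨i, by omega, rfl⟩
        · rintro ⟨i, hi, rfl⟩
          rcases Nat.lt_succ_iff_lt_or_eq.1 hi with h | h
          · exact .inr ⟨i, h, rfl⟩
          · left; congr 1; exact Fin.ext h
  obtain ⟨l, hl, hl'⟩ := key F.n (by omega)
  exact ⟨l, hl.of_iso F.lastIso, fun x => by simp [hl']⟩

/-- A Harder-Narasimhan filtration from its inductive form. -/
theorem Filt.exists_hnFiltration {P : ℝ → ObjectProperty C} {A : C} {l : List ℝ}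
    (h : Filt P l A) : ∃ F : HNFiltration C P A, ∀ i, F.phase i ∈ l := by
  induction h with
  | @zero A h =>
    exact ⟨⟨0, Fin.elim0, fun _ => A, Fin.elim0, fun i => i.elim0, h, Iso.refl _,
      fun i => i.elim0, fun i => i.elim0, fun i => i.elim0⟩, fun i => i.elim0⟩
  | @cons A' A E φ l h hE hE₀ hφ hA' ih =>
    obtain ⟨F, hF⟩ := ih
    refine ⟨⟨F.n + 1, Fin.snoc F.phase φ, Fin.snoc (α := fun _ => C) F.obj A,
      Fin.snoc (α := fun _ => C) F.factor E, ?_, ?_, ?_, ?_, ?_, ?_⟩, ?_⟩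
    · intro i j hij
      induction j using Fin.lastCases with
      | last =>
        induction i using Fin.lastCases with
        | last => exact absurd hij (lt_irrefl _)
        | cast i => simpa using hφ _ (hF i)
      | cast j =>
        induction i using Fin.lastCases with
        | last => exact absurd hij (Fin.le_last _).not_gt
        | cast i => simpa using F.phase_strictAnti (by simpa using hij)
    · have : (0 : Fin (F.n + 1 + 1)) = Fin.castSucc 0 := rfl
      rw [this, Fin.snoc_castSucc]
      exact F.isZero_zero
    · rw [Fin.snoc_last]
    · intro i
      change IsTri _ _ _
      induction i using Fin.lastCases with
      | last =>
        rw [Fin.succ_last, Fin.snoc_last, Fin.snoc_last, Fin.snoc_castSucc]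
        exact h.of_iso F.lastIso.symm (Iso.refl _) (Iso.refl _)
      | cast i =>
        rw [Fin.succ_castSucc, Fin.snoc_castSucc, Fin.snoc_castSucc, Fin.snoc_castSucc]
        exact F.triangle i
    · intro i
      induction i using Fin.lastCases with
      | last => simpa only [Fin.snoc_last] using hE
      | cast i => simpa only [Fin.snoc_castSucc] using F.factor_mem i
    · intro i
      induction i using Fin.lastCases with
      | last => simpa only [Fin.snoc_last] using hE₀
      | cast i => simpa only [Fin.snoc_castSucc] using F.factor_nonzero i
    · intro i
      dsimp only
      induction i using Fin.lastCases with
      | last => simp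
      | cast i => simp [hF i]

end Filtrations

end Bridgeland

namespace Bridgeland

universe w u

/-! ### Slicings without the sum axiom, and truncation -/

section PreSlicing

variable {C : Type u} [Category.{w} C] [HasZeroObject C] [HasShift C ℤ] [Preadditive C]
  [∀ n : ℤ, (shiftFunctor C n).Additive] [Pretriangulated C]

/-- The axioms of a slicing except for the closure under direct sums, which follows from them. -/
structure IsPreSlicing (P : ℝ → ObjectProperty C) : Prop where
  of_iso : ∀ {φ : ℝ} {X Y : C}, (X ≅ Y) → P φ X → P φ Y
  of_isZero : ∀ (φ : ℝ) {X : C}, IsZero X → P φ X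
  shift_iff : ∀ (φ : ℝ) (A : C), P (φ + 1) (A⟦(1 : ℤ)⟧) ↔ P φ A
  hom_eq_zero : ∀ {φ₁ φ₂ : ℝ} {A₁ A₂ : C}, φ₂ < φ₁ → P φ₁ A₁ → P φ₂ A₂ → ∀ f : A₁ ⟶ A₂, f = 0
  exists_filt : ∀ A : C, ∃ l, Filt P l A

theorem Slicing.isPreSlicing (S : Slicing C) : IsPreSlicing S.P where
  of_iso {φ X Y} e h := by
    have := S.closedUnderIso φ
    exact (S.P φ).prop_of_iso e h
  of_isZero φ X h := by
    have := S.closedUnderIso φ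
    obtain ⟨Z, hZ, hZ'⟩ := (S.containsZero φ).exists_zero
    exact (S.P φ).prop_of_iso (hZ.iso h) hZ'
  shift_iff := S.shift_iff
  hom_eq_zero := S.hom_eq_zero
  exists_filt A := by
    obtain ⟨l, hl, -⟩ := (S.exists_hn A).some.exists_filt
    exact ⟨l, hl⟩

/-- Objects are isomorphic to the shift of their desuspension. -/
def shiftNegIso (X : C) (n : ℤ) : (X⟦-n⟧)⟦n⟧ ≅ X := shiftNegShift X n

theorem isZero_shift_iff (X : C) (n : ℤ) : IsZero (X⟦n⟧) ↔ IsZero X := by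
  constructor
  · intro h
    exact ((shiftFunctor C (-n)).map_isZero h).of_iso (shiftShiftNeg X n).symm
  · exact (shiftFunctor C n).map_isZero

namespace IsPreSlicing

variable {P : ℝ → ObjectProperty C} (hP : IsPreSlicing P)
include hP

theorem shift_int_iff (φ : ℝ) (A : C) (n : ℤ) : P (φ + n) (A⟦n⟧) ↔ P φ A := by
  have iso_iff : ∀ {φ : ℝ} {X Y : C}, (X ≅ Y) → (P φ X ↔ P φ Y) :=
    fun e => ⟨hP.of_iso e, hP.of_iso e.symm⟩
  induction n using Int.induction_on generalizing φ with
  | zero =>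
    rw [Int.cast_zero, add_zero]
    exact iso_iff ((shiftFunctorZero C ℤ).app A)
  | succ n ih =>
    refine Iff.trans ?_ (ih φ)
    rw [iso_iff ((shiftFunctorAdd' C (n : ℤ) 1 (n + 1) rfl).app A)]
    push_cast
    rw [← add_assoc]
    exact hP.shift_iff _ _
  | pred n ih =>
    refine Iff.trans ?_ (ih φ)
    rw [iso_iff ((shiftFunctorAdd' C (-(n : ℤ) - 1) 1 (-n) (by ring)).app A), ← hP.shift_iff]
    push_cast
    rw [add_assoc, sub_add_cancel]
    rfl

theorem shift (n : ℤ) {φ : ℝ} {A : C} (h : P φ A) : P (φ + n) (A⟦n⟧) :=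
  (hP.shift_int_iff φ A n).2 h

theorem rOrth_shift {I : Set ℝ} {A : C} (h : rOrth P I A) (n : ℤ) :
    rOrth P {φ | φ - n ∈ I} (A⟦n⟧) := by
  intro φ hφ X hX f
  have h₁ : P (φ - n) (X⟦-n⟧) := by
    have := hP.shift (-n) hX
    push_cast at this
    rwa [← sub_eq_add_neg] at this
  have h₂ := h _ hφ _ h₁ (f⟦-n⟧' ≫ (shiftShiftNeg A n).hom)
  have h₃ : f⟦-n⟧' = 0 := by
    rw [← cancel_mono (shiftShiftNeg A n).hom, h₂, zero_comp]
  exact (shiftFunctor C (-n)).map_injective (by rw [h₃, Functor.map_zero])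

theorem lOrth_shift {I : Set ℝ} {A : C} (h : lOrth P I A) (n : ℤ) :
    lOrth P {φ | φ - n ∈ I} (A⟦n⟧) := by
  intro φ hφ X hX f
  have h₁ : P (φ - n) (X⟦-n⟧) := by
    have := hP.shift (-n) hX
    push_cast at this
    rwa [← sub_eq_add_neg] at this
  have h₂ := h _ hφ _ h₁ ((shiftShiftNeg A n).inv ≫ f⟦-n⟧')
  have h₃ : f⟦-n⟧' = 0 := by
    rw [← cancel_epi (shiftShiftNeg A n).inv, h₂, comp_zero]
  exact (shiftFunctor C (-n)).map_injective (by rw [h₃, Functor.map_zero])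

omit hP in
theorem _root_.Bridgeland.Filt.shift {P P' : ℝ → ObjectProperty C} {l : List ℝ} {A : C} (n : ℤ)
    (h : Filt P l A) (hPP' : ∀ φ ∈ l, ∀ X, P φ X → P' (φ + n) (X⟦n⟧)) :
    Filt P' (l.map (· + (n : ℝ))) (A⟦n⟧) := by
  induction h with
  | zero h => exact .zero ((isZero_shift_iff _ _).2 h)
  | cons h hE hE₀ hφ hA' ih =>
    refine .cons (h.shift n) (hPP' _ (by simp) _ hE) (by rwa [isZero_shift_iff]) ?_
      (ih fun ψ hψ => hPP' ψ (by simp [hψ]))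
    intro ψ hψ
    obtain ⟨x, hx, rfl⟩ := List.mem_map.1 hψ
    simpa using hφ x hx

theorem filt_shift {l : List ℝ} {A : C} (h : Filt P l A) (n : ℤ) :
    Filt P (l.map (· + (n : ℝ))) (A⟦n⟧) :=
  h.shift n fun _ _ _ hX => hP.shift n hX

theorem rOrth_of_mem {φ : ℝ} {X : C} (h : P φ X) {U : Set ℝ} (hU : ∀ ψ ∈ U, φ < ψ) :
    rOrth P U X := fun ψ hψ _ hT f => hP.hom_eq_zero (hU ψ hψ) hT h f

theorem lOrth_of_mem {φ : ℝ} {X : C} (h : P φ X) {U : Set ℝ} (hU : ∀ ψ ∈ U, ψ < φ) :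
    lOrth P U X := fun ψ hψ _ hT f => hP.hom_eq_zero (hU ψ hψ) h hT f

theorem rOrth_of_filt {l : List ℝ} {A : C} (h : Filt P l A) {U : Set ℝ}
    (hU : ∀ φ ∈ l, ∀ ψ ∈ U, φ < ψ) : rOrth P U A :=
  h.rOrth_of_factors fun φ hφ _ hX => hP.rOrth_of_mem hX (hU φ hφ)

theorem lOrth_of_filt {l : List ℝ} {A : C} (h : Filt P l A) {U : Set ℝ}
    (hU : ∀ φ ∈ l, ∀ ψ ∈ U, ψ < φ) : lOrth P U A :=
  h.lOrth_of_factors fun φ hφ _ hX => hP.lOrth_of_mem hX (hU φ hφ)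

omit hP in
theorem _root_.Bridgeland.Filt.hom_eq_zero {l : List ℝ} {A B : C} (h : Filt P l A) {U : Set ℝ}
    (hU : ∀ φ ∈ l, φ ∈ U) (hB : rOrth P U B) (f : A ⟶ B) : f = 0 := by
  induction h with
  | zero h => exact h.eq_of_src _ _
  | cons h hE hE₀ hφ hA' ih =>
    exact h.hom_from_mid_eq_zero (ih fun ψ hψ => hU ψ (by simp [hψ]))
      (hB _ (hU _ (by simp)) _ hE) f

/-- If `A` were zero, the last factor `E` would be isomorphic to `A'⟦1⟧`. All phases of `A'⟦1⟧`
exceed `φ`, so it has no nonzero morphism to `E`, and `E` would vanish. -/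
theorem not_isZero_of_filt {φ : ℝ} {l : List ℝ} {A : C} (h : Filt P (φ :: l) A) :
    ¬ IsZero A := by
  intro hA
  cases h with
  | cons h hE hE₀ hφ hA' =>
    refine hE₀ (h.isZero_right (fun f => hA.eq_of_src _ _) ?_)
    refine (hP.filt_shift hA' 1).hom_eq_zero (U := Set.Ioi φ) ?_
      (hP.rOrth_of_mem hE fun ψ hψ => hψ)
    intro ψ hψ
    obtain ⟨x, hx, rfl⟩ := List.mem_map.1 hψ
    have := hφ x hx
    simp only [Int.cast_one, Set.mem_Ioi]
    linarith

theorem eq_nil_of_isZero {l : List ℝ} {A : C} (h : Filt P l A) (hA : IsZero A) : l = [] := by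
  cases l with
  | nil => rfl
  | cons φ l => exact absurd hA (hP.not_isZero_of_filt h)

omit hP in
theorem _root_.Bridgeland.Filt.ne_nil {l : List ℝ} {A : C} (h : Filt P l A)
    (hA : ¬ IsZero A) : l ≠ [] := by
  rintro rfl
  exact hA h.isZero_of_nil

variable [IsTriangulated C]

/-- The phases of an object of the left half of a torsion pair. -/
theorem mem_of_lOrth {l : List ℝ} {A : C} (h : Filt P l A) {U : Set ℝ} (hU : IsUpperSet U)
    (hA : lOrth P Uᶜ A) : ∀ φ ∈ l, φ ∈ U := by
  obtain ⟨l₁, l₂, T, F, rfl, h₁, h₂, hT, hl₂, hl₁⟩ := h.split hU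
  have hFU : rOrth P U F := hP.rOrth_of_filt hl₁ fun φ hφ ψ hψ => by
    by_contra! hle
    exact h₁ φ hφ (hU hle hψ)
  -- The triangle `T ⟶ A ⟶ F` kills `F` once both `A ⟶ F` and `T⟦1⟧ ⟶ F` are zero: the first by the
  -- orthogonality of `A`, the second because the phases of `T⟦1⟧` are still in `U`.
  have hF : IsZero F := by
    refine hT.isZero_right ?_ ?_
    · have : ∀ (l : List ℝ) (X : C), Filt P l X → (∀ φ ∈ l, φ ∉ U) → ∀ f : A ⟶ X, f = 0 := by
        intro l X hX hl
        induction hX with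
        | zero h => exact fun f => h.eq_of_tgt _ _
        | cons h hE hE₀ hφ hA' ih =>
          exact h.hom_to_mid_eq_zero (ih fun ψ hψ => hl ψ (by simp [hψ]))
            (hA _ (hl _ (by simp)) _ hE)
      exact this _ _ hl₁ h₁
    · refine (hP.filt_shift hl₂ 1).hom_eq_zero (U := U) ?_ hFU
      intro ψ hψ
      obtain ⟨x, hx, rfl⟩ := List.mem_map.1 hψ
      exact hU (by simp) (h₂ x hx)
  rw [hP.eq_nil_of_isZero hl₁ hF]
  exact h₂

/-- The phases of an object of the right half of a torsion pair. -/
theorem notMem_of_rOrth {l : List ℝ} {A : C} (h : Filt P l A) {U : Set ℝ} (hU : IsUpperSet U)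
    (hA : rOrth P U A) : ∀ φ ∈ l, φ ∉ U := by
  obtain ⟨l₁, l₂, T, F, rfl, h₁, h₂, hT, hl₂, hl₁⟩ := h.split hU
  have hFU : rOrth P U F := hP.rOrth_of_filt hl₁ fun φ hφ ψ hψ => by
    by_contra! hle
    exact h₁ φ hφ (hU hle hψ)
  have hT : IsZero T := by
    refine hT.isZero_left (hl₂.hom_eq_zero h₂ hA) (hl₂.hom_eq_zero h₂ ?_)
    refine (hP.rOrth_shift hFU (-1)).mono fun φ hφ => ?_
    refine hU ?_ hφ
    simp
  rw [hP.eq_nil_of_isZero hl₂ hT, List.append_nil]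
  exact h₁

theorem hom_eq_zero_of_orth {U : Set ℝ} (hU : IsUpperSet U) {A B : C} (hA : lOrth P Uᶜ A)
    (hB : rOrth P U B) (f : A ⟶ B) : f = 0 := by
  obtain ⟨l, hl⟩ := hP.exists_filt A
  exact hl.hom_eq_zero (hP.mem_of_lOrth hl hU hA) hB f

/-- The truncation triangle at an upper set of phases. -/
theorem exists_truncation {U : Set ℝ} (hU : IsUpperSet U) (A : C) :
    ∃ T F, IsTri T A F ∧ lOrth P Uᶜ T ∧ rOrth P U F := by
  obtain ⟨l, hl⟩ := hP.exists_filt A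
  obtain ⟨l₁, l₂, T, F, rfl, h₁, h₂, hT, hl₂, hl₁⟩ := hl.split hU
  refine ⟨T, F, hT, hP.lOrth_of_filt hl₂ fun φ hφ ψ hψ => ?_,
    hP.rOrth_of_filt hl₁ fun φ hφ ψ hψ => ?_⟩
  · by_contra! hle
    exact hψ (hU hle (h₂ φ hφ))
  · by_contra! hle
    exact h₁ φ hφ (hU hle hψ)

/-- The objects of a single phase are determined by orthogonality. -/
theorem mem_of_orth {φ : ℝ} {A : C} (h₁ : rOrth P (Set.Ioi φ) A) (h₂ : lOrth P (Set.Iio φ) A) :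
    P φ A := by
  obtain ⟨l, hl⟩ := hP.exists_filt A
  have hl₁ := hP.notMem_of_rOrth hl (isUpperSet_Ioi φ) h₁
  have hl₂ := hP.mem_of_lOrth hl (isUpperSet_Ici φ) (by rwa [Set.compl_Ici])
  cases hl with
  | zero h => exact hP.of_isZero φ h
  | @cons A' _ E ψ l h hE hE₀ hφ hA' =>
    have hψ : ψ = φ := le_antisymm (not_lt.1 (hl₁ ψ (by simp))) (hl₂ ψ (by simp))
    subst hψ
    have : l = [] := by
      cases l with
      | nil => rfl
      | cons x l => exact absurd (hφ x (by simp)) (hl₁ x (by simp))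
    subst this
    obtain ⟨e⟩ := h.nonempty_iso_right hA'.isZero_of_nil
    exact hP.of_iso e.symm hE

theorem mem_of_isTri {φ : ℝ} {X Y Z : C} (h : IsTri X Y Z) (hX : P φ X) (hZ : P φ Z) :
    P φ Y :=
  hP.mem_of_orth
    (rOrth.mid h (hP.rOrth_of_mem hX fun _ h => h) (hP.rOrth_of_mem hZ fun _ h => h))
    (lOrth.mid h (hP.lOrth_of_mem hX fun _ h => h) (hP.lOrth_of_mem hZ fun _ h => h))

/-- The slicing given by its axioms other than the closure under sums. -/
def toSlicing : Slicing C where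
  P := P
  closedUnderIso φ := ⟨fun e h => hP.of_iso e h⟩
  containsZero φ := ⟨⟨_, isZero_zero C, hP.of_isZero φ (isZero_zero C)⟩⟩
  closedUnderSums φ := by
    have : (P φ).IsClosedUnderIsomorphisms := ⟨fun e h => hP.of_iso e h⟩
    refine ⟨?_⟩
    rintro X ⟨p⟩
    -- A direct sum is the middle term of a split triangle, so closure under extensions suffices.
    refine hP.of_iso ?_ (hP.mem_of_isTri
      (IsTri.of_mem (binaryProductTriangle_distinguished _ _)) (p.prop_diag_obj ⟨.left⟩)
      (p.prop_diag_obj ⟨.right⟩))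
    exact IsLimit.conePointUniqueUpToIso (prodIsProd _ _)
      ((IsLimit.postcomposeHomEquiv (diagramIsoPair p.diag) _).2 p.isLimit)
  shift_iff := hP.shift_iff
  hom_eq_zero := hP.hom_eq_zero
  exists_hn A := by
    obtain ⟨l, hl⟩ := hP.exists_filt A
    obtain ⟨F, -⟩ := hl.exists_hnFiltration
    exact ⟨F⟩

end IsPreSlicing

end PreSlicing

end Bridgeland

namespace Bridgeland

universe w u

/-! ### Extreme phases and the distance of slicings -/

section Phases

variable {C : Type u} [Category.{w} C] [HasZeroObject C] [HasShift C ℤ] [Preadditive C]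
  [∀ n : ℤ, (shiftFunctor C n).Additive] [Pretriangulated C]

namespace Slicing

variable (S T : Slicing C) {A : C}

/-- A filtration that realizes the extreme phases. -/
theorem exists_filt_phi (hA : ¬ IsZero A) :
    ∃ l, Filt S.P l A ∧ S.phiPlus A ∈ l ∧ S.phiMinus A ∈ l ∧
      (∀ x ∈ l, x ≤ S.phiPlus A) ∧ ∀ x ∈ l, S.phiMinus A ≤ x := by
  obtain ⟨l, hl, hl'⟩ := (Classical.choice (S.exists_hn A)).exists_filt
  have hn : 0 < (Classical.choice (S.exists_hn A)).n := by
    by_contra! h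
    refine hl.ne_nil hA (List.eq_nil_iff_forall_not_mem.2 fun x hx => ?_)
    obtain ⟨i, -⟩ := (hl' x).1 hx
    exact absurd i.2 (by omega)
  refine ⟨l, hl, ?_⟩
  unfold phiPlus phiMinus
  simp only [dif_pos hn, hl', forall_exists_index, forall_apply_eq_imp_iff]
  refine ⟨⟨_, rfl⟩, ⟨_, rfl⟩, fun i => ?_, fun i => ?_⟩
  · exact (Classical.choice (S.exists_hn A)).phase_strictAnti.antitone (Nat.zero_le _)
  · exact (Classical.choice (S.exists_hn A)).phase_strictAnti.antitone
      (Fin.mk_le_mk.2 (by omega))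

variable [IsTriangulated C]

/-- `phiPlus` is read off an arbitrarily chosen filtration; the description by vanishing of
morphisms shows that the choice does not matter and is the form in which phases are compared below.
-/
theorem rOrth_iff (hA : ¬ IsZero A) {U : Set ℝ} (hU : IsUpperSet U) :
    rOrth S.P U A ↔ S.phiPlus A ∉ U := by
  obtain ⟨l, hl, h₁, -, h₂, -⟩ := S.exists_filt_phi hA
  refine ⟨fun h => S.isPreSlicing.notMem_of_rOrth hl hU h _ h₁, fun h => ?_⟩
  refine S.isPreSlicing.rOrth_of_filt hl fun φ hφ ψ hψ => ?_
  by_contra! hle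
  exact h (hU (hle.trans (h₂ φ hφ)) hψ)

theorem lOrth_iff (hA : ¬ IsZero A) {U : Set ℝ} (hU : IsUpperSet U) :
    lOrth S.P Uᶜ A ↔ S.phiMinus A ∈ U := by
  obtain ⟨l, hl, -, h₁, -, h₂⟩ := S.exists_filt_phi hA
  refine ⟨fun h => S.isPreSlicing.mem_of_lOrth hl hU h _ h₁, fun h => ?_⟩
  refine S.isPreSlicing.lOrth_of_filt hl fun φ hφ ψ hψ => ?_
  by_contra! hle
  exact hψ (hU ((h₂ φ hφ).trans hle) h)

theorem phiPlus_le_iff (hA : ¬ IsZero A) {t : ℝ} :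
    S.phiPlus A ≤ t ↔ rOrth S.P (Set.Ioi t) A := by
  rw [S.rOrth_iff hA (isUpperSet_Ioi t), Set.mem_Ioi, not_lt]

theorem le_phiMinus_iff (hA : ¬ IsZero A) {t : ℝ} :
    t ≤ S.phiMinus A ↔ lOrth S.P (Set.Iio t) A := by
  rw [← Set.compl_Ici, S.lOrth_iff hA (isUpperSet_Ici t), Set.mem_Ici]

/-- The slices of `T` of phase `φ` lie in the range `[φ - ε, φ + ε]` with respect to `S`. -/
def Close (ε : ℝ) (S T : Slicing C) : Prop :=
  ∀ φ A, T.P φ A → rOrth S.P (Set.Ioi (φ + ε)) A ∧ lOrth S.P (Set.Iio (φ - ε)) A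

variable {S T}

/-- Control of the `T`-slices by `S` suffices for both inequalities. One bound comes from the
`T`-factors of `A`. For the other, a `T`-semistable object of phase `ψ > φ⁺_S(A) + ε` has `S`-phases
at least `ψ - ε`, so it has no nonzero morphism to `A`. -/
theorem Close.abs_phiPlus_sub_le {ε : ℝ} (h : Close ε S T) (hA : ¬ IsZero A) :
    |S.phiPlus A - T.phiPlus A| ≤ ε := by
  rw [abs_le']
  constructor
  · suffices S.phiPlus A ≤ T.phiPlus A + ε by linarith
    rw [S.phiPlus_le_iff hA]
    obtain ⟨l, hl, -, -, hl', -⟩ := T.exists_filt_phi hA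
    refine hl.rOrth_of_factors fun φ hφ X hX => (h φ X hX).1.mono ?_
    exact Set.Ioi_subset_Ioi (by linarith [hl' φ hφ])
  · suffices T.phiPlus A ≤ S.phiPlus A + ε by linarith
    rw [T.phiPlus_le_iff hA]
    intro ψ hψ X hX
    refine S.isPreSlicing.hom_eq_zero_of_orth (isUpperSet_Ici (ψ - ε)) ?_ ?_
    · rw [Set.compl_Ici]
      exact (h ψ X hX).2
    · refine ((S.phiPlus_le_iff hA).1 le_rfl).mono fun x hx => ?_
      simp only [Set.mem_Ioi, Set.mem_Ici] at *
      linarith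

theorem Close.abs_phiMinus_sub_le {ε : ℝ} (h : Close ε S T) (hA : ¬ IsZero A) :
    |S.phiMinus A - T.phiMinus A| ≤ ε := by
  rw [abs_le']
  constructor
  · suffices S.phiMinus A - ε ≤ T.phiMinus A by linarith
    rw [T.le_phiMinus_iff hA]
    intro ψ hψ X hX
    refine S.isPreSlicing.hom_eq_zero_of_orth (isUpperSet_Ioi (ψ + ε)) ?_ (h ψ X hX).1
    rw [Set.compl_Ioi]
    refine ((S.le_phiMinus_iff hA).1 le_rfl).mono fun x hx => ?_
    simp only [Set.mem_Iio, Set.mem_Iic] at *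
    linarith
  · suffices T.phiMinus A - ε ≤ S.phiMinus A by linarith
    rw [S.le_phiMinus_iff hA]
    obtain ⟨l, hl, -, -, -, hl'⟩ := T.exists_filt_phi hA
    refine hl.lOrth_of_factors fun φ hφ X hX => (h φ X hX).2.mono ?_
    exact Set.Iio_subset_Iio (by linarith [hl' φ hφ])

theorem Close.edist_le {ε : ℝ} (h : Close ε S T) : edist S T ≤ ENNReal.ofReal ε := by
  change (⨆ (A : C) (_ : ¬ IsZero A), _) ≤ _
  refine iSup₂_le fun A hA => max_le ?_ ?_
  · rw [edist_dist, Real.dist_eq]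
    exact ENNReal.ofReal_le_ofReal (h.abs_phiPlus_sub_le hA)
  · rw [edist_dist, Real.dist_eq]
    exact ENNReal.ofReal_le_ofReal (h.abs_phiMinus_sub_le hA)

theorem abs_phi_sub_lt (h : edist S T < 1) (hA : ¬ IsZero A) :
    |S.phiPlus A - T.phiPlus A| < 1 ∧ |S.phiMinus A - T.phiMinus A| < 1 := by
  have h' : max (edist (S.phiPlus A) (T.phiPlus A)) (edist (S.phiMinus A) (T.phiMinus A)) < 1 :=
    (le_iSup₂ (f := fun (A : C) (_ : ¬ IsZero A) => max (edist (S.phiPlus A) (T.phiPlus A))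
      (edist (S.phiMinus A) (T.phiMinus A))) A hA).trans_lt h
  rw [max_lt_iff, edist_dist, edist_dist, ENNReal.ofReal_lt_one, ENNReal.ofReal_lt_one] at h'
  exact h'

theorem ext' (h : ∀ φ A, S.P φ A ↔ T.P φ A) : S = T := by
  cases S; cases T
  congr
  funext φ A
  exact propext (h φ A)

end Slicing

end Phases

/-! ### Rigidity: the charge determines the slicing locally -/

section Uniqueness

variable {C : Type u} [Category.{w} C] [HasZeroObject C] [HasShift C ℤ] [Preadditive C]
  [∀ n : ℤ, (shiftFunctor C n).Additive] [Pretriangulated C]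
  {Λ : Type*} [AddCommGroup Λ] {v : K0 C →+ Λ}

namespace StabPrecondition

variable (σ τ : StabPrecondition v)

/-- The imaginary part of the central charge, normalized to vanish on objects of phase `φ`. -/
theorem rotated_im {φ ψ : ℝ} {A : C} (hA : σ.slicing.P ψ A) (h₀ : ¬ IsZero A) :
    ∃ m : ℝ, 0 < m ∧ (σ.Z (v (K0.of A)) * Complex.exp (-(Real.pi * φ * Complex.I))).im =
      m * Real.sin (Real.pi * (ψ - φ)) := by
  obtain ⟨m, hm, h⟩ := σ.compat ψ A hA h₀
  refine ⟨m, hm, ?_⟩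
  rw [h, mul_assoc, ← Complex.exp_add, Complex.im_ofReal_mul, ← Complex.exp_ofReal_mul_I_im]
  push_cast
  ring_nf

variable [IsTriangulated C]

variable {σ τ}

/-- Phases of the two slicings differ by less than 1, so after rotation by `-πφ` the relevant phases
stay within one half turn on either side of 0, where the sign of the imaginary part of the common
charge decides on which side a phase lies. -/
theorem P_of_edist_lt_one (hZ : σ.Z = τ.Z) (h : edist σ.slicing τ.slicing < 1) {φ : ℝ} {E : C}
    (hE : σ.slicing.P φ E) : τ.slicing.P φ E := by
  set S := σ.slicing
  set T := τ.slicing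
  by_cases h₀ : IsZero E
  · exact T.isPreSlicing.of_isZero φ h₀
  have hadd : ∀ x y : Λ, (σ.Z (x + y) * Complex.exp (-(Real.pi * φ * Complex.I))).im =
      (σ.Z x * Complex.exp (-(Real.pi * φ * Complex.I))).im +
      (σ.Z y * Complex.exp (-(Real.pi * φ * Complex.I))).im := by
    intro x y; rw [map_add, add_mul, Complex.add_im]
  have hpos : ∀ x : ℝ, 0 < x → x < 1 → 0 < Real.sin (Real.pi * x) := fun x h₁ h₂ =>
    Real.sin_pos_of_pos_of_lt_pi (by positivity) (by nlinarith [Real.pi_pos])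
  have hneg : ∀ x : ℝ, x < 0 → -1 < x → Real.sin (Real.pi * x) < 0 := fun x h₁ h₂ => by
    have := hpos (-x) (by linarith) (by linarith)
    rw [mul_neg, Real.sin_neg] at this
    linarith
  have hSp : S.phiPlus E ≤ φ :=
    (S.phiPlus_le_iff h₀).2 (S.isPreSlicing.rOrth_of_mem hE fun _ h => h)
  have hSm : φ ≤ S.phiMinus E :=
    (S.le_phiMinus_iff h₀).2 (S.isPreSlicing.lOrth_of_mem hE fun _ h => h)
  obtain ⟨hp, hm⟩ := Slicing.abs_phi_sub_lt h h₀
  rw [abs_lt] at hp hm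
  obtain ⟨l, hl, -, -, hl₁, hl₂⟩ := T.exists_filt_phi h₀
  obtain ⟨l₁, l₂, A, B, rfl, h₁, h₂, hT, hA, hB⟩ := hl.split (isUpperSet_Ioi φ)
  -- The `τ`-phases of `A` lie in `(φ, φ + 1)`, so its rotated imaginary part is positive. Its
  -- `σ`-phases lie in `(φ - 1, φ]`, since `A` is an extension of `E` by `B⟦-1⟧`, so the same number
  -- is at most 0.
  have hAz : IsZero A := by
    by_contra hAz
    have hSA : rOrth S.P (Set.Ioi φ) A := by
      refine rOrth.mid hT.invRotate ?_ (S.isPreSlicing.rOrth_of_mem hE fun _ h => h)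
      by_cases hBz : IsZero (B⟦(-1 : ℤ)⟧)
      · exact rOrth.of_isZero hBz
      · rw [← S.phiPlus_le_iff hBz]
        have h₃ : T.phiPlus (B⟦(-1 : ℤ)⟧) ≤ φ - 1 := by
          rw [T.phiPlus_le_iff hBz]
          refine T.isPreSlicing.rOrth_of_filt (T.isPreSlicing.filt_shift hB (-1)) ?_
          intro x hx y hy
          obtain ⟨z, hz, rfl⟩ := List.mem_map.1 hx
          have := h₁ z hz
          simp only [Set.mem_Ioi, not_lt] at this hy
          push_cast
          linarith
        have := (abs_lt.1 (Slicing.abs_phi_sub_lt h hBz).1).2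
        linarith
    rw [← S.phiPlus_le_iff hAz] at hSA
    obtain ⟨hp', hm'⟩ := Slicing.abs_phi_sub_lt h hAz
    have hTA : φ < T.phiMinus A := by
      rw [← Set.mem_Ioi, ← T.lOrth_iff hAz (isUpperSet_Ioi φ)]
      refine T.isPreSlicing.lOrth_of_filt hA fun x hx y hy => ?_
      have := h₂ x hx
      simp only [Set.mem_compl_iff, Set.mem_Ioi, not_lt] at this hy
      linarith
    rw [abs_lt] at hp' hm'
    have e₁ : 0 < (σ.Z (v (K0.of A)) * Complex.exp (-(Real.pi * φ * Complex.I))).im := by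
      refine hA.class_induction v
        (D := fun x => 0 < (σ.Z x * Complex.exp (-(Real.pi * φ * Complex.I))).im)
        (fun x y hx hy => by rw [hadd]; exact add_pos hx hy) (fun x hx X hX hX₀ => ?_) hAz
      rw [hZ]
      obtain ⟨m, hm, e⟩ := τ.rotated_im (φ := φ) hX hX₀
      rw [e]
      have := h₂ x hx
      have := hl₁ x (by simp [hx])
      rw [Set.mem_Ioi] at *
      exact mul_pos hm (hpos _ (by linarith) (by linarith))
    have e₂ : (σ.Z (v (K0.of A)) * Complex.exp (-(Real.pi * φ * Complex.I))).im ≤ 0 := by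
      obtain ⟨l', hl', -, -, hl'₁, hl'₂⟩ := S.exists_filt_phi hAz
      refine hl'.class_induction v
        (D := fun x => (σ.Z x * Complex.exp (-(Real.pi * φ * Complex.I))).im ≤ 0)
        (fun x y hx hy => by rw [hadd]; exact add_nonpos hx hy) (fun x hx X hX hX₀ => ?_) hAz
      obtain ⟨m, hm, e⟩ := σ.rotated_im (φ := φ) hX hX₀
      rw [e]
      have h₃ := hl'₁ x hx
      have h₄ := hl'₂ x hx
      rcases (h₃.trans hSA).lt_or_eq with h₅ | rfl
      · exact (mul_neg_of_pos_of_neg hm (hneg _ (by linarith) (by linarith))).le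
      · simp
    exact absurd e₁ (not_lt.2 e₂)
  have hl₂nil : l₂ = [] := T.isPreSlicing.eq_nil_of_isZero hA hAz
  subst hl₂nil
  simp only [List.append_nil] at hl hl₁ hl₂
  obtain ⟨l₃, l₄, X, Y, rfl, h₃, h₄, hXY, hX, hY⟩ := hl.split (isUpperSet_Ici φ)
  have hXφ : T.P φ X := by
    refine T.isPreSlicing.mem_of_orth (T.isPreSlicing.rOrth_of_filt hX fun x hx y hy => ?_)
      (T.isPreSlicing.lOrth_of_filt hX fun x hx y hy => ?_)
    · exact (not_lt.1 (h₁ x (by simp [hx]))).trans_lt hy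
    · exact lt_of_lt_of_le hy (h₄ x hx)
  -- Here the charge alone decides: `E` and `X` have rotated imaginary part 0, while the `τ`-phases
  -- of `Y` lie in `(φ - 1, φ)` and would make it negative.
  have hYz : IsZero Y := by
    by_contra hYz
    have e₁ : (σ.Z (v (K0.of Y)) * Complex.exp (-(Real.pi * φ * Complex.I))).im < 0 := by
      refine hY.class_induction v
        (D := fun x => (σ.Z x * Complex.exp (-(Real.pi * φ * Complex.I))).im < 0)
        (fun x y hx hy => by rw [hadd]; exact add_neg hx hy) (fun x hx X hX hX₀ => ?_) hYz
      rw [hZ]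
      obtain ⟨m, hm, e⟩ := τ.rotated_im (φ := φ) hX hX₀
      rw [e]
      have := h₃ x hx
      have := hl₂ x (by simp [hx])
      rw [Set.mem_Ici, not_le] at *
      exact mul_neg_of_pos_of_neg hm (hneg _ (by linarith) (by linarith))
    have e₂ : (σ.Z (v (K0.of X)) * Complex.exp (-(Real.pi * φ * Complex.I))).im = 0 := by
      by_cases hX₀ : IsZero X
      · simp [K0.of_isZero hX₀]
      · rw [hZ]
        obtain ⟨m, hm, e⟩ := τ.rotated_im (φ := φ) hXφ hX₀
        rw [e]; simp
    have e₃ : (σ.Z (v (K0.of E)) * Complex.exp (-(Real.pi * φ * Complex.I))).im = 0 := by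
      obtain ⟨m, hm, e⟩ := σ.rotated_im (φ := φ) hE h₀
      rw [e]; simp
    rw [K0.of_add hXY, map_add, hadd, e₂] at e₃
    linarith
  obtain ⟨e⟩ := hXY.nonempty_iso_left hYz
  exact T.isPreSlicing.of_iso e hXφ

theorem slicing_eq_of_edist_lt_one (hZ : σ.Z = τ.Z) (h : edist σ.slicing τ.slicing < 1) :
    σ.slicing = τ.slicing :=
  Slicing.ext' fun _ _ => ⟨P_of_edist_lt_one hZ h,
    P_of_edist_lt_one hZ.symm (by rwa [edist_comm])⟩

end StabPrecondition

theorem Stab.eq_of_edist_lt_one [IsTriangulated C] {σ τ : Stab v} (hZ : σ.charge = τ.charge)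
    (h : edist σ.slicing τ.slicing < 1) : σ = τ := by
  have h₁ := StabPrecondition.slicing_eq_of_edist_lt_one hZ h
  rcases σ with ⟨⟨S, Z, h₂⟩, h₃⟩
  rcases τ with ⟨⟨T, W, h₄⟩, h₅⟩
  obtain rfl : S = T := h₁
  obtain rfl : Z = W := hZ
  rfl

end Uniqueness

end Bridgeland

namespace Bridgeland

/-! ### Arguments in the upper half plane -/

section UpperHalfPlane

/-- The union of the open upper half plane and the negative real axis. -/
def IsUpper (z : ℂ) : Prop := 0 < z.im ∨ z.im = 0 ∧ z.re < 0

/-- The cross product of two complex numbers. -/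
def cross (a b : ℂ) : ℝ := a.re * b.im - a.im * b.re

theorem cross_eq (a b : ℂ) : cross a b = ‖a‖ * ‖b‖ * Real.sin (b.arg - a.arg) := by
  rw [Real.sin_sub, cross]
  nth_rewrite 1 [← Complex.norm_mul_cos_arg a, ← Complex.norm_mul_sin_arg b,
    ← Complex.norm_mul_sin_arg a, ← Complex.norm_mul_cos_arg b]
  ring

theorem cross_add_left (a b c : ℂ) : cross (a + b) c = cross a c + cross b c := by
  simp only [cross, Complex.add_re, Complex.add_im]; ring

theorem cross_add_right (a b c : ℂ) : cross a (b + c) = cross a b + cross a c := by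
  simp only [cross, Complex.add_re, Complex.add_im]; ring

theorem cross_self (a : ℂ) : cross a a = 0 := by rw [cross]; ring

theorem cross_comm (a b : ℂ) : cross a b = -cross b a := by rw [cross, cross]; ring

namespace IsUpper

variable {a b : ℂ}

theorem ne_zero (h : IsUpper a) : a ≠ 0 := by
  rintro rfl
  rcases h with h | h
  · simp at h
  · simp at h

theorem im_nonneg (h : IsUpper a) : 0 ≤ a.im := by
  rcases h with h | h
  · exact h.le
  · exact h.1.ge

theorem arg_pos (h : IsUpper a) : 0 < a.arg := by
  refine lt_of_le_of_ne (Complex.arg_nonneg_iff.2 h.im_nonneg) fun h₀ => ?_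
  have := Complex.arg_eq_zero_iff.1 h₀.symm
  rcases h with h | h
  · exact h.ne' this.2
  · linarith [this.1]

theorem add (ha : IsUpper a) (hb : IsUpper b) : IsUpper (a + b) := by
  rw [IsUpper, Complex.add_re, Complex.add_im]
  rcases ha with ha | ha <;> rcases hb with hb | hb
  · left; linarith
  · left; linarith
  · left; linarith
  · right; constructor <;> linarith

theorem smul (ha : IsUpper a) {t : ℝ} (ht : 0 < t) : IsUpper (t * a) := by
  rw [IsUpper, Complex.re_ofReal_mul, Complex.im_ofReal_mul]
  rcases ha with ha | ha
  · left; positivity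
  · right; exact ⟨by rw [ha.1, mul_zero], mul_neg_of_pos_of_neg ht ha.2⟩

theorem convex (ha : IsUpper a) (hb : IsUpper b) {t : ℝ} (h₀ : 0 ≤ t) (h₁ : t ≤ 1) :
    IsUpper (((1 - t : ℝ) : ℂ) * a + (t : ℂ) * b) := by
  rcases h₀.eq_or_lt with rfl | h₀
  · simpa using ha
  rcases h₁.eq_or_lt with rfl | h₁
  · simpa using hb
  exact (ha.smul (by linarith)).add (hb.smul h₀)

/-- Both arguments lie in `(0, π]`, so their difference lies in `(-π, π)`, where the sine has the
sign of its argument. This replaces comparisons of arguments by a bilinear expression. -/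
theorem cross_pos_iff (ha : IsUpper a) (hb : IsUpper b) : 0 < cross a b ↔ a.arg < b.arg := by
  have h₁ := ha.arg_pos
  have h₂ := hb.arg_pos
  have h₃ := a.arg_le_pi
  have h₄ := b.arg_le_pi
  have h₅ : 0 < ‖a‖ * ‖b‖ := mul_pos (norm_pos_iff.2 ha.ne_zero) (norm_pos_iff.2 hb.ne_zero)
  rw [cross_eq, mul_pos_iff_of_pos_left h₅]
  constructor
  · intro h
    by_contra! h'
    exact absurd h (not_lt.2 (Real.sin_nonpos_of_nonpos_of_neg_pi_le (by linarith) (by linarith)))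
  · intro h
    exact Real.sin_pos_of_pos_of_lt_pi (by linarith) (by linarith)

theorem cross_nonneg_iff (ha : IsUpper a) (hb : IsUpper b) :
    0 ≤ cross a b ↔ a.arg ≤ b.arg := by
  rw [cross_comm, neg_nonneg, ← not_lt, hb.cross_pos_iff ha, not_lt]

/-- The see-saw property follows from bilinearity: `cross a (a + b)` and `cross (a + b) b` both
equal `cross a b`. -/
theorem arg_le_arg_add (ha : IsUpper a) (hb : IsUpper b) (h : a.arg ≤ b.arg) :
    a.arg ≤ (a + b).arg ∧ (a + b).arg ≤ b.arg := by
  rw [← ha.cross_nonneg_iff hb] at h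
  rw [← ha.cross_nonneg_iff (ha.add hb), ← (ha.add hb).cross_nonneg_iff hb, cross_add_left,
    cross_add_right, cross_self, cross_self]
  exact ⟨by linarith, by linarith⟩

theorem arg_lt_arg_add (ha : IsUpper a) (hb : IsUpper b) (h : a.arg < b.arg) :
    a.arg < (a + b).arg ∧ (a + b).arg < b.arg := by
  rw [← ha.cross_pos_iff hb] at h
  rw [← ha.cross_pos_iff (ha.add hb), ← (ha.add hb).cross_pos_iff hb, cross_add_left,
    cross_add_right, cross_self, cross_self]
  exact ⟨by linarith, by linarith⟩

theorem of_exp {m φ : ℝ} (hm : 0 < m) (h₀ : 0 < φ) (h₁ : φ ≤ 1)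
    (ha : a = m * Complex.exp (Real.pi * φ * Complex.I)) :
    IsUpper a ∧ a.arg = Real.pi * φ ∧ ‖a‖ = m := by
  have hre : a.re = m * Real.cos (Real.pi * φ) := by
    rw [ha, Complex.re_ofReal_mul, ← Complex.ofReal_mul, Complex.exp_ofReal_mul_I_re]
  have him : a.im = m * Real.sin (Real.pi * φ) := by
    rw [ha, Complex.im_ofReal_mul, ← Complex.ofReal_mul, Complex.exp_ofReal_mul_I_im]
  refine ⟨?_, ?_, ?_⟩
  · rcases h₁.eq_or_lt with rfl | h₁
    · right; rw [hre, him]; simpa using hm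
    · left; rw [him]
      exact mul_pos hm (Real.sin_pos_of_pos_of_lt_pi (by positivity) (by nlinarith [Real.pi_pos]))
  · rw [ha, ← Complex.ofReal_mul, Complex.exp_mul_I, Complex.arg_mul_cos_add_sin_mul_I hm]
    exact ⟨by nlinarith [Real.pi_pos], by nlinarith [Real.pi_pos]⟩
  · rw [ha, ← Complex.ofReal_mul, norm_mul, Complex.norm_exp_ofReal_mul_I, mul_one,
      Complex.norm_real, Real.norm_of_nonneg hm.le]

end IsUpper

/-- The argument is uniformly continuous for relative perturbations in the upper half plane. -/
theorem exists_abs_arg_sub_le {ε : ℝ} (hε : 0 < ε) :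
    ∃ δ : ℝ, 0 < δ ∧ ∀ a b : ℂ, IsUpper a → IsUpper b → ‖b - a‖ ≤ δ * ‖a‖ →
      |b.arg - a.arg| ≤ ε := by
  have hc := Metric.continuousAt_iff.1
    (Complex.continuousAt_arg (x := 1) (by simp [Complex.slitPlane])) ε hε
  obtain ⟨δ, hδ, h⟩ := hc
  refine ⟨δ / 2, by positivity, fun a b ha hb hab => ?_⟩
  have ha₀ := ha.ne_zero
  have h₁ : dist (b / a) 1 < δ := by
    have : b / a - 1 = (b - a) / a := by field_simp
    rw [dist_eq_norm, this, norm_div, div_lt_iff₀ (norm_pos_iff.2 ha₀)]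
    nlinarith [norm_pos_iff.2 ha₀]
  have h₂ := h h₁
  rw [Complex.arg_one, dist_zero_right, Real.norm_eq_abs] at h₂
  -- No multiple of `2π` intervenes because both arguments lie in `(0, π]`. Thus continuity of the
  -- argument at 1 is enough for a uniform estimate.
  have h₃ : (b / a).arg = b.arg - a.arg := by
    have h₄ := ha.arg_pos
    have h₅ := hb.arg_pos
    have h₆ := a.arg_le_pi
    have h₇ := b.arg_le_pi
    have hba : b / a = ((‖b‖ / ‖a‖ : ℝ) : ℂ) *
        (Complex.cos ((b.arg - a.arg : ℝ) : ℂ) + Complex.sin ((b.arg - a.arg : ℝ) : ℂ) *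
          Complex.I) := by
      rw [← Complex.exp_mul_I]
      nth_rewrite 1 [← Complex.norm_mul_exp_arg_mul_I a, ← Complex.norm_mul_exp_arg_mul_I b]
      push_cast
      rw [sub_mul, Complex.exp_sub]
      have : (‖a‖ : ℂ) ≠ 0 := by simpa using ha₀
      field_simp
    rw [hba, Complex.arg_mul_cos_add_sin_mul_I]
    · exact div_pos (norm_pos_iff.2 hb.ne_zero) (norm_pos_iff.2 ha₀)
    · constructor <;> linarith
  rw [← h₃]
  exact h₂.le

end UpperHalfPlane

/-! ### Coarsening lists of classes and positivity of the quadratic form -/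

section Merging

/-- If `Q` is negative definite on the kernel of `F`, then the vectors with `Q ≥ 0` which `F` maps
to a fixed ray form a convex cone. -/
theorem quadraticForm_add_nonneg {M : Type*} [AddCommGroup M] [Module ℝ M]
    (Q : QuadraticForm ℝ M) (F : M →ₗ[ℝ] ℂ) (hQ : ∀ x, F x = 0 → x ≠ 0 → Q x < 0) {x y : M}
    (hx : IsUpper (F x)) (hy : IsUpper (F y)) (hxy : cross (F x) (F y) = 0) (hQx : 0 ≤ Q x)
    (hQy : 0 ≤ Q y) : 0 ≤ Q (x + y) := by
  have harg : (F x).arg = (F y).arg := by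
    refine le_antisymm ((hx.cross_nonneg_iff hy).1 hxy.ge) ((hy.cross_nonneg_iff hx).1 ?_)
    rw [cross_comm, hxy, neg_zero]
  rw [Complex.arg_eq_arg_iff hx.ne_zero hy.ne_zero] at harg
  -- With this `r` the vector `y - r x` lies in the kernel of `F`, so `Q` is at most 0 on it.
  -- Expanding, `Q x, Q y ≥ 0` forces the polar form of `x` and `y` to be nonnegative.
  set r : ℝ := ‖F y‖ / ‖F x‖ with hr
  have hr₀ : 0 < r := div_pos (norm_pos_iff.2 hy.ne_zero) (norm_pos_iff.2 hx.ne_zero)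
  have hker : F (y - r • x) = 0 := by
    rw [map_sub, map_smul, ← harg, sub_eq_zero, Complex.real_smul, hr]
    push_cast
    rfl
  have h₁ : Q (y - r • x) ≤ 0 := by
    by_cases h : y - r • x = 0
    · rw [h, QuadraticMap.map_zero]
    · exact (hQ _ hker h).le
  have h₂ : Q (y - r • x) = Q y + r * r * Q x - r * QuadraticMap.polar Q x y := by
    have h₃ : Q (y - r • x) =
        QuadraticMap.polar Q y (-(r • x)) + Q y + Q (-(r • x)) := by
      rw [QuadraticMap.polar, sub_eq_add_neg]; ring
    rw [h₃, QuadraticMap.polar_neg_right, QuadraticMap.polar_smul_right, QuadraticMap.map_neg,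
      QuadraticMap.map_smul, QuadraticMap.polar_comm]
    simp only [smul_eq_mul]
    ring
  have h₄ : 0 ≤ QuadraticMap.polar Q x y := by
    by_contra! h
    have := mul_neg_of_pos_of_neg hr₀ h
    have := mul_nonneg (mul_nonneg hr₀.le hr₀.le) hQx
    linarith
  have h₅ : Q (x + y) = QuadraticMap.polar Q x y + Q x + Q y := by
    rw [QuadraticMap.polar]; ring
  linarith

variable {G : Type*} [AddCommGroup G] {f g : G → ℝ} {D : G → Prop}

/-- Insertion of an element into a list which is increasing for `f` and `g`, adding up elements
where the two orders disagree. -/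
theorem exists_insert
    (hf : ∀ x y, D x → D y → f x ≤ f y → f x ≤ f (x + y) ∧ f (x + y) ≤ f y)
    (hD : ∀ x y, D x → D y → f x ≤ f y → g y ≤ g x → D (x + y)) (L : List G) :
    ∀ x, D x → (∀ y ∈ L, D y) → (∀ y ∈ L, f x ≤ f y) → L.Pairwise (fun a b => f a ≤ f b) →
      L.Pairwise (fun a b => g a < g b) →
      ∃ y L', y + L'.sum = x + L.sum ∧ (∀ z ∈ y :: L', D z ∧ f x ≤ f z) ∧
        (y :: L').Pairwise (fun a b => f a ≤ f b) ∧ (y :: L').Pairwise (fun a b => g a < g b) ∧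
        L' <:+ L := by
  induction L with
  | nil =>
    intro x hx _ _ _ _
    exact ⟨x, [], rfl, by simpa using hx, by simp, by simp, List.suffix_rfl⟩
  | cons y L ih =>
    intro x hx hL hxL hfL hgL
    rcases lt_or_ge (g x) (g y) with h | h
    · refine ⟨x, y :: L, rfl, ?_, List.pairwise_cons.2 ⟨hxL, hfL⟩,
        List.pairwise_cons.2 ⟨fun z hz => ?_, hgL⟩, List.suffix_rfl⟩
      · intro z hz
        rcases List.mem_cons.1 hz with rfl | hz
        · exact ⟨hx, le_rfl⟩
        · exact ⟨hL z hz, hxL z hz⟩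
      · rcases List.mem_cons.1 hz with rfl | hz
        · exact h
        · exact h.trans ((List.pairwise_cons.1 hgL).1 z hz)
    -- The orders disagree, so `y` is absorbed and `x + y` is inserted into the rest; it still
    -- precedes the rest for `f` because `f (x + y) ≤ f y`.
    · have hy := hL y (by simp)
      have hxy := hxL y (by simp)
      obtain ⟨h₁, h₂⟩ := hf x y hx hy hxy
      obtain ⟨z, L', hsum, hDz, hfz, hgz, hs⟩ := ih (x + y) (hD x y hx hy hxy h)
        (fun z hz => hL z (by simp [hz]))
        (fun z hz => h₂.trans ((List.pairwise_cons.1 hfL).1 z hz))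
        (List.pairwise_cons.1 hfL).2 (List.pairwise_cons.1 hgL).2
      refine ⟨z, L', ?_, fun w hw => ⟨(hDz w hw).1, h₁.trans (hDz w hw).2⟩, hfz, hgz,
        hs.trans (List.suffix_cons _ _)⟩
      rw [hsum, List.sum_cons, add_assoc]

/-- A list which is increasing for `f` can be coarsened to one which is also increasing for `g`. -/
theorem exists_coarsening
    (hf : ∀ x y, D x → D y → f x ≤ f y → f x ≤ f (x + y) ∧ f (x + y) ≤ f y)
    (hD : ∀ x y, D x → D y → f x ≤ f y → g y ≤ g x → D (x + y)) (X : List G)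
    (hX : ∀ x ∈ X, D x) (hfX : X.Pairwise (fun a b => f a ≤ f b)) :
    ∃ L : List G, L.sum = X.sum ∧ (∀ y ∈ L, D y) ∧ L.Pairwise (fun a b => f a ≤ f b) ∧
      L.Pairwise (fun a b => g a < g b) ∧ (∀ s, s <:+ L → ∃ s', s' <:+ X ∧ s'.sum = s.sum) ∧
      ∀ b, (∀ x ∈ X, b ≤ f x) → ∀ y ∈ L, b ≤ f y := by
  induction X with
  | nil => exact ⟨[], by simp⟩
  | cons x X ih =>
    obtain ⟨h₁, h₂⟩ := List.pairwise_cons.1 hfX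
    obtain ⟨L, hsum, hDL, hfL, hgL, hs, hb⟩ := ih (fun y hy => hX y (by simp [hy])) h₂
    obtain ⟨y, L', hsum', hDz, hfz, hgz, hs'⟩ := exists_insert hf hD L x (hX x (by simp)) hDL
      (hb _ h₁) hfL hgL
    refine ⟨y :: L', by rw [List.sum_cons, hsum', hsum, List.sum_cons],
      fun z hz => (hDz z hz).1, hfz, hgz, fun s hsu => ?_, fun b hbx z hz => ?_⟩
    · rcases List.suffix_cons_iff.1 hsu with rfl | hsu
      · exact ⟨x :: X, List.suffix_rfl, by rw [List.sum_cons, List.sum_cons, hsum', hsum]⟩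
      · obtain ⟨s', h, h'⟩ := hs s (hsu.trans hs')
        exact ⟨s', h.trans (List.suffix_cons _ _), h'⟩
    · exact (hbx x (by simp)).trans (hDz z hz).2

theorem isUpper_sum (F : G →+ ℂ) {L : List G} (hL : ∀ y ∈ L, IsUpper (F y)) (h : L ≠ []) :
    IsUpper (F L.sum) := by
  induction L with
  | nil => exact absurd rfl h
  | cons x L ih =>
    rw [List.sum_cons, map_add]
    by_cases hL' : L = []
    · subst hL'
      simpa using hL x (by simp)
    · exact (hL x (by simp)).add (ih (fun y hy => hL y (by simp [hy])) hL')

theorem lt_arg_sum (F : G →+ ℂ) {L : List G} (hL : ∀ y ∈ L, IsUpper (F y)) (h : L ≠ []) {t : ℝ}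
    (ht : ∀ y ∈ L, t < (F y).arg) : t < (F L.sum).arg := by
  induction L with
  | nil => exact absurd rfl h
  | cons x L ih =>
    rw [List.sum_cons, map_add]
    by_cases hL' : L = []
    · subst hL'
      simpa using ht x (by simp)
    · have h₁ := hL x (by simp)
      have h₂ := isUpper_sum F (fun y hy => hL y (by simp [hy])) hL'
      have h₃ := ht x (by simp)
      have h₄ := ih (fun y hy => hL y (by simp [hy])) hL' fun y hy => ht y (by simp [hy])
      rcases le_total (F x).arg (F L.sum).arg with h | h
      · exact h₃.trans_le (h₁.arg_le_arg_add h₂ h).1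
      · rw [add_comm]
        exact h₄.trans_le (h₂.arg_le_arg_add h₁ h).1

/-- A sum of vectors with `Q ≥ 0` which is ordered by the argument of `Z` has `Q ≥ 0` if it is
`W`-semistable with respect to its partial sums and `Z`, `W` have the same imaginary part. -/
theorem quadraticForm_sum_nonneg {M : Type*} [AddCommGroup M] [Module ℝ M]
    (Q : QuadraticForm ℝ M) (ι : G →+ M) (Z W : M →ₗ[ℝ] ℂ) (him : ∀ x, (W x).im = (Z x).im)
    (hQ : ∀ t : ℝ, 0 ≤ t → t ≤ 1 → ∀ x, ((1 - t : ℝ) : ℂ) * Z x + (t : ℂ) * W x = 0 → x ≠ 0 →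
      Q x < 0) (X : List G) (hX₀ : X ≠ [])
    (hX : ∀ x ∈ X, 0 ≤ Q (ι x) ∧ IsUpper (Z (ι x)) ∧ IsUpper (W (ι x)))
    (hZX : X.Pairwise fun a b => (Z (ι a)).arg ≤ (Z (ι b)).arg)
    (hWX : ∀ s, s <:+ X → s ≠ [] → (W (ι s.sum)).arg ≤ (W (ι X.sum)).arg) :
    0 ≤ Q (ι X.sum) := by
  let D : G → Prop := fun x => 0 ≤ Q (ι x) ∧ IsUpper (Z (ι x)) ∧ IsUpper (W (ι x))
  obtain ⟨L, hsum, hDL, -, hgL, hs, -⟩ := exists_coarsening (D := D)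
    (f := fun x => (Z (ι x)).arg) (g := fun x => (W (ι x)).arg) (fun x y hx hy h => by
      have := hx.2.1.arg_le_arg_add hy.2.1 h
      simpa only [map_add] using this) (fun x y hx hy h₁ h₂ => by
      refine ⟨?_, by rw [map_add, map_add]; exact hx.2.1.add hy.2.1,
        by rw [map_add, map_add]; exact hx.2.2.add hy.2.2⟩
      rw [← hx.2.1.cross_nonneg_iff hy.2.1] at h₁
      rw [← hy.2.2.cross_nonneg_iff hx.2.2, cross_comm, neg_nonneg] at h₂
      set a := cross (Z (ι x)) (Z (ι y)) with ha
      set b := cross (W (ι x)) (W (ι y)) with hb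
      -- As `Z` and `W` have the same imaginary part, the cross product of the images of `x` and `y`
      -- under `(1 - t) Z + t W` is affine in `t`. It goes from `a ≥ 0` to `b ≤ 0`, and at its zero
      -- the two images are on one ray.
      obtain ⟨t, h₀, h₁, ht⟩ : ∃ t : ℝ, 0 ≤ t ∧ t ≤ 1 ∧ (1 - t) * a + t * b = 0 := by
        rcases h₁.eq_or_lt with h | h
        · exact ⟨0, le_rfl, zero_le_one, by simp [← h]⟩
        · refine ⟨a / (a - b), by apply div_nonneg <;> linarith, ?_, ?_⟩
          · rw [div_le_one (by linarith)]; linarith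
          · have : a - b ≠ 0 := by linarith
            field_simp
            ring
      let F : M →ₗ[ℝ] ℂ := (1 - t) • Z + t • W
      have hF : ∀ x, F x = ((1 - t : ℝ) : ℂ) * Z x + (t : ℂ) * W x := fun x => by
        simp [F, Complex.real_smul]
      rw [map_add]
      refine quadraticForm_add_nonneg Q F (fun x hx => hQ t h₀ h₁ x (by rwa [← hF]))
        (by rw [hF]; exact hx.2.1.convex hx.2.2 h₀ h₁)
        (by rw [hF]; exact hy.2.1.convex hy.2.2 h₀ h₁) ?_ hx.1 hy.1
      rw [← ht, ha, hb, hF, hF]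
      simp only [cross, Complex.add_re, Complex.add_im, Complex.re_ofReal_mul,
        Complex.im_ofReal_mul, him]
      ring) X hX hZX
  cases L with
  | nil =>
    have := isUpper_sum (W.toAddMonoidHom.comp ι) (fun x hx => (hX x hx).2.2) hX₀
    rw [← hsum] at this
    exact absurd (by simp) this.ne_zero
  | cons y L =>
    by_cases hL : L = []
    · subst hL
      rw [← hsum]
      simpa using (hDL y (by simp)).1
    -- If entries follow `y`, their sum has larger `W`-argument than `y`, hence larger than the
    -- total. It is also the sum of a suffix of `X`, which contradicts `hWX`.
    · exfalso
      have hLu : ∀ z ∈ L, IsUpper (W.toAddMonoidHom.comp ι z) :=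
        fun z hz => (hDL z (by simp [hz])).2.2
      have h₁ := isUpper_sum (W.toAddMonoidHom.comp ι) hLu hL
      have h₂ := lt_arg_sum (W.toAddMonoidHom.comp ι) hLu hL (List.pairwise_cons.1 hgL).1
      obtain ⟨s', hs', hs''⟩ := hs L (List.suffix_cons _ _)
      have hs₀ : s' ≠ [] := by
        rintro rfl
        rw [← hs''] at h₁
        exact h₁.ne_zero (by simp)
      have h₃ := hWX s' hs' hs₀
      rw [hs'', ← hsum, List.sum_cons, map_add, map_add] at h₃
      exact absurd h₃ (not_le.2 ((hDL y (by simp)).2.2.arg_lt_arg_add h₁ h₂).2)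

end Merging

end Bridgeland

namespace Bridgeland

universe w u

/-! ### Stability functions on the heart of a slicing -/

section Heart

variable {C : Type u} [Category.{w} C] [HasZeroObject C] [HasShift C ℤ] [Preadditive C]
  [∀ n : ℤ, (shiftFunctor C n).Additive] [Pretriangulated C]

/-- The heart `P(0, 1]` of a slicing. -/
def heart (P : ℝ → ObjectProperty C) (A : C) : Prop :=
  lOrth P (Set.Iic 0) A ∧ rOrth P (Set.Ioi 1) A

/-- `A` is a subobject of `E` in the heart. -/
def IsSub (P : ℝ → ObjectProperty C) (A E : C) : Prop :=
  heart P A ∧ ∃ B, heart P B ∧ IsTri A E B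

section

variable {P : ℝ → ObjectProperty C} {X Y Z : C}

theorem heart.of_isZero (h : IsZero X) : heart P X := ⟨lOrth.of_isZero h, rOrth.of_isZero h⟩

theorem heart.of_iso (h : heart P X) (e : X ≅ Y) : heart P Y := ⟨h.1.of_iso e, h.2.of_iso e⟩

theorem heart.mid (h : IsTri X Y Z) (hX : heart P X) (hZ : heart P Z) : heart P Y :=
  ⟨lOrth.mid h hX.1 hZ.1, rOrth.mid h hX.2 hZ.2⟩

theorem IsSub.refl (h : heart P X) : IsSub P X X :=
  ⟨h, _, heart.of_isZero (isZero_zero C), IsTri.of_isZero_right (isZero_zero C) (Iso.refl X)⟩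

variable [IsTriangulated C]

theorem IsSub.trans (h : IsSub P X Y) (h' : IsSub P Y Z) : IsSub P X Z := by
  obtain ⟨hX, B, hB, hT⟩ := h
  obtain ⟨hY, D, hD, hT'⟩ := h'
  obtain ⟨W, h₁, h₂⟩ := hT.comp_left hT'
  exact ⟨hX, W, heart.mid h₂ hB hD, h₁⟩

/-- The preimage of a subobject of a quotient. -/
theorem IsSub.exists_preimage {A B E : C} (hT : IsTri A E B) (hA : heart P A) (h : IsSub P X B) :
    ∃ A', IsSub P A' E ∧ IsTri A A' X := by
  obtain ⟨hX, D, hD, hT'⟩ := h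
  obtain ⟨W, h₁, h₂⟩ := hT.comp_right hT'
  exact ⟨W, ⟨heart.mid h₂ hA hX, D, hD, h₁⟩, h₂⟩

namespace IsPreSlicing

variable (hP : IsPreSlicing P)
include hP

theorem heart_of_filt {l : List ℝ} {A : C} (h : Filt P l A) (hl : ∀ φ ∈ l, 0 < φ ∧ φ ≤ 1) :
    heart P A :=
  ⟨hP.lOrth_of_filt h fun φ hφ _ hψ => lt_of_le_of_lt hψ (hl φ hφ).1,
    hP.rOrth_of_filt h fun φ hφ _ hψ => lt_of_le_of_lt (hl φ hφ).2 hψ⟩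

theorem mem_of_heart {l : List ℝ} {A : C} (h : Filt P l A) (hA : heart P A) :
    ∀ φ ∈ l, 0 < φ ∧ φ ≤ 1 := fun φ hφ =>
  ⟨hP.mem_of_lOrth h (isUpperSet_Ioi 0) (by rw [Set.compl_Ioi]; exact hA.1) φ hφ,
    not_lt.1 (hP.notMem_of_rOrth h (isUpperSet_Ioi 1) hA.2 φ hφ)⟩

/-- Morphisms in the heart have kernels, images and cokernels in the heart. -/
theorem exists_heart_factorization (hX : heart P X) (hY : heart P Y) (f : X ⟶ Y) :
    ∃ (K I Q : C) (p : X ⟶ I) (i : I ⟶ Y), p ≫ i = f ∧ heart P K ∧ heart P I ∧ heart P Q ∧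
      IsTri K X I ∧ IsTri I Y Q := by
  -- The cone has phases in `(0, 2]`. Its part in `(1, 2]`, shifted down by one, is the kernel, and
  -- its part in `(0, 1]` is the cokernel.
  obtain ⟨Z, g, h, H⟩ := distinguished_cocone_triangle f
  have hZ : IsTri Y Z (X⟦(1 : ℤ)⟧) := (IsTri.of_mem H).rotate
  obtain ⟨T, Q, hT, hT₁, hQ₁⟩ := hP.exists_truncation (isUpperSet_Ioi 1) Z
  rw [Set.compl_Ioi] at hT₁
  have hZ₁ : lOrth P (Set.Iic 0) Z := by
    refine lOrth.mid hZ hY.1 ((hP.lOrth_shift hX.1 1).mono fun x hx => ?_)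
    simp only [Set.mem_Iic, Set.mem_ofPred_eq] at *
    push_cast
    linarith
  have hZ₂ : rOrth P (Set.Ioi 2) Z := by
    refine rOrth.mid hZ (hY.2.mono (Set.Ioi_subset_Ioi (by norm_num)))
      ((hP.rOrth_shift hX.2 1).mono fun x hx => ?_)
    simp only [Set.mem_Ioi, Set.mem_ofPred_eq] at *
    push_cast
    linarith
  have hQ : heart P Q := by
    refine ⟨lOrth.mid hT.rotate hZ₁ ((hP.lOrth_shift hT₁ 1).mono fun x hx => ?_), hQ₁⟩
    simp only [Set.mem_Iic, Set.mem_ofPred_eq] at *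
    push_cast
    linarith
  have hT₂ : rOrth P (Set.Ioi 2) T := by
    refine rOrth.mid hT.invRotate ((hP.rOrth_shift hQ₁ (-1)).mono fun x hx => ?_) hZ₂
    simp only [Set.mem_Ioi, Set.mem_ofPred_eq] at *
    push_cast
    linarith
  have hK : heart P (T⟦(-1 : ℤ)⟧) := by
    refine ⟨(hP.lOrth_shift hT₁ (-1)).mono fun x hx => ?_,
      (hP.rOrth_shift hT₂ (-1)).mono fun x hx => ?_⟩
    all_goals
      simp only [Set.mem_Iic, Set.mem_Ioi, Set.mem_ofPred_eq] at *
      push_cast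
      linarith
  obtain ⟨I, p, i, hpi, hI, hI'⟩ := exists_image_factorization H hT
  refine ⟨_, I, Q, p, i, hpi, hK, ⟨?_, ?_⟩, hQ, hI'.invRotate, hI⟩
  · exact lOrth.mid hI' hX.1 (hT₁.mono (Set.Iic_subset_Iic.2 zero_le_one))
  · refine rOrth.mid hI.invRotate ((hP.rOrth_shift hQ₁ (-1)).mono fun x hx => ?_) hY.2
    simp only [Set.mem_Ioi, Set.mem_ofPred_eq] at *
    push_cast
    linarith

end IsPreSlicing

end

variable {Λ : Type*} [AddCommGroup Λ]

/-- The homomorphism `W` is a stability function on the heart of `P` such that every object has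
only finitely many classes of subobjects in each left half plane. -/
structure IsStabFun (P : ℝ → ObjectProperty C) (v : K0 C →+ Λ) (W : Λ →+ ℂ) : Prop where
  upper : ∀ A, heart P A → ¬ IsZero A → IsUpper (W (v (K0.of A)))
  finite : ∀ E, heart P E → ∀ R : ℝ,
    {x : Λ | (∃ A, IsSub P A E ∧ x = v (K0.of A)) ∧ (W x).re ≤ R}.Finite

/-- The `W`-semistable objects of phase `φ` in the heart of `P`, and the zero objects. -/
def heartSlice (P : ℝ → ObjectProperty C) (v : K0 C →+ Λ) (W : Λ →+ ℂ) (φ : ℝ) :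
    ObjectProperty C := fun E =>
  IsZero E ∨ heart P E ∧ (W (v (K0.of E))).arg = Real.pi * φ ∧
    ∀ A, IsSub P A E → ¬ IsZero A → (W (v (K0.of A))).arg ≤ (W (v (K0.of E))).arg

/-- The classes of subobjects of `E` of argument at least that of `E`. -/
def destabilizingClasses (P : ℝ → ObjectProperty C) (v : K0 C →+ Λ) (W : Λ →+ ℂ) (E : C) :
    Set Λ :=
  {x | ∃ A, IsSub P A E ∧ ¬ IsZero A ∧ x = v (K0.of A) ∧ (W (v (K0.of E))).arg ≤ (W x).arg}

section

variable {P : ℝ → ObjectProperty C} {v : K0 C →+ Λ} {W : Λ →+ ℂ}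

theorem map_of_isTri {G : Type*} [AddCommGroup G] (F : Λ →+ G) {X Y Z : C} (h : IsTri X Y Z) :
    F (v (K0.of Y)) = F (v (K0.of X)) + F (v (K0.of Z)) := by
  rw [K0.of_add h, map_add, map_add]

theorem heartSlice_of_iso {φ : ℝ} {X Y : C} (e : X ≅ Y) (h : heartSlice P v W φ X) :
    heartSlice P v W φ Y := by
  rcases h with h | ⟨h₁, h₂, h₃⟩
  · exact .inl (h.of_iso e.symm)
  · refine .inr ⟨h₁.of_iso e, by rw [← K0.of_iso e, h₂], fun A hA hA₀ => ?_⟩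
    rw [← K0.of_iso e]
    obtain ⟨hA, B, hB, hT⟩ := hA
    exact h₃ A ⟨hA, B, hB, hT.of_iso (Iso.refl _) e.symm (Iso.refl _)⟩ hA₀

namespace IsStabFun

variable (hW : IsStabFun P v W)
include hW

theorem im_nonneg {A : C} (hA : heart P A) : 0 ≤ (W (v (K0.of A))).im := by
  by_cases h : IsZero A
  · simp [K0.of_isZero h]
  · exact (hW.upper A hA h).im_nonneg

theorem phase_mem {φ : ℝ} {A : C} (hA : heartSlice P v W φ A) (h : ¬ IsZero A) :
    0 < φ ∧ φ ≤ 1 := by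
  obtain ⟨h₁, h₂, -⟩ := hA.resolve_left h
  have h₃ := (hW.upper A h₁ h).arg_pos
  have h₄ := (W (v (K0.of A))).arg_le_pi
  rw [h₂] at h₃ h₄
  have := Real.pi_pos
  constructor
  · by_contra! h
    nlinarith
  · by_contra! h
    nlinarith

theorem phase_mem_of_filt {l : List ℝ} {A : C} (h : Filt (heartSlice P v W) l A) :
    ∀ φ ∈ l, 0 < φ ∧ φ ≤ 1 := by
  induction h with
  | zero => simp
  | cons h hE hE₀ hφ hA' ih =>
    intro ψ hψ
    rcases List.mem_cons.1 hψ with rfl | hψ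
    · exact hW.phase_mem hE hE₀
    · exact ih ψ hψ

/-- A subobject has imaginary part between 0 and that of `E`. Together with an argument at least
that of `E` this bounds its real part above by `|Re W(E)|`, so the finiteness axiom applies. -/
theorem finite_destabilizingClasses {E : C} (hE : heart P E) (hE₀ : ¬ IsZero E) :
    (destabilizingClasses P v W E).Finite := by
  refine (hW.finite E hE |(W (v (K0.of E))).re|).subset ?_
  rintro x ⟨A, hA, hA₀, rfl, harg⟩
  refine ⟨⟨A, hA, rfl⟩, ?_⟩
  obtain ⟨hA, B, hB, hT⟩ := hA
  have h₁ := hW.upper A hA hA₀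
  have h₂ := hW.upper E hE hE₀
  rw [← h₂.cross_nonneg_iff h₁, cross] at harg
  have h₃ := hW.im_nonneg hB
  have h₄ := congrArg Complex.im (map_of_isTri (v := v) W hT)
  rw [Complex.add_im] at h₄
  have h₅ := h₁.im_nonneg
  have h₆ := le_abs_self (W (v (K0.of E))).re
  have h₇ := abs_nonneg (W (v (K0.of E))).re
  rcases h₂ with h₂ | h₂
  · by_contra! h
    nlinarith
  · have : (W (v (K0.of A))).im = 0 := by linarith
    rcases h₁ with h₁ | h₁
    · linarith
    · linarith

variable [IsTriangulated C]

/-- A nonzero image would be a subobject of `Y` and a quotient of `X`. Semistability of `Y` makes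
its argument smaller than that of `X`; by the see-saw property the kernel would then destabilize
`X`. -/
theorem hom_eq_zero (hP : IsPreSlicing P) {φ₁ φ₂ : ℝ} {X Y : C} (hφ : φ₂ < φ₁)
    (hX : heartSlice P v W φ₁ X) (hY : heartSlice P v W φ₂ Y) (f : X ⟶ Y) : f = 0 := by
  rcases hX with hX | ⟨hX, hX₁, hX₂⟩
  · exact hX.eq_of_src _ _
  rcases hY with hY | ⟨hY, hY₁, hY₂⟩
  · exact hY.eq_of_tgt _ _
  obtain ⟨K, I, Q, p, i, rfl, hK, hI, hQ, hT, hT'⟩ := hP.exists_heart_factorization hX hY f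
  by_cases hI₀ : IsZero I
  · rw [hI₀.eq_of_tgt p 0, zero_comp]
  exfalso
  have h₁ := hY₂ I ⟨hI, Q, hQ, hT'⟩ hI₀
  rw [hY₁] at h₁
  have hIX : (W (v (K0.of I))).arg < (W (v (K0.of X))).arg := by
    rw [hX₁]
    exact h₁.trans_lt (mul_lt_mul_of_pos_left hφ Real.pi_pos)
  have hIu := hW.upper I hI hI₀
  have hX' := map_of_isTri (v := v) W hT
  by_cases hK₀ : IsZero K
  · rw [K0.of_isZero hK₀, map_zero, map_zero, zero_add] at hX'
    rw [hX'] at hIX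
    exact lt_irrefl _ hIX
  · have hKu := hW.upper K hK hK₀
    have h₂ := hX₂ K ⟨hK, I, hI, hT⟩ hK₀
    rw [hX'] at h₂ hIX
    rcases le_or_gt (W (v (K0.of K))).arg (W (v (K0.of I))).arg with h | h
    · exact absurd hIX (not_lt.2 (hKu.arg_le_arg_add hIu h).2)
    · rw [add_comm] at h₂
      exact absurd h₂ (not_le.2 (hIu.arg_lt_arg_add hKu h).2)

/-- A maximal destabilizing subobject. -/
theorem exists_maximal {E : C} (hE : heart P E) (hE₀ : ¬ IsZero E) :
    ∃ A B, heart P A ∧ heart P B ∧ IsTri A E B ∧ ¬ IsZero A ∧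
      (W (v (K0.of E))).arg ≤ (W (v (K0.of A))).arg ∧
      (∀ A', IsSub P A' E → ¬ IsZero A' → (W (v (K0.of A'))).arg ≤ (W (v (K0.of A))).arg) ∧
      ∀ B', IsSub P B' B → ¬ IsZero B' → (W (v (K0.of B'))).arg < (W (v (K0.of A))).arg := by
  have hfin := hW.finite_destabilizingClasses hE hE₀
  obtain ⟨x₀, hx₀, hmax₀⟩ := Set.exists_max_image _ (fun x => (W x).arg) hfin
    ⟨_, E, IsSub.refl hE, hE₀, rfl, le_rfl⟩
  -- Among the classes of maximal argument one of maximal norm is taken. If the quotient had a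
  -- subobject `B'` of argument at least that of `A`, its preimage would lie on the same ray with
  -- norm larger by `‖W(B')‖`.
  obtain ⟨x, ⟨hx, hxx₀⟩, hmax⟩ := Set.exists_max_image
    {x ∈ destabilizingClasses P v W E | (W x).arg = (W x₀).arg} (fun x => ‖W x‖)
    (hfin.subset fun _ h => h.1) ⟨x₀, hx₀, rfl⟩
  obtain ⟨A, ⟨hA, B, hB, hT⟩, hA₀, rfl, harg⟩ := hx
  have hmaxA : ∀ A', IsSub P A' E → ¬ IsZero A' →
      (W (v (K0.of A'))).arg ≤ (W (v (K0.of A))).arg := by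
    intro A' hA' hA'₀
    by_contra! h
    have := hmax₀ _ ⟨A', hA', hA'₀, rfl, harg.trans h.le⟩
    rw [← hxx₀] at this
    exact absurd h (not_lt.2 this)
  refine ⟨A, B, hA, hB, hT, hA₀, harg, hmaxA, fun B' hB' hB'₀ => ?_⟩
  by_contra! h
  have hAu := hW.upper A hA hA₀
  have hBu := hW.upper B' hB'.1 hB'₀
  obtain ⟨A', hA', hT'⟩ := hB'.exists_preimage hT hA
  have hsum := map_of_isTri (v := v) W hT'
  have hA'₀ : ¬ IsZero A' := by
    intro h₀
    rw [K0.of_isZero h₀, map_zero, map_zero] at hsum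
    exact (hAu.add hBu).ne_zero hsum.symm
  have h₁ := hmaxA A' hA' hA'₀
  have h₂ := hAu.arg_le_arg_add hBu h
  rw [← hsum] at h₂
  have h₃ : (W (v (K0.of A'))).arg = (W (v (K0.of A))).arg := le_antisymm h₁ h₂.1
  have h₄ : (W (v (K0.of A))).arg = (W (v (K0.of B'))).arg := by
    refine h.eq_or_lt.resolve_right fun h => ?_
    have := (hAu.arg_lt_arg_add hBu h).1
    rw [← hsum, h₃] at this
    exact lt_irrefl _ this
  have h₅ := hmax (v (K0.of A')) ⟨⟨A', hA', hA'₀, rfl, by rw [h₃]; exact harg⟩,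
    by rw [h₃]; exact hxx₀⟩
  rw [hsum, Complex.norm_add_eq h₄] at h₅
  have := norm_pos_iff.2 hBu.ne_zero
  linarith

/-- Harder-Narasimhan filtrations with respect to `W` in the heart of `P`. -/
theorem exists_filt_aux (n : ℕ) : ∀ E, heart P E → ¬ IsZero E →
    (destabilizingClasses P v W E).ncard ≤ n →
    ∃ l, Filt (heartSlice P v W) l E ∧
      ∀ φ ∈ l, ∃ A, IsSub P A E ∧ ¬ IsZero A ∧ Real.pi * φ ≤ (W (v (K0.of A))).arg := by
  induction n with
  | zero =>
    intro E hE hE₀ hn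
    have h := hW.finite_destabilizingClasses hE hE₀
    have h' := (Set.ncard_eq_zero h).1 (Nat.le_zero.1 hn)
    exact absurd (show v (K0.of E) ∈ destabilizingClasses P v W E from
      ⟨E, IsSub.refl hE, hE₀, rfl, le_rfl⟩) (by simp [h'])
  | succ n ih =>
    intro E hE hE₀ hn
    obtain ⟨A, B, hA, hB, hT, hA₀, harg, hmaxA, hmaxB⟩ := hW.exists_maximal hE hE₀
    have hAu := hW.upper A hA hA₀
    have hAs : heartSlice P v W ((W (v (K0.of A))).arg / Real.pi) A := by
      refine .inr ⟨hA, by rw [mul_div_cancel₀ _ Real.pi_ne_zero], fun A' hA' hA'₀ => ?_⟩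
      exact hmaxA A' (hA'.trans ⟨hA, B, hB, hT⟩) hA'₀
    have hFA := Filt.singleton hAs hA₀
    have hAE : IsSub P A E := ⟨hA, B, hB, hT⟩
    have hphase : Real.pi * ((W (v (K0.of A))).arg / Real.pi) ≤ (W (v (K0.of A))).arg :=
      (mul_div_cancel₀ _ Real.pi_ne_zero).le
    by_cases hB₀ : IsZero B
    · obtain ⟨e⟩ := hT.nonempty_iso_left hB₀
      refine ⟨_, hFA.of_iso e, fun φ hφ => ⟨A, hAE, hA₀, ?_⟩⟩
      rw [List.mem_singleton.1 hφ]
      exact hphase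
    have hBu := hW.upper B hB hB₀
    -- Adding the class of `A` maps the destabilizing classes of `B` injectively to those of `E`, by
    -- taking preimages. The class of `A` itself is missed, since a nonzero object of the heart does
    -- not have class 0.
    have hcard : (destabilizingClasses P v W B).ncard ≤ n := by
      rw [← Nat.lt_succ_iff]
      refine lt_of_lt_of_le ?_ hn
      rw [← Set.ncard_image_of_injective _ (add_right_injective (v (K0.of A)))]
      refine Set.ncard_lt_ncard ?_ (hW.finite_destabilizingClasses hE hE₀)
      refine (Set.ssubset_iff_of_subset ?_).2 ⟨v (K0.of A), ⟨A, hAE, hA₀, rfl, harg⟩, ?_⟩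
      · rintro _ ⟨_, ⟨B', hB', hB'₀, rfl, hB'arg⟩, rfl⟩
        obtain ⟨A', hA', hT'⟩ := hB'.exists_preimage hT hA
        have hsum := map_of_isTri (v := v) W hT'
        have hB'u := hW.upper B' hB'.1 hB'₀
        have hA'u : IsUpper (W (v (K0.of A'))) := by rw [hsum]; exact hAu.add hB'u
        have hlt := hmaxB B' hB' hB'₀
        refine ⟨A', hA', ?_, ?_, ?_⟩
        · intro h₀
          exact hA'u.ne_zero (by rw [K0.of_isZero h₀, map_zero, map_zero])
        · rw [K0.of_add hT', map_add]
        · rw [map_add, ← hsum]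
          obtain ⟨-, D, hD, hT''⟩ := hB'
          have hE' : W (v (K0.of E)) = W (v (K0.of A')) + W (v (K0.of D)) := by
            rw [map_of_isTri W hT, hsum, map_of_isTri W hT'', add_assoc]
          by_cases hD₀ : IsZero D
          · rw [hE', K0.of_isZero hD₀, map_zero, map_zero, add_zero]
          have hDu := hW.upper D hD hD₀
          rw [← hBu.cross_nonneg_iff hB'u, map_of_isTri (v := v) W hT'', cross_add_left,
            cross_self, zero_add, hDu.cross_nonneg_iff hB'u] at hB'arg
          have h₁ := (hB'u.arg_le_arg_add hAu hlt.le).1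
          rw [add_comm, ← hsum] at h₁
          rw [hE', add_comm]
          exact (hDu.arg_le_arg_add hA'u (hB'arg.trans h₁)).2
      · rintro ⟨_, ⟨B', hB', hB'₀, rfl, -⟩, h⟩
        have : v (K0.of B') = 0 := by simpa using h
        exact (hW.upper B' hB'.1 hB'₀).ne_zero (by rw [this, map_zero])
    obtain ⟨l, hl, hl'⟩ := ih B hB hB₀ hcard
    refine ⟨l ++ [(W (v (K0.of A))).arg / Real.pi], Filt.append hT hFA hl ?_, ?_⟩
    · intro φ hφ ψ hψ
      rw [List.mem_singleton.1 hψ, lt_div_iff₀ Real.pi_pos, mul_comm]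
      obtain ⟨B', hB', hB'₀, h⟩ := hl' φ hφ
      exact h.trans_lt (hmaxB B' hB' hB'₀)
    · intro φ hφ
      refine ⟨A, hAE, hA₀, ?_⟩
      rcases List.mem_append.1 hφ with hφ | hφ
      · obtain ⟨B', hB', hB'₀, h⟩ := hl' φ hφ
        exact h.trans (hmaxB B' hB' hB'₀).le
      · rw [List.mem_singleton.1 hφ]
        exact hphase

theorem exists_filt {E : C} (hE : heart P E) : ∃ l, Filt (heartSlice P v W) l E := by
  by_cases hE₀ : IsZero E
  · exact ⟨_, .zero hE₀⟩
  · obtain ⟨l, hl, -⟩ := hW.exists_filt_aux _ E hE hE₀ le_rfl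
    exact ⟨l, hl⟩

end IsStabFun

/-- The family of subcategories with the given heart and the given stability function. -/
def slicesOfHeart (P : ℝ → ObjectProperty C) (v : K0 C →+ Λ) (W : Λ →+ ℂ) (φ : ℝ) :
    ObjectProperty C := fun X =>
  -- `⌈φ⌉ - 1` is the unique integer `n` with `φ - n` in `(0, 1]`.
  heartSlice P v W (φ - (⌈φ⌉ - 1 : ℤ)) (X⟦-(⌈φ⌉ - 1)⟧)

theorem slicesOfHeart_shift {φ : ℝ} (h₀ : 0 < φ) (h₁ : φ ≤ 1) (n : ℤ) {X : C}
    (hX : heartSlice P v W φ X) : slicesOfHeart P v W (φ + n) (X⟦n⟧) := by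
  have hn : ⌈φ + n⌉ - 1 = n := by
    have : ⌈φ⌉ = 1 := Int.ceil_eq_iff.2 ⟨by simpa using h₀, by simpa using h₁⟩
    rw [Int.ceil_add_intCast, this]; ring
  rw [slicesOfHeart, hn, add_sub_cancel_right]
  exact heartSlice_of_iso (shiftShiftNeg X n).symm hX

variable [IsTriangulated C]

/-- The old slicing is needed only across different shifts of the heart: it separates them and cuts
any object into finitely many pieces, one in each shift. Inside one shift everything comes from `W`.
-/
theorem IsStabFun.isPreSlicing (hP : IsPreSlicing P) (hW : IsStabFun P v W) :
    IsPreSlicing (slicesOfHeart P v W) where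
  of_iso e h := heartSlice_of_iso ((shiftFunctor C _).mapIso e) h
  of_isZero φ X h := .inl ((isZero_shift_iff _ _).2 h)
  shift_iff φ A := by
    have e : (A⟦(1 : ℤ)⟧)⟦-(⌈φ⌉ + 1 - 1)⟧ ≅ A⟦-(⌈φ⌉ - 1)⟧ :=
      ((shiftFunctorAdd' C 1 (-(⌈φ⌉ + 1 - 1)) (-(⌈φ⌉ - 1)) (by ring)).app A).symm
    have h : φ + 1 - ((⌈φ⌉ + 1 - 1 : ℤ) : ℝ) = φ - ((⌈φ⌉ - 1 : ℤ) : ℝ) := by push_cast; ring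
    rw [slicesOfHeart, slicesOfHeart, Int.ceil_add_one, h]
    exact ⟨heartSlice_of_iso e, heartSlice_of_iso e.symm⟩
  hom_eq_zero {φ₁ φ₂ A₁ A₂} hφ h₁ h₂ f := by
    rw [slicesOfHeart] at h₁ h₂
    rcases eq_or_ne ⌈φ₁⌉ ⌈φ₂⌉ with h | h
    · rw [h] at h₁
      have := hW.hom_eq_zero hP (sub_lt_sub_right hφ _) h₁ h₂ (f⟦-(⌈φ₂⌉ - 1)⟧')
      exact (shiftFunctor C (-(⌈φ₂⌉ - 1))).map_injective (by rw [this, Functor.map_zero])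
    · have hlt : ⌈φ₂⌉ ≤ ⌈φ₁⌉ - 1 :=
        Int.le_sub_one_of_lt (lt_of_le_of_ne (Int.ceil_mono hφ.le) h.symm)
      have hlt' : (⌈φ₂⌉ : ℝ) ≤ ((⌈φ₁⌉ - 1 : ℤ) : ℝ) := by exact_mod_cast hlt
      have k₁ : heart P (A₁⟦-(⌈φ₁⌉ - 1)⟧) := h₁.elim heart.of_isZero fun h => h.1
      have k₂ : heart P (A₂⟦-(⌈φ₂⌉ - 1)⟧) := h₂.elim heart.of_isZero fun h => h.1
      refine hP.hom_eq_zero_of_orth (isUpperSet_Ioi ((⌈φ₁⌉ - 1 : ℤ) : ℝ)) ?_ ?_ f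
      · refine ((hP.lOrth_shift k₁.1 (⌈φ₁⌉ - 1)).of_iso (shiftNegIso _ _)).mono fun x hx => ?_
        simpa using hx
      · refine ((hP.rOrth_shift k₂.2 (⌈φ₂⌉ - 1)).of_iso (shiftNegIso _ _)).mono fun x hx => ?_
        simp only [Set.mem_Ioi, Set.mem_ofPred_eq] at *
        push_cast at *
        linarith
  exists_filt A := by
    -- Induction on the number of unit intervals covering the old phases: the part in the top
    -- interval lies in a shift of the heart and is filtered by `W`. The bounds on the new phases
    -- let the filtrations be concatenated.
    have key : ∀ (k : ℕ) (m : ℤ) (l : List ℝ) (E : C), Filt P l E →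
        (∀ φ ∈ l, (m : ℝ) < φ ∧ φ ≤ m + k) →
        ∃ l', Filt (slicesOfHeart P v W) l' E ∧ ∀ φ ∈ l', (m : ℝ) < φ ∧ φ ≤ m + k := by
      intro k
      induction k with
      | zero =>
        intro m l E hl hm
        cases l with
        | nil => exact ⟨[], .zero hl.isZero_of_nil, by simp⟩
        | cons φ l =>
          have := hm φ (by simp)
          simp only [Nat.cast_zero, add_zero] at this
          linarith
      | succ k ih =>
        intro m l E hl hm
        obtain ⟨l₁, l₂, T, F, rfl, h₁, h₂, hT, hl₂, hl₁⟩ :=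
          hl.split (isUpperSet_Ioi ((m : ℝ) + k))
        obtain ⟨l₁', hl₁', h₁'⟩ := ih m l₁ F hl₁ fun φ hφ =>
          ⟨(hm φ (by simp [hφ])).1, not_lt.1 (h₁ φ hφ)⟩
        have hT₀ : heart P (T⟦-(m + k)⟧) := by
          refine hP.heart_of_filt (hP.filt_shift hl₂ (-(m + k))) ?_
          intro ψ hψ
          obtain ⟨φ, hφ, rfl⟩ := List.mem_map.1 hψ
          have e₁ := h₂ φ hφ
          have e₂ := (hm φ (by simp [hφ])).2
          simp only [Set.mem_Ioi] at e₁
          push_cast at *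
          constructor <;> linarith
        obtain ⟨l₀, hl₀⟩ := hW.exists_filt hT₀
        have hmem := hW.phase_mem_of_filt hl₀
        have hl₀' := (hl₀.shift (P' := slicesOfHeart P v W) (m + k) fun φ hφ X hX =>
          slicesOfHeart_shift (hmem φ hφ).1 (hmem φ hφ).2 _ hX).of_iso (shiftNegIso _ _)
        have hmem' : ∀ ψ ∈ l₀.map (· + ((m + k : ℤ) : ℝ)),
            (m : ℝ) + k < ψ ∧ ψ ≤ m + (k + 1 : ℕ) := by
          intro ψ hψ
          obtain ⟨φ, hφ, rfl⟩ := List.mem_map.1 hψ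
          have := hmem φ hφ
          push_cast
          constructor <;> linarith
        refine ⟨_, Filt.append hT hl₀' hl₁' fun φ hφ ψ hψ =>
          (h₁' φ hφ).2.trans_lt (hmem' ψ hψ).1, fun φ hφ => ?_⟩
        rcases List.mem_append.1 hφ with hφ | hφ
        · refine ⟨(h₁' φ hφ).1, (h₁' φ hφ).2.trans ?_⟩
          push_cast
          linarith
        · refine ⟨lt_of_le_of_lt ?_ (hmem' φ hφ).1, (hmem' φ hφ).2⟩
          simp
    obtain ⟨l, hl⟩ := hP.exists_filt A
    obtain ⟨N, hN⟩ : ∃ N : ℕ, ∀ φ ∈ l, -(N : ℝ) < φ ∧ φ ≤ N := by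
      clear hl
      induction l with
      | nil => exact ⟨0, by simp⟩
      | cons φ l ih =>
        obtain ⟨N, hN⟩ := ih
        obtain ⟨M, hM⟩ := exists_nat_gt |φ|
        refine ⟨max N M, fun ψ hψ => ?_⟩
        have e₁ : (N : ℝ) ≤ (max N M : ℕ) := by exact_mod_cast le_max_left N M
        have e₂ : (M : ℝ) ≤ (max N M : ℕ) := by exact_mod_cast le_max_right N M
        rcases List.mem_cons.1 hψ with rfl | hψ
        · rw [abs_lt] at hM
          constructor <;> linarith
        · have := hN ψ hψ
          constructor <;> linarith
    obtain ⟨l', hl', -⟩ := key (2 * N) (-N) l A hl fun φ hφ => by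
      have := hN φ hφ
      push_cast
      constructor <;> linarith
    exact ⟨l', hl'⟩

end

end Heart

end Bridgeland

namespace Bridgeland

universe w u

/-! ### Deforming the charge with fixed imaginary part -/

section Deformation

variable {C : Type u} [Category.{w} C] [HasZeroObject C] [HasShift C ℤ] [Preadditive C]
  [∀ n : ℤ, (shiftFunctor C n).Additive] [Pretriangulated C]
  {Λ : Type*} [AddCommGroup Λ] {v : K0 C →+ Λ}

/-- `W` is a deformation of the real part of the central charge of `σ` which is small compared
with the norm `N`, and the support property of `σ` holds for `N` with constant `K`. -/
structure IsSmallDeformation (σ : StabPrecondition v) (W : Λ →+ ℂ) (N : Λ → ℝ) (K η : ℝ) :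
    Prop where
  im_eq : ∀ x, (W x).im = (σ.Z x).im
  map_zero : N 0 = 0
  nonneg : ∀ x, 0 ≤ N x
  add_le : ∀ x y, N (x + y) ≤ N x + N y
  le_norm : ∀ A, σ.IsSemistable A → N (v (K0.of A)) ≤ K * ‖σ.Z (v (K0.of A))‖
  norm_sub_le : ∀ x, ‖W x - σ.Z x‖ ≤ η * N x
  finite_le : ∀ M : ℝ, {x : Λ | N x ≤ M}.Finite
  K_nonneg : 0 ≤ K
  η_nonneg : 0 ≤ η
  mul_le : η * K ≤ 1 / 2

theorem StabPrecondition.upper_of_mem (σ : StabPrecondition v) {φ : ℝ} {A : C}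
    (hA : σ.slicing.P φ A) (hA₀ : ¬ IsZero A) (h₀ : 0 < φ) (h₁ : φ ≤ 1) :
    IsUpper (σ.Z (v (K0.of A))) ∧ (σ.Z (v (K0.of A))).arg = Real.pi * φ := by
  obtain ⟨m, hm, h⟩ := σ.compat φ A hA hA₀
  obtain ⟨h₂, h₃, -⟩ := IsUpper.of_exp hm h₀ h₁ h
  exact ⟨h₂, h₃⟩

namespace IsSmallDeformation

variable {σ : StabPrecondition v} {W : Λ →+ ℂ} {N : Λ → ℝ} {K η : ℝ}
  (h : IsSmallDeformation σ W N K η)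
include h

theorem norm_sub_le_of_mem {φ : ℝ} {A : C} (hA : σ.slicing.P φ A) (hA₀ : ¬ IsZero A) :
    ‖W (v (K0.of A)) - σ.Z (v (K0.of A))‖ ≤ η * K * ‖σ.Z (v (K0.of A))‖ :=
  (h.norm_sub_le _).trans (by
    rw [mul_assoc]
    exact mul_le_mul_of_nonneg_left (h.le_norm A ⟨hA₀, φ, hA⟩) h.η_nonneg)

/-- Only charges on the negative real axis could leave the region, as imaginary parts are unchanged;
they stay on it because the charge moves by at most half of its absolute value. -/
theorem upper_of_mem {φ : ℝ} {A : C} (hA : σ.slicing.P φ A) (hA₀ : ¬ IsZero A) (h₀ : 0 < φ)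
    (h₁ : φ ≤ 1) : IsUpper (W (v (K0.of A))) := by
  obtain ⟨hu, -⟩ := σ.upper_of_mem hA hA₀ h₀ h₁
  rw [IsUpper, h.im_eq]
  rcases hu with hu | ⟨hu, hu'⟩
  · exact .inl hu
  · refine .inr ⟨hu, ?_⟩
    have h₂ := h.norm_sub_le_of_mem hA hA₀
    have h₃ := (Complex.re_le_norm _).trans h₂
    have h₄ : ‖σ.Z (v (K0.of A))‖ = -(σ.Z (v (K0.of A))).re := by
      rw [← abs_of_neg hu', Complex.abs_re_eq_norm.2 hu]
    rw [Complex.sub_re, h₄] at h₃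
    nlinarith [h.mul_le]

variable [IsTriangulated C]

theorem upper {A : C} (hA : heart σ.slicing.P A) (hA₀ : ¬ IsZero A) :
    IsUpper (W (v (K0.of A))) := by
  obtain ⟨l, hl⟩ := σ.slicing.isPreSlicing.exists_filt A
  have hl' := σ.slicing.isPreSlicing.mem_of_heart hl hA
  refine hl.class_induction v (D := fun x => IsUpper (W x))
    (fun x y hx hy => by rw [_root_.map_add]; exact hx.add hy) (fun φ hφ X hX hX₀ => ?_) hA₀
  exact h.upper_of_mem hX hX₀ (hl' φ hφ).1 (hl' φ hφ).2

/-- The norm of the class of an object is bounded by its charge and the charge of its part of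
phase larger than `1 / 2`. -/
theorem exists_norm_le {A : C} (hA : heart σ.slicing.P A) :
    ∃ T, IsSub σ.slicing.P T A ∧ lOrth σ.slicing.P (Set.Iic (1 / 2)) T ∧
      N (v (K0.of A)) ≤ K * ((σ.Z (v (K0.of A))).im + (σ.Z (v (K0.of A))).re -
        2 * (σ.Z (v (K0.of T))).re) := by
  have hP := σ.slicing.isPreSlicing
  obtain ⟨l, hl⟩ := hP.exists_filt A
  have hmem := hP.mem_of_heart hl hA
  obtain ⟨l₁, l₂, T, F, rfl, h₁, h₂, hT, hl₂, hl₁⟩ := hl.split (isUpperSet_Ioi (1 / 2 : ℝ))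
  have hTh : heart σ.slicing.P T := hP.heart_of_filt hl₂ fun φ hφ => hmem φ (by simp [hφ])
  have hFh : heart σ.slicing.P F := hP.heart_of_filt hl₁ fun φ hφ => hmem φ (by simp [hφ])
  refine ⟨T, ⟨hTh, F, hFh, hT⟩, hP.lOrth_of_filt hl₂ fun φ hφ _ hψ =>
    lt_of_le_of_lt hψ (h₂ φ hφ), ?_⟩
  have hK := h.K_nonneg
  -- The real part has constant sign on the factors of `T` and on those of `F`, so without absolute
  -- values the bound is additive and sums over each half.
  have key : ∀ x : Λ, N x ≤ K * ‖σ.Z x‖ → N x ≤ K * (|(σ.Z x).re| + |(σ.Z x).im|) := fun x hx =>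
    hx.trans (mul_le_mul_of_nonneg_left (Complex.norm_le_abs_re_add_abs_im _) hK)
  have eT : N (v (K0.of T)) ≤ K * ((σ.Z (v (K0.of T))).im - (σ.Z (v (K0.of T))).re) := by
    by_cases hT₀ : IsZero T
    · simp [K0.of_isZero hT₀, h.map_zero]
    refine hl₂.class_induction v (D := fun x => N x ≤ K * ((σ.Z x).im - (σ.Z x).re))
      (fun x y hx hy => (h.add_le x y).trans ?_) (fun φ hφ X hX hX₀ => ?_) hT₀
    · rw [_root_.map_add, Complex.add_im, Complex.add_re]
      linarith
    · have hφ₁ := hmem φ (by simp [hφ])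
      have hφ₂ : 1 / 2 < φ := h₂ φ hφ
      obtain ⟨hu, harg⟩ := σ.upper_of_mem hX hX₀ hφ₁.1 hφ₁.2
      have hre : (σ.Z (v (K0.of X))).re ≤ 0 := by
        rw [← Complex.norm_mul_cos_arg, harg]
        exact mul_nonpos_of_nonneg_of_nonpos (norm_nonneg _)
          (Real.cos_nonpos_of_pi_div_two_le_of_le (by nlinarith [Real.pi_pos])
            (by nlinarith [Real.pi_pos]))
      have := key _ (h.le_norm X ⟨hX₀, φ, hX⟩)
      rw [abs_of_nonpos hre, abs_of_nonneg hu.im_nonneg] at this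
      linarith
  have eF : N (v (K0.of F)) ≤ K * ((σ.Z (v (K0.of F))).im + (σ.Z (v (K0.of F))).re) := by
    by_cases hF₀ : IsZero F
    · simp [K0.of_isZero hF₀, h.map_zero]
    refine hl₁.class_induction v (D := fun x => N x ≤ K * ((σ.Z x).im + (σ.Z x).re))
      (fun x y hx hy => (h.add_le x y).trans ?_) (fun φ hφ X hX hX₀ => ?_) hF₀
    · rw [_root_.map_add, Complex.add_im, Complex.add_re]
      linarith
    · have hφ₁ := hmem φ (by simp [hφ])
      have hφ₂ : φ ≤ 1 / 2 := not_lt.1 (h₁ φ hφ)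
      obtain ⟨hu, harg⟩ := σ.upper_of_mem hX hX₀ hφ₁.1 hφ₁.2
      have hre : 0 ≤ (σ.Z (v (K0.of X))).re := by
        rw [← Complex.norm_mul_cos_arg, harg]
        exact mul_nonneg (norm_nonneg _)
          (Real.cos_nonneg_of_neg_pi_div_two_le_of_le (by nlinarith [Real.pi_pos])
            (by nlinarith [Real.pi_pos]))
      have := key _ (h.le_norm X ⟨hX₀, φ, hX⟩)
      rw [abs_of_nonneg hre, abs_of_nonneg hu.im_nonneg] at this
      linarith
  have e := congrArg N (map_of_isTri (v := v) (AddMonoidHom.id Λ) hT)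
  simp only [AddMonoidHom.id_apply] at e
  rw [e, map_of_isTri (v := v) σ.Z hT, Complex.add_im, Complex.add_re]
  have := h.add_le (v (K0.of T)) (v (K0.of F))
  linarith

omit h in
/-- Subobjects of `E` of phase larger than `1 / 2` have charge to the right of the charge of the
maximal such subobject. -/
theorem _root_.Bridgeland.StabPrecondition.re_le_of_isSub {E T F A : C} (hT : IsTri T E F)
    (hT₁ : lOrth σ.slicing.P (Set.Iic (1 / 2)) T) (hF : rOrth σ.slicing.P (Set.Ioi (1 / 2)) F)
    (hA : IsSub σ.slicing.P A E) (hA₁ : lOrth σ.slicing.P (Set.Iic (1 / 2)) A) :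
    (σ.Z (v (K0.of T))).re ≤ (σ.Z (v (K0.of A))).re := by
  have hP := σ.slicing.isPreSlicing
  obtain ⟨hA, B, hB, hT'⟩ := hA
  -- The inclusion of `A` factors through `T`, and the cone `X` of `A ⟶ T` has phases in `(1 / 2,
  -- 1]`. Hence the real part of its charge is at most 0, and that of `T` is at most that of `A`.
  obtain ⟨X, hX, hX'⟩ := hT.lift hT'
    (hP.hom_eq_zero_of_orth (isUpperSet_Ioi (1 / 2)) (by rwa [Set.compl_Ioi]) hF)
  have h₁ : lOrth σ.slicing.P (Set.Iic (1 / 2)) X := by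
    refine lOrth.mid hX.rotate hT₁ ((hP.lOrth_shift hA₁ 1).mono fun x hx => ?_)
    simp only [Set.mem_Iic, Set.mem_ofPred_eq] at *
    push_cast
    linarith
  have h₂ : rOrth σ.slicing.P (Set.Ioi 1) X := by
    refine rOrth.mid hX'.invRotate ((hP.rOrth_shift hF (-1)).mono fun x hx => ?_) hB.2
    simp only [Set.mem_Ioi, Set.mem_ofPred_eq] at *
    push_cast
    linarith
  have h₃ : (σ.Z (v (K0.of X))).re ≤ 0 := by
    by_cases hX₀ : IsZero X
    · simp [K0.of_isZero hX₀]
    obtain ⟨l, hl⟩ := hP.exists_filt X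
    refine hl.class_induction v (D := fun x => (σ.Z x).re ≤ 0)
      (fun x y hx hy => by rw [map_add, Complex.add_re]; linarith) (fun φ hφ Y hY hY₀ => ?_) hX₀
    have hφ₁ : 1 / 2 < φ :=
      hP.mem_of_lOrth hl (isUpperSet_Ioi (1 / 2)) (by rwa [Set.compl_Ioi]) φ hφ
    have hφ₂ : φ ≤ 1 := not_lt.1 (hP.notMem_of_rOrth hl (isUpperSet_Ioi 1) h₂ φ hφ)
    obtain ⟨hu, harg⟩ := σ.upper_of_mem hY hY₀ (by linarith) hφ₂
    rw [← Complex.norm_mul_cos_arg, harg]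
    exact mul_nonpos_of_nonneg_of_nonpos (norm_nonneg _)
      (Real.cos_nonpos_of_pi_div_two_le_of_le (by nlinarith [Real.pi_pos])
        (by nlinarith [Real.pi_pos]))
  rw [map_of_isTri (v := v) σ.Z hX, Complex.add_re]
  linarith

/-- Subobjects in a left half plane have bounded norm: `exists_norm_le` bounds the norm by the
charge of the subobject and of its part of phase above `1 / 2`, and the real part of the latter is
bounded below independently of the subobject. -/
theorem isStabFun : IsStabFun σ.slicing.P v W where
  upper _ hA hA₀ := h.upper hA hA₀
  finite E hE R := by
    have hP := σ.slicing.isPreSlicing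
    obtain ⟨T, F, hT, hT₁, hF⟩ := hP.exists_truncation (isUpperSet_Ioi (1 / 2)) E
    rw [Set.compl_Ioi] at hT₁
    -- Replacing the real part of `W` by that of `Z` costs `η N(A)`, which contributes at most `N(A)
    -- / 2` since `η K ≤ 1 / 2`. Moving this term to the left produces the factor 2.
    refine (h.finite_le (2 * (K * ((σ.Z (v (K0.of E))).im + R -
      2 * (σ.Z (v (K0.of T))).re)))).subset ?_
    rintro _ ⟨⟨A, hA, rfl⟩, hR⟩
    obtain ⟨S, hS, hS₁, hN⟩ := h.exists_norm_le hA.1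
    have h₁ := σ.re_le_of_isSub hT hT₁ hF (hS.trans hA) hS₁
    have h₂ : (σ.Z (v (K0.of A))).im ≤ (σ.Z (v (K0.of E))).im := by
      obtain ⟨hA, B, hB, hT'⟩ := hA
      rw [map_of_isTri (v := v) σ.Z hT', Complex.add_im, le_add_iff_nonneg_right]
      by_cases hB₀ : IsZero B
      · simp [K0.of_isZero hB₀]
      · rw [← h.im_eq]
        exact (h.upper hB hB₀).im_nonneg
    have h₃ := (neg_le_abs _).trans ((Complex.abs_re_le_norm _).trans
      (h.norm_sub_le (v (K0.of A))))
    rw [Complex.sub_re] at h₃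
    have hK := h.K_nonneg
    have h₄ : K * ((σ.Z (v (K0.of A))).im + (σ.Z (v (K0.of A))).re -
        2 * (σ.Z (v (K0.of S))).re) ≤ K * ((σ.Z (v (K0.of E))).im +
        (R + η * N (v (K0.of A))) - 2 * (σ.Z (v (K0.of T))).re) :=
      mul_le_mul_of_nonneg_left (by linarith) hK
    have h₆ := mul_le_mul_of_nonneg_right h.mul_le (h.nonneg (v (K0.of A)))
    rw [Set.mem_ofPred_eq]
    nlinarith

/-- The deformed stability precondition. -/
def deform : StabPrecondition v where
  slicing := (h.isStabFun.isPreSlicing σ.slicing.isPreSlicing).toSlicing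
  Z := W
  compat φ A hA hA₀ := by
    obtain ⟨n, hn⟩ : ∃ n : ℤ, ⌈φ⌉ - 1 = n := ⟨_, rfl⟩
    change slicesOfHeart σ.slicing.P v W φ A at hA
    rw [slicesOfHeart, hn] at hA
    obtain ⟨hX, harg, -⟩ := hA.resolve_left (by rwa [isZero_shift_iff])
    have hu := h.upper hX (by rwa [isZero_shift_iff])
    refine ⟨_, norm_pos_iff.2 hu.ne_zero, ?_⟩
    have e : K0.of A = n.negOnePow • K0.of (A⟦-n⟧) := by
      rw [← K0.of_shift, K0.of_iso (shiftNegIso A n)]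
    have e' : W (v (K0.of A)) =
        W (v (K0.of (A⟦-n⟧))) * Complex.exp (n * (Real.pi * Complex.I)) := by
      rw [e]
      rcases Int.even_or_odd n with hn | hn
      · rw [Int.negOnePow_even n hn, one_smul]
        obtain ⟨k, rfl⟩ := hn.exists_two_nsmul
        have : ((2 • k : ℤ) : ℂ) * (Real.pi * Complex.I) = k * (2 * Real.pi * Complex.I) := by
          push_cast [nsmul_eq_mul]; ring
        rw [this, Complex.exp_int_mul_two_pi_mul_I, mul_one]
      · rw [Int.negOnePow_odd n hn, Units.neg_smul, one_smul]
        obtain ⟨k, rfl⟩ := hn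
        have : ((2 * k + 1 : ℤ) : ℂ) * (Real.pi * Complex.I) =
            k * (2 * Real.pi * Complex.I) + Real.pi * Complex.I := by
          push_cast; ring
        rw [this, Complex.exp_add, Complex.exp_int_mul_two_pi_mul_I, Complex.exp_pi_mul_I]
        simp
    rw [e']
    nth_rewrite 1 [← Complex.norm_mul_exp_arg_mul_I (W (v (K0.of (A⟦-n⟧))))]
    rw [harg, mul_assoc, ← Complex.exp_add]
    congr 2
    push_cast
    ring

omit h in
/-- The classes of the Harder-Narasimhan factors of an object of the heart; their partial sums
are classes of subobjects. -/
theorem _root_.Bridgeland.StabPrecondition.exists_classes {l : List ℝ} {E : C}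
    (hl : Filt σ.slicing.P l E) (hmem : ∀ φ ∈ l, 0 < φ ∧ φ ≤ 1) :
    ∃ X : List Λ, X.sum = v (K0.of E) ∧ (X = [] → l = []) ∧
      (∀ x ∈ X, ∃ φ ∈ l, ∃ A, σ.slicing.P φ A ∧ ¬ IsZero A ∧ x = v (K0.of A)) ∧
      (X.Pairwise fun a b => (σ.Z a).arg ≤ (σ.Z b).arg) ∧
      ∀ s, s <:+ X → ∃ A, IsSub σ.slicing.P A E ∧ v (K0.of A) = s.sum := by
  have hP := σ.slicing.isPreSlicing
  induction hl with
  | zero h₀ =>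
    refine ⟨[], by simp [K0.of_isZero h₀], by simp, by simp, by simp, fun s hs => ?_⟩
    rw [List.suffix_nil.1 hs]
    exact ⟨_, IsSub.refl (heart.of_isZero h₀), by simp [K0.of_isZero h₀]⟩
  | @cons A' A E φ l hT hE hE₀ hφ hA' ih =>
    obtain ⟨X, hsum, -, hX, hZX, hs⟩ := ih fun ψ hψ => hmem ψ (by simp [hψ])
    have hA := hP.heart_of_filt (Filt.cons hT hE hE₀ hφ hA') hmem
    have hA'h := hP.heart_of_filt hA' fun ψ hψ => hmem ψ (by simp [hψ])
    have hφ₁ := hmem φ (by simp)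
    have hEh := hP.heart_of_filt (Filt.singleton hE hE₀) (by simpa using hφ₁)
    have hsum' : v (K0.of A) = (v (K0.of E) :: X).sum := by
      rw [List.sum_cons, hsum, K0.of_add hT, map_add, add_comm]
    refine ⟨v (K0.of E) :: X, hsum'.symm, by simp, ?_, List.pairwise_cons.2 ⟨?_, hZX⟩, ?_⟩
    · intro x hx
      rcases List.mem_cons.1 hx with rfl | hx
      · exact ⟨φ, by simp, E, hE, hE₀, rfl⟩
      · obtain ⟨ψ, hψ, h'⟩ := hX x hx
        exact ⟨ψ, by simp [hψ], h'⟩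
    · intro x hx
      obtain ⟨ψ, hψ, B, hB, hB₀, rfl⟩ := hX x hx
      have hψ₁ := hmem ψ (by simp [hψ])
      rw [(σ.upper_of_mem hE hE₀ hφ₁.1 hφ₁.2).2, (σ.upper_of_mem hB hB₀ hψ₁.1 hψ₁.2).2]
      exact mul_le_mul_of_nonneg_left (hφ ψ hψ).le Real.pi_pos.le
    · intro s hsu
      rcases List.suffix_cons_iff.1 hsu with rfl | hsu
      · exact ⟨A, IsSub.refl hA, hsum'⟩
      · obtain ⟨B, hB, hB'⟩ := hs s hsu
        exact ⟨B, hB.trans ⟨hA'h, E, hEh, hT⟩, hB'⟩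

/-- This applies `quadraticForm_sum_nonneg` to the classes of the old Harder-Narasimhan factors.
Sums of suffixes are classes of subobjects of `E`, so the condition on `W`-arguments is the
semistability of `E`. -/
theorem nonneg_of_heartSlice {Q : QuadraticForm ℝ (ℝ ⊗[ℤ] Λ)}
    (hQσ : ∀ A, σ.IsSemistable A → 0 ≤ Q ((1 : ℝ) ⊗ₜ[ℤ] v (K0.of A)))
    (hQ : ∀ t : ℝ, 0 ≤ t → t ≤ 1 → ∀ x, ((1 - t : ℝ) : ℂ) * extendReal σ.Z x +
      (t : ℂ) * extendReal W x = 0 → x ≠ 0 → Q x < 0) {φ : ℝ} {E : C}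
    (hE : heartSlice σ.slicing.P v W φ E) : 0 ≤ Q ((1 : ℝ) ⊗ₜ[ℤ] v (K0.of E)) := by
  by_cases hE₀ : IsZero E
  · simp [K0.of_isZero hE₀]
  obtain ⟨hEh, -, hss⟩ := hE.resolve_left hE₀
  have hP := σ.slicing.isPreSlicing
  obtain ⟨l, hl⟩ := hP.exists_filt E
  have hmem := hP.mem_of_heart hl hEh
  obtain ⟨X, hsum, hXl, hX, hZX, hs⟩ := σ.exists_classes hl hmem
  let ι : Λ →+ ℝ ⊗[ℤ] Λ := (TensorProduct.mk ℤ ℝ Λ 1).toAddMonoidHom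
  have hι : ∀ (F : Λ →+ ℂ) x, extendReal F (ι x) = F x := fun F x => by
    simp [ι, extendReal]
  have him : ∀ x, (extendReal W x).im = (extendReal σ.Z x).im := by
    intro x
    induction x using TensorProduct.induction_on with
    | zero => simp
    | tmul r x => simp [extendReal, h.im_eq]
    | add x y hx hy => simp [hx, hy]
  have hu : ∀ x ∈ X, 0 ≤ Q (ι x) ∧ IsUpper (extendReal σ.Z (ι x)) ∧
      IsUpper (extendReal W (ι x)) := by
    intro x hx
    obtain ⟨ψ, hψ, A, hA, hA₀, rfl⟩ := hX x hx
    rw [hι, hι]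
    exact ⟨hQσ A ⟨hA₀, ψ, hA⟩, (σ.upper_of_mem hA hA₀ (hmem ψ hψ).1 (hmem ψ hψ).2).1,
      h.upper_of_mem hA hA₀ (hmem ψ hψ).1 (hmem ψ hψ).2⟩
  have := quadraticForm_sum_nonneg Q ι (extendReal σ.Z) (extendReal W) him hQ X
    (fun h₀ => hl.ne_nil hE₀ (hXl h₀)) hu (by simpa only [hι] using hZX) (fun s hsX hs₀ => ?_)
  · rwa [hsum] at this
  · rw [hι, hι, hsum]
    obtain ⟨A, hA, hAs⟩ := hs s hsX
    rw [← hAs]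
    refine hss A hA fun hA₀ => ?_
    have h₁ := isUpper_sum W (L := s) (fun x hx => by
      have := (hu x (hsX.subset hx)).2.2
      rwa [hι] at this) hs₀
    rw [← hAs, K0.of_isZero hA₀, _root_.map_zero, _root_.map_zero] at h₁
    exact h₁.ne_zero rfl

theorem supportWrt_deform {Q : QuadraticForm ℝ (ℝ ⊗[ℤ] Λ)}
    (hQσ : ∀ A, σ.IsSemistable A → 0 ≤ Q ((1 : ℝ) ⊗ₜ[ℤ] v (K0.of A)))
    (hQ : ∀ t : ℝ, 0 ≤ t → t ≤ 1 → ∀ x, ((1 - t : ℝ) : ℂ) * extendReal σ.Z x +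
      (t : ℂ) * extendReal W x = 0 → x ≠ 0 → Q x < 0) : h.deform.SupportWrt Q := by
  refine ⟨fun x hx hx₀ => hQ 1 zero_le_one le_rfl x ?_ hx₀, ?_⟩
  · change extendReal W x = 0 at hx
    simp [hx]
  · rintro A ⟨hA₀, φ, hA⟩
    obtain ⟨n, hn⟩ : ∃ n : ℤ, ⌈φ⌉ - 1 = n := ⟨_, rfl⟩
    change slicesOfHeart σ.slicing.P v W φ A at hA
    rw [slicesOfHeart, hn] at hA
    have hX := h.nonneg_of_heartSlice hQσ hQ hA
    have e : K0.of A = n.negOnePow • K0.of (A⟦-n⟧) := by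
      rw [← K0.of_shift, K0.of_iso (shiftNegIso A n)]
    rw [e]
    rcases Int.even_or_odd n with hn | hn
    · rwa [Int.negOnePow_even n hn, one_smul]
    · rwa [Int.negOnePow_odd n hn, Units.neg_smul, one_smul, map_neg, TensorProduct.tmul_neg,
        QuadraticMap.map_neg]

/-- The phases of the new semistable objects in the heart with respect to the old slicing. -/
theorem phases_of_heartSlice {ε : ℝ} (hε : ∀ φ A, 0 < φ → φ ≤ 1 → σ.slicing.P φ A →
      ¬ IsZero A → |(W (v (K0.of A))).arg - (σ.Z (v (K0.of A))).arg| ≤ Real.pi * ε)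
    {ψ : ℝ} {E : C} (hE : heartSlice σ.slicing.P v W ψ E) :
    rOrth σ.slicing.P (Set.Ioi (ψ + ε)) E ∧ lOrth σ.slicing.P (Set.Iio (ψ - ε)) E := by
  by_cases hE₀ : IsZero E
  · exact ⟨rOrth.of_isZero hE₀, lOrth.of_isZero hE₀⟩
  obtain ⟨hEh, harg, hss⟩ := hE.resolve_left hE₀
  have hP := σ.slicing.isPreSlicing
  obtain ⟨l, hl⟩ := hP.exists_filt E
  have hmem := hP.mem_of_heart hl hEh
  have hπ := Real.pi_pos
  constructor
  · obtain ⟨l₁, l₂, T, F, rfl, h₁, h₂, hT, hl₂, hl₁⟩ := hl.split (isUpperSet_Ioi (ψ + ε))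
    have hTh : heart σ.slicing.P T := hP.heart_of_filt hl₂ fun φ hφ => hmem φ (by simp [hφ])
    have hFh : heart σ.slicing.P F := hP.heart_of_filt hl₁ fun φ hφ => hmem φ (by simp [hφ])
    -- Old factors of phase above `ψ + ε` have new argument above `πψ`, so `T` would destabilize
    -- `E`. Dually, below, a quotient of old phases under `ψ - ε` would do so.
    have hT₀ : IsZero T := by
      by_contra hT₀
      have h₃ := hss T ⟨hTh, F, hFh, hT⟩ hT₀
      have h₄ : IsUpper (W (v (K0.of T))) ∧ Real.pi * ψ < (W (v (K0.of T))).arg := by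
        refine hl₂.class_induction v (D := fun x => IsUpper (W x) ∧ Real.pi * ψ < (W x).arg)
          (fun x y hx hy => ?_) (fun φ hφ X hX hX₀ => ?_) hT₀
        · rw [_root_.map_add]
          refine ⟨hx.1.add hy.1, ?_⟩
          rcases le_total (W x).arg (W y).arg with h | h
          · exact hx.2.trans_le (hx.1.arg_le_arg_add hy.1 h).1
          · rw [add_comm]
            exact hy.2.trans_le (hy.1.arg_le_arg_add hx.1 h).1
        · have hφ₁ := hmem φ (by simp [hφ])
          have hφ₂ : ψ + ε < φ := h₂ φ hφ
          refine ⟨h.upper_of_mem hX hX₀ hφ₁.1 hφ₁.2, ?_⟩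
          have := (abs_le.1 (hε φ X hφ₁.1 hφ₁.2 hX hX₀)).1
          rw [(σ.upper_of_mem hX hX₀ hφ₁.1 hφ₁.2).2] at this
          nlinarith
      rw [harg] at h₃
      exact absurd h₄.2 (not_lt.2 h₃)
    obtain rfl := hP.eq_nil_of_isZero hl₂ hT₀
    rw [List.append_nil] at hl
    exact hP.rOrth_of_filt hl fun φ hφ x hx => (not_lt.1 (h₁ φ hφ)).trans_lt hx
  · obtain ⟨l₁, l₂, T, F, rfl, h₁, h₂, hT, hl₂, hl₁⟩ := hl.split (isUpperSet_Ici (ψ - ε))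
    have hTh : heart σ.slicing.P T := hP.heart_of_filt hl₂ fun φ hφ => hmem φ (by simp [hφ])
    have hFh : heart σ.slicing.P F := hP.heart_of_filt hl₁ fun φ hφ => hmem φ (by simp [hφ])
    have hF₀ : IsZero F := by
      by_contra hF₀
      have h₄ : IsUpper (W (v (K0.of F))) ∧ (W (v (K0.of F))).arg < Real.pi * ψ := by
        refine hl₁.class_induction v (D := fun x => IsUpper (W x) ∧ (W x).arg < Real.pi * ψ)
          (fun x y hx hy => ?_) (fun φ hφ X hX hX₀ => ?_) hF₀
        · rw [_root_.map_add]
          refine ⟨hx.1.add hy.1, ?_⟩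
          rcases le_total (W x).arg (W y).arg with h | h
          · exact (hx.1.arg_le_arg_add hy.1 h).2.trans_lt hy.2
          · rw [add_comm]
            exact (hy.1.arg_le_arg_add hx.1 h).2.trans_lt hx.2
        · have hφ₁ := hmem φ (by simp [hφ])
          have hφ₂ : φ < ψ - ε := not_le.1 (h₁ φ hφ)
          refine ⟨h.upper_of_mem hX hX₀ hφ₁.1 hφ₁.2, ?_⟩
          have := (abs_le.1 (hε φ X hφ₁.1 hφ₁.2 hX hX₀)).2
          rw [(σ.upper_of_mem hX hX₀ hφ₁.1 hφ₁.2).2] at this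
          nlinarith
      rw [← harg] at h₄
      have hsum := map_of_isTri (v := v) W hT
      by_cases hT₀ : IsZero T
      · rw [K0.of_isZero hT₀, _root_.map_zero, _root_.map_zero, zero_add] at hsum
        rw [hsum] at h₄
        exact lt_irrefl _ h₄.2
      · have h₃ := hss T ⟨hTh, F, hFh, hT⟩ hT₀
        have hTu := h.upper hTh hT₀
        rw [hsum] at h₃ h₄
        rcases le_or_gt (W (v (K0.of T))).arg (W (v (K0.of F))).arg with h₅ | h₅
        · exact absurd h₄.2 (not_lt.2 (hTu.arg_le_arg_add h₄.1 h₅).2)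
        · rw [add_comm] at h₃
          exact absurd h₃ (not_le.2 (h₄.1.arg_lt_arg_add hTu h₅).2)
    obtain rfl := hP.eq_nil_of_isZero hl₁ hF₀
    rw [List.nil_append] at hl
    exact hP.lOrth_of_filt hl fun φ hφ x hx => lt_of_lt_of_le hx (h₂ φ hφ)

theorem close_deform {ε : ℝ} (hε : ∀ φ A, 0 < φ → φ ≤ 1 → σ.slicing.P φ A →
      ¬ IsZero A → |(W (v (K0.of A))).arg - (σ.Z (v (K0.of A))).arg| ≤ Real.pi * ε) :
    Slicing.Close ε σ.slicing h.deform.slicing := by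
  intro φ A hA
  obtain ⟨n, hn⟩ : ∃ n : ℤ, ⌈φ⌉ - 1 = n := ⟨_, rfl⟩
  change slicesOfHeart σ.slicing.P v W φ A at hA
  rw [slicesOfHeart, hn] at hA
  obtain ⟨h₁, h₂⟩ := h.phases_of_heartSlice hε hA
  have hP := σ.slicing.isPreSlicing
  refine ⟨((hP.rOrth_shift h₁ n).of_iso (shiftNegIso A n)).mono fun x hx => ?_,
    ((hP.lOrth_shift h₂ n).of_iso (shiftNegIso A n)).mono fun x hx => ?_⟩
  all_goals
    simp only [Set.mem_Ioi, Set.mem_Iio, Set.mem_ofPred_eq] at *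
    linarith

end IsSmallDeformation

end Deformation

end Bridgeland

namespace Bridgeland

universe w u

/-! ### Norm estimates from negative definiteness on the kernel -/

section LinearAlgebra

variable {Λ : Type*} [AddCommGroup Λ]

theorem extendReal_tmul (Z : Λ →+ ℂ) (r : ℝ) (x : Λ) :
    extendReal Z (r ⊗ₜ[ℤ] x) = r * Z x := by
  simp [extendReal]

theorem extendReal_add (Z W : Λ →+ ℂ) (x : ℝ ⊗[ℤ] Λ) :
    extendReal (Z + W) x = extendReal Z x + extendReal W x := by
  induction x using TensorProduct.induction_on with
  | zero => simp
  | tmul r x => simp only [extendReal_tmul, AddMonoidHom.add_apply, mul_add]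
  | add x y hx hy => rw [map_add, map_add, map_add, hx, hy]; ring

theorem extendReal_smul (c : ℂ) (Z : Λ →+ ℂ) (x : ℝ ⊗[ℤ] Λ) :
    extendReal (c • Z) x = c * extendReal Z x := by
  induction x using TensorProduct.induction_on with
  | zero => simp
  | tmul r x =>
    simp only [extendReal_tmul, AddMonoidHom.smul_apply, smul_eq_mul]
    ring
  | add x y hx hy => rw [map_add, map_add, hx, hy]; ring

theorem extendReal_sub (Z W : Λ →+ ℂ) (x : ℝ ⊗[ℤ] Λ) :
    extendReal (Z - W) x = extendReal Z x - extendReal W x := by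
  rw [eq_sub_iff_add_eq, ← extendReal_add, sub_add_cancel]

theorem NegDefOnKer.smul {Q : QuadraticForm ℝ (ℝ ⊗[ℤ] Λ)} {Z : Λ →+ ℂ} (h : NegDefOnKer Q Z)
    {c : ℂ} (hc : c ≠ 0) : NegDefOnKer Q (c • Z) := by
  intro x hx
  rw [extendReal_smul] at hx
  exact h x ((mul_eq_zero.1 hx).resolve_left hc)

variable [Module.Free ℤ Λ] [Module.Finite ℤ Λ]

variable (Λ) in
/-- The basis of `Λ_ℝ` induced by the chosen basis of `Λ`. -/
noncomputable def realBasis :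
    Module.Basis (Module.Free.ChooseBasisIndex ℤ Λ) ℝ (ℝ ⊗[ℤ] Λ) :=
  (Module.Free.chooseBasis ℤ Λ).baseChange ℝ

/-- The maximum norm on `Λ_ℝ` with respect to the chosen basis. -/
noncomputable def supNorm (x : ℝ ⊗[ℤ] Λ) : ℝ := ‖(realBasis Λ).equivFun x‖

theorem supNorm_nonneg (x : ℝ ⊗[ℤ] Λ) : 0 ≤ supNorm x := norm_nonneg _

theorem supNorm_add_le (x y : ℝ ⊗[ℤ] Λ) : supNorm (x + y) ≤ supNorm x + supNorm y := by
  rw [supNorm, map_add]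
  exact norm_add_le _ _

theorem supNorm_eq_zero {x : ℝ ⊗[ℤ] Λ} : supNorm x = 0 ↔ x = 0 := by
  rw [supNorm, norm_eq_zero, map_eq_zero_iff _ (realBasis Λ).equivFun.injective]

theorem finite_supNorm_le (M : ℝ) : {x : Λ | supNorm ((1 : ℝ) ⊗ₜ[ℤ] x) ≤ M}.Finite := by
  let b := Module.Free.chooseBasis ℤ Λ
  refine ((Set.finite_Icc (fun _ => -⌈M⌉) (fun _ => ⌈M⌉)).preimage
    (f := fun x : Λ => (b.equivFun x : Module.Free.ChooseBasisIndex ℤ Λ → ℤ))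
    b.equivFun.injective.injOn).subset ?_
  intro x hx
  have h : ∀ i, |((b.equivFun x i : ℤ) : ℝ)| ≤ M := fun i => by
    have := (norm_le_pi_norm ((realBasis Λ).equivFun ((1 : ℝ) ⊗ₜ[ℤ] x)) i).trans hx
    simpa [realBasis, b] using this
  have h' : ∀ i, |b.equivFun x i| ≤ ⌈M⌉ := fun i => by
    have := (h i).trans (Int.le_ceil M)
    exact_mod_cast this
  exact ⟨fun i => (abs_le.1 (h' i)).1, fun i => (abs_le.1 (h' i)).2⟩

theorem norm_apply_basis_le (W : Λ →+ ℂ) (i : Module.Free.ChooseBasisIndex ℤ Λ) :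
    ‖W (Module.Free.chooseBasis ℤ Λ i)‖ ≤ ‖W‖ :=
  norm_le_pi_norm (evalBasis Λ W) i

theorem norm_le_of_apply_basis {W : Λ →+ ℂ} {r : ℝ} (hr : 0 ≤ r)
    (h : ∀ i, ‖W (Module.Free.chooseBasis ℤ Λ i)‖ ≤ r) : ‖W‖ ≤ r :=
  (pi_norm_le_iff_of_nonneg hr).2 h

variable (Λ) in
/-- The rank of `Λ` as a real number. -/
noncomputable def realRank : ℝ := Fintype.card (Module.Free.ChooseBasisIndex ℤ Λ)

variable (Λ) in
theorem realRank_nonneg : 0 ≤ realRank Λ := Nat.cast_nonneg _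

theorem norm_extendReal_le (W : Λ →+ ℂ) (x : ℝ ⊗[ℤ] Λ) :
    ‖extendReal W x‖ ≤ realRank Λ * ‖W‖ * supNorm x := by
  have h : extendReal W x = ∑ i, (realBasis Λ).equivFun x i *
      W (Module.Free.chooseBasis ℤ Λ i) := by
    nth_rewrite 1 [← (realBasis Λ).sum_equivFun x]
    rw [map_sum]
    refine Finset.sum_congr rfl fun i _ => ?_
    rw [map_smul, realBasis, Module.Basis.baseChange_apply, extendReal_tmul, Complex.real_smul,
      Complex.ofReal_one, one_mul]
  rw [h]
  refine (norm_sum_le _ _).trans ?_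
  calc ∑ i, ‖((realBasis Λ).equivFun x i : ℂ) * W (Module.Free.chooseBasis ℤ Λ i)‖
      ≤ ∑ _i : Module.Free.ChooseBasisIndex ℤ Λ, ‖W‖ * supNorm x := by
        refine Finset.sum_le_sum fun i _ => ?_
        rw [norm_mul, mul_comm, Complex.norm_real]
        exact mul_le_mul (norm_apply_basis_le W i) (norm_le_pi_norm _ i) (norm_nonneg _)
          (norm_nonneg _)
    _ = _ := by
        rw [Finset.sum_const, Finset.card_univ, nsmul_eq_mul, realRank, mul_assoc]

theorem continuous_quadraticForm {ι : Type*} [Fintype ι] (Q : QuadraticForm ℝ (ι → ℝ)) :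
    Continuous Q := by
  classical
  have h : ∀ x, Q x = ∑ i, x i * QuadraticMap.associated (R := ℝ) Q (Pi.single i 1) x := by
    intro x
    nth_rewrite 1 [← QuadraticMap.associated_eq_self_apply ℝ Q x]
    nth_rewrite 1 [← Finset.univ_sum_single x]
    rw [map_sum, LinearMap.sum_apply]
    refine Finset.sum_congr rfl fun i _ => ?_
    have : Pi.single i (x i) = x i • (Pi.single i 1 : ι → ℝ) := by
      rw [← Pi.single_smul, smul_eq_mul, mul_one]
    rw [this, map_smul, LinearMap.smul_apply, smul_eq_mul]
  rw [show (Q : (ι → ℝ) → ℝ) = _ from funext h]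
  exact continuous_finsetSum _ fun i _ => (continuous_apply i).mul
    (LinearMap.continuous_of_finiteDimensional _)

variable {Q : QuadraticForm ℝ (ℝ ⊗[ℤ] Λ)} {Z : Λ →+ ℂ}

/-- The part of the unit sphere where `Q ≥ 0` is compact and `Z` has no zero on it, so `‖Z‖` has a
positive minimum there; homogeneity does the rest. -/
theorem NegDefOnKer.exists_pos_mul_le (h : NegDefOnKer Q Z) :
    ∃ c : ℝ, 0 < c ∧ ∀ x, 0 ≤ Q x → c * supNorm x ≤ ‖extendReal Z x‖ := by
  let e := (realBasis Λ).equivFun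
  let Q' : QuadraticForm ℝ (Module.Free.ChooseBasisIndex ℤ Λ → ℝ) := Q.comp e.symm.toLinearMap
  have hQ' : Continuous Q' := continuous_quadraticForm Q'
  let S : Set (Module.Free.ChooseBasisIndex ℤ Λ → ℝ) := Metric.sphere 0 1 ∩ {y | 0 ≤ Q' y}
  have hS : IsCompact S := (isCompact_sphere 0 1).inter_right (isClosed_le continuous_const hQ')
  have hcont : Continuous fun y => ‖(extendReal Z ∘ₗ e.symm.toLinearMap) y‖ :=
    (LinearMap.continuous_of_finiteDimensional _).norm
  obtain ⟨c, hc, hcS⟩ : ∃ c : ℝ, 0 < c ∧ ∀ y ∈ S, c ≤ ‖extendReal Z (e.symm y)‖ := by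
    rcases S.eq_empty_or_nonempty with hS₀ | hS₀
    · exact ⟨1, one_pos, by simp [hS₀]⟩
    · obtain ⟨y, hy, hmin⟩ := hS.exists_isMinOn hS₀ hcont.continuousOn
      refine ⟨_, norm_pos_iff.2 fun h₀ => ?_, hmin⟩
      have h₁ : e.symm y ≠ 0 := by
        intro h₁
        have : y = 0 := by simpa using h₁
        have := hy.1
        simp_all
      exact absurd hy.2 (not_le.2 (h _ h₀ h₁))
  refine ⟨c, hc, fun x hx => ?_⟩
  by_cases hx₀ : x = 0
  · rw [supNorm_eq_zero.2 hx₀, mul_zero]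
    exact norm_nonneg _
  have hpos : 0 < supNorm x :=
    lt_of_le_of_ne (supNorm_nonneg x) fun h => hx₀ (supNorm_eq_zero.1 h.symm)
  have h₁ := hcS ((supNorm x)⁻¹ • e x) ⟨?_, ?_⟩
  · rw [map_smul, LinearEquiv.symm_apply_apply, map_smul, norm_smul, norm_inv,
      Real.norm_of_nonneg hpos.le, ← div_eq_inv_mul, le_div_iff₀ hpos] at h₁
    exact h₁
  · rw [mem_sphere_zero_iff_norm, norm_smul, norm_inv, Real.norm_of_nonneg hpos.le]
    exact inv_mul_cancel₀ hpos.ne'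
  · change 0 ≤ Q (e.symm _)
    rw [map_smul, LinearEquiv.symm_apply_apply, QuadraticMap.map_smul]
    exact smul_nonneg (mul_self_nonneg _) hx

/-- The support property holds with uniform constants for central charges near a given one. -/
theorem NegDefOnKer.exists_uniform (h : NegDefOnKer Q Z) :
    ∃ r K : ℝ, 0 < r ∧ 0 < K ∧ ∀ W : Λ →+ ℂ, ‖W - Z‖ < r → ∀ x, 0 ≤ Q x →
      supNorm x ≤ K * ‖extendReal W x‖ := by
  obtain ⟨c, hc, hcx⟩ := h.exists_pos_mul_le
  have hn := realRank_nonneg Λ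
  -- The radius makes `‖(W - Z) x‖` at most half of the lower bound `c * supNorm x`, so half of that
  -- bound remains for `W`.
  refine ⟨c / (2 * (realRank Λ + 1)), 2 / c, by positivity, by positivity, fun W hW x hx => ?_⟩
  have h₁ := hcx x hx
  have h₂ := norm_extendReal_le (W - Z) x
  rw [extendReal_sub] at h₂
  have h₃ : realRank Λ * ‖W - Z‖ ≤ c / 2 := by
    rw [lt_div_iff₀ (by positivity)] at hW
    nlinarith [norm_nonneg (W - Z)]
  have h₄ := mul_le_mul_of_nonneg_right h₃ (supNorm_nonneg x)
  have h₅ := norm_sub_norm_le (extendReal Z x) (extendReal W x)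
  rw [norm_sub_rev] at h₅
  rw [div_mul_eq_mul_div, le_div_iff₀ hc]
  linarith

theorem NegDefOnKer.exists_ball (h : NegDefOnKer Q Z) :
    ∃ r : ℝ, 0 < r ∧ ∀ W : Λ →+ ℂ, ‖W - Z‖ < r → NegDefOnKer Q W := by
  obtain ⟨r, K, hr, hK, hrK⟩ := h.exists_uniform
  refine ⟨r, hr, fun W hW x hx hx₀ => ?_⟩
  by_contra! hQ
  have := hrK W hW x hQ
  rw [hx, norm_zero, mul_zero] at this
  exact hx₀ (supNorm_eq_zero.1 (le_antisymm this (supNorm_nonneg x)))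

variable (Q) in
theorem isOpen_negDefOnKer : IsOpen {Z : Λ →+ ℂ | NegDefOnKer Q Z} := by
  rw [Metric.isOpen_iff]
  intro Z hZ
  obtain ⟨r, hr, h⟩ := NegDefOnKer.exists_ball hZ
  exact ⟨r, hr, fun W hW => h W (by rwa [mem_ball_iff_norm] at hW)⟩

end LinearAlgebra

/-! ### Rotation and the uniform local deformation theorem -/

section LocalDeformation

variable {C : Type u} [Category.{w} C] [HasZeroObject C] [HasShift C ℤ] [Preadditive C]
  [∀ n : ℤ, (shiftFunctor C n).Additive] [Pretriangulated C] [IsTriangulated C]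
  {Λ : Type*} [AddCommGroup Λ] {v : K0 C →+ Λ}

/-- The slicing with phases shifted by `s`. -/
def Slicing.rotate (S : Slicing C) (s : ℝ) : Slicing C :=
  IsPreSlicing.toSlicing (P := fun φ => S.P (φ + s))
    { of_iso := fun e h => S.isPreSlicing.of_iso e h
      of_isZero := fun _ _ h => S.isPreSlicing.of_isZero _ h
      shift_iff := fun φ A => by rw [add_right_comm]; exact S.shift_iff _ _
      hom_eq_zero := fun hφ h₁ h₂ => S.hom_eq_zero (by linarith) h₁ h₂
      exists_filt := fun A => by
        obtain ⟨l, hl⟩ := S.isPreSlicing.exists_filt A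
        refine ⟨l.map (· - s), ?_⟩
        induction hl with
        | zero h => exact .zero h
        | cons h hE hE₀ hφ hA' ih =>
          refine .cons h (by rwa [sub_add_cancel]) hE₀ (fun ψ hψ => ?_) ih
          obtain ⟨x, hx, rfl⟩ := List.mem_map.1 hψ
          simpa using hφ x hx }

theorem Slicing.Close.rotate_symm {S T : Slicing C} {ε s : ℝ}
    (h : Slicing.Close ε (S.rotate s) T) : Slicing.Close ε S (T.rotate (-s)) := by
  intro φ A hA
  obtain ⟨h₁, h₂⟩ := h _ _ hA
  refine ⟨fun ψ hψ X hX => h₁ (ψ - s) ?_ X ?_, fun ψ hψ X hX => h₂ (ψ - s) ?_ X ?_⟩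
  · simp only [Set.mem_Ioi] at *; linarith
  · change S.P (ψ - s + s) X
    rwa [sub_add_cancel]
  · simp only [Set.mem_Iio] at *; linarith
  · change S.P (ψ - s + s) X
    rwa [sub_add_cancel]

namespace StabPrecondition

/-- The action of rotations of the complex plane on stability preconditions. -/
noncomputable def rotate (σ : StabPrecondition v) (s : ℝ) : StabPrecondition v where
  slicing := σ.slicing.rotate s
  Z := Complex.exp (-(Real.pi * s * Complex.I)) • σ.Z
  compat φ A hA hA₀ := by
    obtain ⟨m, hm, h⟩ := σ.compat _ A hA hA₀
    refine ⟨m, hm, ?_⟩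
    rw [AddMonoidHom.smul_apply, h, smul_eq_mul, mul_left_comm, ← Complex.exp_add]
    push_cast
    ring_nf

theorem SupportWrt.rotate {σ : StabPrecondition v} {Q : QuadraticForm ℝ (ℝ ⊗[ℤ] Λ)}
    (h : σ.SupportWrt Q) (s : ℝ) : (σ.rotate s).SupportWrt Q :=
  ⟨h.1.smul (Complex.exp_ne_zero _), fun A ⟨hA₀, φ, hA⟩ => h.2 A ⟨hA₀, φ + s, hA⟩⟩

end StabPrecondition

variable [Module.Free ℤ Λ] [Module.Finite ℤ Λ]

/-- Deformations of the real part of the central charge. -/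
theorem exists_deformation_of_im_eq {Q : QuadraticForm ℝ (ℝ ⊗[ℤ] Λ)} {Z₀ : Λ →+ ℂ}
    (hZ₀ : NegDefOnKer Q Z₀) {ε : ℝ} (hε : 0 < ε) :
    ∃ ρ : ℝ, 0 < ρ ∧ ∀ (σ : StabPrecondition v) (W : Λ →+ ℂ), σ.SupportWrt Q →
      ‖σ.Z - Z₀‖ < ρ → ‖W - Z₀‖ < ρ → (∀ x, (W x).im = (σ.Z x).im) →
      ∃ τ : StabPrecondition v, τ.Z = W ∧ τ.SupportWrt Q ∧
        Slicing.Close ε σ.slicing τ.slicing := by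
  obtain ⟨r, K, hr, hK, hrK⟩ := hZ₀.exists_uniform
  obtain ⟨r', hr', hneg⟩ := hZ₀.exists_ball
  obtain ⟨δ, hδ, harg⟩ := exists_abs_arg_sub_le (mul_pos Real.pi_pos hε)
  have hn := realRank_nonneg Λ
  set m : ℝ := min (1 / 2) δ
  have hm : 0 < m := lt_min (by norm_num) hδ
  have hd : 0 < 2 * realRank Λ * K + 1 := by positivity
  -- `r` gives the support constant `K`, and `r'` keeps `Q` negative definite on the kernels along
  -- the segment from `σ.Z` to `W`. Since `‖W - σ.Z‖` is less than twice the radius, the last term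
  -- gives `η K ≤ m`; the `+ 1` keeps the denominator positive.
  refine ⟨min (min r r') (m / (2 * realRank Λ * K + 1)), by positivity,
    fun σ W hσ hσZ hW him => ?_⟩
  rw [lt_min_iff, lt_min_iff] at hσZ hW
  obtain ⟨⟨hσr, hσr'⟩, hσm⟩ := hσZ
  obtain ⟨⟨hWr, hWr'⟩, hWm⟩ := hW
  set η : ℝ := realRank Λ * ‖W - σ.Z‖
  have hη₀ : 0 ≤ η := by positivity
  have hηK : η * K ≤ m := by
    have h₁ : ‖W - σ.Z‖ ≤ 2 * (m / (2 * realRank Λ * K + 1)) := by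
      have h₂ := norm_sub_le (W - Z₀) (σ.Z - Z₀)
      rw [sub_sub_sub_cancel_right] at h₂
      linarith
    calc η * K = realRank Λ * K * ‖W - σ.Z‖ := by ring
      _ ≤ realRank Λ * K * (2 * (m / (2 * realRank Λ * K + 1))) :=
        mul_le_mul_of_nonneg_left h₁ (by positivity)
      _ = m * ((2 * realRank Λ * K) / (2 * realRank Λ * K + 1)) := by ring
      _ ≤ m * 1 := by
        refine mul_le_mul_of_nonneg_left ?_ hm.le
        rw [div_le_one hd]
        linarith
      _ = m := mul_one m
  have hext : ∀ (F : Λ →+ ℂ) x, extendReal F ((1 : ℝ) ⊗ₜ[ℤ] x) = F x := fun F x => by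
    rw [extendReal_tmul, Complex.ofReal_one, one_mul]
  have hdef : IsSmallDeformation σ W (fun x => supNorm ((1 : ℝ) ⊗ₜ[ℤ] x)) K η :=
    { im_eq := him
      map_zero := by rw [TensorProduct.tmul_zero, supNorm_eq_zero.2 rfl]
      nonneg := fun x => supNorm_nonneg _
      add_le := fun x y => by
        rw [TensorProduct.tmul_add]
        exact supNorm_add_le _ _
      le_norm := fun A hA => by
        have := hrK σ.Z hσr _ (hσ.2 A hA)
        rwa [hext] at this
      norm_sub_le := fun x => by
        have := norm_extendReal_le (W - σ.Z) ((1 : ℝ) ⊗ₜ[ℤ] x)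
        rwa [hext] at this
      finite_le := finite_supNorm_le
      K_nonneg := hK.le
      η_nonneg := hη₀
      mul_le := hηK.trans (min_le_left _ _) }
  refine ⟨hdef.deform, rfl, hdef.supportWrt_deform hσ.2 fun t h₀ h₁ x hx hx₀ => ?_,
    hdef.close_deform fun φ A h₀ h₁ hA hA₀ => ?_⟩
  · refine hneg (((1 - t : ℝ) : ℂ) • σ.Z + (t : ℂ) • W) ?_ x ?_ hx₀
    · have h₂ : ((1 - t : ℝ) : ℂ) • σ.Z + (t : ℂ) • W - Z₀ =
          ((1 - t : ℝ) : ℂ) • (σ.Z - Z₀) + (t : ℂ) • (W - Z₀) := by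
        ext x
        simp only [AddMonoidHom.sub_apply, AddMonoidHom.add_apply, AddMonoidHom.smul_apply,
          smul_eq_mul]
        push_cast
        ring
      rw [h₂]
      refine (norm_add_le _ _).trans_lt ?_
      rw [norm_smul, norm_smul, Complex.norm_real, Complex.norm_real, Real.norm_of_nonneg h₀,
        Real.norm_of_nonneg (by linarith)]
      have h₃ := mul_le_mul_of_nonneg_left (le_max_left ‖σ.Z - Z₀‖ ‖W - Z₀‖) (sub_nonneg.2 h₁)
      have h₄ := mul_le_mul_of_nonneg_left (le_max_right ‖σ.Z - Z₀‖ ‖W - Z₀‖) h₀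
      have h₅ := max_lt hσr' hWr'
      linarith
    · rw [extendReal_add, extendReal_smul, extendReal_smul, hx]
  · refine harg _ _ (σ.upper_of_mem hA hA₀ h₀ h₁).1 (hdef.upper_of_mem hA hA₀ h₀ h₁) ?_
    refine (hdef.norm_sub_le_of_mem hA hA₀).trans ?_
    exact mul_le_mul_of_nonneg_right (hηK.trans (min_le_right _ _)) (norm_nonneg _)

/-- The homomorphism with the given real and imaginary parts. -/
noncomputable def combine (W Z : Λ →+ ℂ) : Λ →+ ℂ where
  toFun x := ⟨(W x).re, (Z x).im⟩
  map_zero' := by simp [Complex.ext_iff]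
  map_add' x y := by simp [Complex.ext_iff]

/-- Multiplication by `-i` turns imaginary parts into real parts, so two deformations of real parts
suffice: one near `Z₀` and, after rotating phases by `1 / 2`, one near `-i Z₀`. The radius is chosen
before the stability condition. -/
theorem exists_deformation {Q : QuadraticForm ℝ (ℝ ⊗[ℤ] Λ)} {Z₀ : Λ →+ ℂ}
    (hZ₀ : NegDefOnKer Q Z₀) {ε : ℝ} (hε : 0 < ε) :
    ∃ ρ : ℝ, 0 < ρ ∧ ∀ (σ : Stab v) (W : Λ →+ ℂ), σ.SupportWrt Q →
      ‖σ.charge - Z₀‖ < ρ → ‖W - Z₀‖ < ρ →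
      ∃ τ : Stab v, τ.charge = W ∧ τ.SupportWrt Q ∧
        edist σ.slicing τ.slicing ≤ ENNReal.ofReal ε := by
  have hexp₁ : Complex.exp (-(Real.pi * ((1 / 2 : ℝ) : ℂ) * Complex.I)) = -Complex.I := by
    rw [Complex.exp_neg]
    have : (Real.pi * ((1 / 2 : ℝ) : ℂ) * Complex.I) = Real.pi / 2 * Complex.I := by
      push_cast; ring
    rw [this, Complex.exp_pi_div_two_mul_I, Complex.inv_I]
  have hexp₂ : Complex.exp (-(Real.pi * ((-(1 / 2) : ℝ) : ℂ) * Complex.I)) = Complex.I := by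
    have : -(Real.pi * ((-(1 / 2) : ℝ) : ℂ) * Complex.I) = Real.pi / 2 * Complex.I := by
      push_cast; ring
    rw [this, Complex.exp_pi_div_two_mul_I]
  have hI : (-Complex.I) ≠ 0 := neg_ne_zero.2 Complex.I_ne_zero
  obtain ⟨ρ₁, hρ₁, h₁⟩ := exists_deformation_of_im_eq (v := v) hZ₀ (half_pos hε)
  obtain ⟨ρ₂, hρ₂, h₂⟩ := exists_deformation_of_im_eq (v := v) (hZ₀.smul hI) (half_pos hε)
  -- The intermediate charge takes its real part from `W` and its imaginary part from `σ`, so its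
  -- distance to `Z₀` is bounded by the sum of two distances; hence the division by 2.
  refine ⟨min ρ₁ ρ₂ / 2, by positivity, fun σ W hσ hσZ hW => ?_⟩
  have hm₁ := min_le_left ρ₁ ρ₂
  have hm₂ := min_le_right ρ₁ ρ₂
  have hm₀ : 0 < min ρ₁ ρ₂ := lt_min hρ₁ hρ₂
  have hcomb : ‖combine W σ.charge - Z₀‖ < min ρ₁ ρ₂ := by
    refine lt_of_le_of_lt (norm_le_of_apply_basis (r := ‖W - Z₀‖ + ‖σ.charge - Z₀‖)
      (by positivity) fun i => ?_) (by linarith)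
    refine (Complex.norm_le_abs_re_add_abs_im _).trans (add_le_add ?_ ?_)
    · exact (Complex.abs_re_le_norm ((W - Z₀) (Module.Free.chooseBasis ℤ Λ i))).trans
        (norm_apply_basis_le _ i)
    · exact (Complex.abs_im_le_norm ((σ.charge - Z₀) (Module.Free.chooseBasis ℤ Λ i))).trans
        (norm_apply_basis_le _ i)
  obtain ⟨τ₁, hτ₁, hτ₁Q, hclose₁⟩ := h₁ σ.toStabPrecondition (combine W σ.charge) hσ
    (by change ‖σ.charge - Z₀‖ < _; linarith) (by linarith) fun x => rfl
  have hrotZ : (τ₁.rotate (1 / 2)).Z = (-Complex.I) • combine W σ.charge := by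
    rw [← hτ₁, ← hexp₁]
    rfl
  obtain ⟨τ₂, hτ₂, hτ₂Q, hclose₂⟩ := h₂ (τ₁.rotate (1 / 2)) ((-Complex.I) • W)
    (hτ₁Q.rotate _)
    (by rw [hrotZ, ← smul_sub, norm_smul, norm_neg, Complex.norm_I, one_mul]; linarith)
    (by rw [← smul_sub, norm_smul, norm_neg, Complex.norm_I, one_mul]; linarith)
    (fun x => by
      rw [hrotZ]
      simp [combine])
  have hτQ := hτ₂Q.rotate (-(1 / 2))
  refine ⟨⟨τ₂.rotate (-(1 / 2)), Q, hτQ⟩, ?_, hτQ, ?_⟩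
  · change Complex.exp (-(Real.pi * ((-(1 / 2) : ℝ) : ℂ) * Complex.I)) • τ₂.Z = W
    rw [hexp₂, hτ₂, smul_smul]
    simp
  · have e := edist_triangle σ.slicing τ₁.slicing (τ₂.rotate (-(1 / 2))).slicing
    refine e.trans ((add_le_add hclose₁.edist_le hclose₂.rotate_symm.edist_le).trans ?_)
    rw [← ENNReal.ofReal_add (by positivity) (by positivity), add_halves]

end LocalDeformation

end Bridgeland

namespace Bridgeland

open Topology

/-! ### Coverings from locally uniform sheets -/

section Sheets

variable {X Y : Type*} [TopologicalSpace X] [TopologicalSpace Y]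

/-- A family of disjoint open subsets of `S`, covering the part of `S` over `B`, each of which `f`
maps bijectively onto `B`. -/
structure IsSheetFamily (f : X → Y) (S : Set X) (B : Set Y) (𝒜 : Set (Set X)) : Prop where
  isOpen_base : IsOpen B
  isOpen : ∀ A ∈ 𝒜, IsOpen A
  subset : ∀ A ∈ 𝒜, A ⊆ S ∩ f ⁻¹' B
  injOn : ∀ A ∈ 𝒜, Set.InjOn f A
  surjOn : ∀ A ∈ 𝒜, Set.SurjOn f A B
  disjoint : 𝒜.PairwiseDisjoint id
  exhaustive : ∀ x ∈ S, f x ∈ B → ∃ A ∈ 𝒜, x ∈ A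

variable {f : X → Y} {S : Set X} {B : Set Y} {𝒜 : Set (Set X)}

theorem IsSheetFamily.mono (h : IsSheetFamily f S B 𝒜) (hf : Continuous f) {B' : Set Y}
    (hB' : IsOpen B') (hsub : B' ⊆ B) :
    IsSheetFamily f S B' ((fun A => A ∩ f ⁻¹' B') '' 𝒜) where
  isOpen_base := hB'
  isOpen := by
    rintro _ ⟨A, hA, rfl⟩
    exact (h.isOpen A hA).inter (hB'.preimage hf)
  subset := by
    rintro _ ⟨A, hA, rfl⟩ x hx
    exact ⟨(h.subset A hA hx.1).1, hx.2⟩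
  injOn := by
    rintro _ ⟨A, hA, rfl⟩
    exact (h.injOn A hA).mono Set.inter_subset_left
  surjOn := by
    rintro _ ⟨A, hA, rfl⟩ y hy
    obtain ⟨x, hx, rfl⟩ := h.surjOn A hA (hsub hy)
    exact ⟨x, ⟨hx, hy⟩, rfl⟩
  disjoint := by
    rintro _ ⟨A, hA, rfl⟩ _ ⟨A', hA', rfl⟩ hne
    exact (h.disjoint hA hA' fun e => hne (by rw [e])).mono Set.inter_subset_left
      Set.inter_subset_left
  exhaustive x hx hxB := by
    obtain ⟨A, hA, hxA⟩ := h.exhaustive x hx (hsub hxB)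
    exact ⟨_, ⟨A, hA, rfl⟩, hxA, hxB⟩

theorem IsSheetFamily.isPreconnected (h : IsSheetFamily f S B 𝒜) (hf : IsOpenMap f)
    (hB : IsPreconnected B) {A : Set X} (hA : A ∈ 𝒜) : IsPreconnected A := by
  have key : IsPreconnected ((fun x : A => f x) ⁻¹' B) := by
    refine hB.preimage_of_isOpenMap ?_ ?_ ?_
    · exact fun x y hxy => Subtype.ext (h.injOn A hA x.2 y.2 hxy)
    · exact hf.comp (h.isOpen A hA).isOpenMap_subtype_val
    · intro y hy
      obtain ⟨x, hx, rfl⟩ := h.surjOn A hA hy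
      exact ⟨⟨x, hx⟩, rfl⟩
  convert key.image Subtype.val continuous_subtype_val.continuousOn
  ext x
  constructor
  · exact fun hx => ⟨⟨x, hx⟩, (h.subset A hA hx).2, rfl⟩
  · rintro ⟨⟨x, hx⟩, _, rfl⟩
    exact hx

/-- The sheets serve as a discrete fibre. Openness and continuity of `f` make its bijection from
each sheet to `B` a homeomorphism. -/
theorem IsSheetFamily.isEvenlyCovered {f : X → Y} (h : IsSheetFamily f Set.univ B 𝒜)
    (hc : Continuous f) (ho : IsOpenMap f) (h𝒜 : 𝒜.Nonempty) {y : Y} (hy : y ∈ B) :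
    IsEvenlyCovered f y (f ⁻¹' {y}) := by
  let _ : TopologicalSpace 𝒜 := ⊥
  have : DiscreteTopology 𝒜 := ⟨rfl⟩
  have : Nonempty 𝒜 := h𝒜.to_subtype
  obtain ⟨A₀, hA₀⟩ := h𝒜
  obtain ⟨x₀, -, -⟩ := h.surjOn A₀ hA₀ hy
  have : Nonempty (Y → X) := ⟨fun _ => x₀⟩
  refine (IsEvenlyCovered.of_trivialization (I := 𝒜)
    (t := IsOpen.trivializationDiscrete (fun A : 𝒜 => (A : Set X)) B h.isOpen_base ?_
      (fun A => h.injOn A A.2) (fun A => h.surjOn A A.2) ?_ ?_) hy).to_isEvenlyCovered_preimage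
  · intro A W hW
    refine ⟨fun hWo => (hWo.preimage hc).inter (h.isOpen A A.2), fun hWo => ?_⟩
    convert ho _ hWo
    ext w
    constructor
    · intro hw
      obtain ⟨x, hx, rfl⟩ := h.surjOn A A.2 (hW hw)
      exact ⟨x, ⟨hw, hx⟩, rfl⟩
    · rintro ⟨x, ⟨hx, -⟩, rfl⟩
      exact hx
  · exact fun A A' hne => h.disjoint A.2 A'.2 fun e => hne (Subtype.ext e)
  · intro x hx
    obtain ⟨A, hA, hxA⟩ := h.exhaustive x trivial hx
    exact Set.mem_iUnion.2 ⟨⟨A, hA⟩, hxA⟩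

/-- If the open set `S` is a union of sheets locally over `U'` and relatively closed over `U'`,
then the components of the part of the domain over a component of `U'` that meet `S` lie in `S`
and cover the component of `U'`. -/
theorem isCoveringMap_restrict_connectedComponentIn [LocallyConnectedSpace Y]
    (hc : Continuous f) (ho : IsOpenMap f) {U' : Set Y} (hU' : IsOpen U') (hS : IsOpen S)
    (hclosed : ∀ x ∈ closure S, f x ∈ U' → x ∈ S)
    (hsheets : ∀ y ∈ U', ∃ B 𝒜, y ∈ B ∧ IsSheetFamily f S B 𝒜)
    {x : X} (hx : x ∈ S) (hxU' : f x ∈ U') {U : Set Y} {V : Set X}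
    (hU : U = connectedComponentIn U' (f x)) (hV : V = connectedComponentIn (f ⁻¹' U) x) :
    V ⊆ S ∧ ∃ hVU : Set.MapsTo f V U,
      IsCoveringMap (hVU.restrict f V U) ∧ Function.Surjective (hVU.restrict f V U) := by
  have hUopen : IsOpen U := hU ▸ hU'.connectedComponentIn
  have hUU' : U ⊆ U' := hU ▸ connectedComponentIn_subset _ _
  have hxU : f x ∈ U := hU ▸ mem_connectedComponentIn hxU'
  have hxV : x ∈ V := hV ▸ mem_connectedComponentIn hxU
  have hUconn : IsPreconnected U := hU ▸ isPreconnected_connectedComponentIn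
  have hVconn : IsPreconnected V := hV ▸ isPreconnected_connectedComponentIn
  have hVU : Set.MapsTo f V U := hV ▸ connectedComponentIn_subset _ _
  have hmax : ∀ T : Set X, IsPreconnected T → T ⊆ f ⁻¹' U → (T ∩ V).Nonempty → T ⊆ V := by
    rintro T hT hTU ⟨t, htT, htV⟩
    subst hV
    rw [connectedComponentIn_eq htV]
    exact hT.subset_connectedComponentIn htT hTU
  -- `S` is open and relatively closed over `U'`, and the connected set `V` meets it.
  have hVS : V ⊆ S := by
    refine hVconn.subset_of_closure_inter_subset hS ⟨x, hxV, hx⟩ ?_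
    rintro z ⟨hz, hzV⟩
    exact hclosed z hz (hUU' (hVU hzV))
  have hloc : ∀ y ∈ U, ∃ B 𝒜, y ∈ B ∧ IsPreconnected B ∧ B ⊆ U ∧ IsSheetFamily f S B 𝒜 := by
    intro y hy
    obtain ⟨B, 𝒜, hyB, h⟩ := hsheets y (hUU' hy)
    have hyBU : y ∈ B ∩ U := ⟨hyB, hy⟩
    have hsub := connectedComponentIn_subset (B ∩ U) y
    exact ⟨_, _, mem_connectedComponentIn hyBU, isPreconnected_connectedComponentIn,
      hsub.trans Set.inter_subset_right,
      h.mono hc (h.isOpen_base.inter hUopen).connectedComponentIn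
        (hsub.trans Set.inter_subset_left)⟩
  have hsheetV : ∀ {B 𝒜}, IsPreconnected B → B ⊆ U → IsSheetFamily f S B 𝒜 →
      ∀ A ∈ 𝒜, (A ∩ V).Nonempty → A ⊆ V := fun hB hBU h A hA hAV =>
    hmax A (h.isPreconnected ho hB hA) (fun z hz => hBU (h.subset A hA hz).2) hAV
  have hVopen : IsOpen V := by
    refine isOpen_iff_mem_nhds.2 fun z hz => ?_
    obtain ⟨B, 𝒜, hzB, hB, hBU, h⟩ := hloc (f z) (hVU hz)
    obtain ⟨A, hA, hzA⟩ := h.exhaustive z (hVS hz) hzB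
    exact Filter.mem_of_superset ((h.isOpen A hA).mem_nhds hzA)
      (hsheetV hB hBU h A hA ⟨z, hzA, hz⟩)
  -- The image of `V` is open and relatively closed in the connected set `U`: near a limit point, a
  -- connected sheet that meets `V` lies in `V` and covers a neighbourhood of that point.
  have hsurj : U ⊆ f '' V := by
    refine hUconn.subset_of_closure_inter_subset (ho _ hVopen) ⟨f x, hxU, x, hxV, rfl⟩ ?_
    rintro y ⟨hy, hyU⟩
    obtain ⟨B, 𝒜, hyB, hB, hBU, h⟩ := hloc y hyU
    obtain ⟨_, hzB, z, hz, rfl⟩ := mem_closure_iff.1 hy B h.isOpen_base hyB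
    obtain ⟨A, hA, hzA⟩ := h.exhaustive z (hVS hz) hzB
    obtain ⟨z', hz', rfl⟩ := h.surjOn A hA hyB
    exact ⟨z', hsheetV hB hBU h A hA ⟨z, hzA, hz⟩ hz', rfl⟩
  have hsurj' : Function.Surjective (hVU.restrict f V U) := by
    rintro ⟨y, hy⟩
    obtain ⟨z, hz, rfl⟩ := hsurj hy
    exact ⟨⟨z, hz⟩, rfl⟩
  refine ⟨hVS, hVU, ?_, hsurj'⟩
  rintro ⟨y, hy⟩
  obtain ⟨B, 𝒜, hyB, hB, hBU, h⟩ := hloc y hy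
  have hVsheet := hsheetV hB hBU h
  have hfam : IsSheetFamily (hVU.restrict f V U) Set.univ (Subtype.val ⁻¹' B)
      ((fun A : Set X => (Subtype.val ⁻¹' A : Set V)) '' {A ∈ 𝒜 | (A ∩ V).Nonempty}) := by
    constructor
    · exact h.isOpen_base.preimage continuous_subtype_val
    · rintro _ ⟨A, ⟨hA, -⟩, rfl⟩
      exact (h.isOpen A hA).preimage continuous_subtype_val
    · rintro _ ⟨A, ⟨hA, -⟩, rfl⟩ z hz
      exact ⟨trivial, (h.subset A hA hz).2⟩
    · rintro _ ⟨A, ⟨hA, -⟩, rfl⟩ z hz z' hz' hzz'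
      exact Subtype.ext (h.injOn A hA hz hz' (congrArg Subtype.val hzz'))
    · rintro _ ⟨A, ⟨hA, hAV⟩, rfl⟩ ⟨w, hw⟩ hwB
      obtain ⟨z, hz, rfl⟩ := h.surjOn A hA hwB
      exact ⟨⟨z, hVsheet A hA hAV hz⟩, hz, rfl⟩
    · rintro _ ⟨A, ⟨hA, -⟩, rfl⟩ _ ⟨A', ⟨hA', -⟩, rfl⟩ hne
      exact (h.disjoint hA hA' fun e => hne (by rw [e])).preimage Subtype.val
    · rintro ⟨z, hz⟩ - hzB
      obtain ⟨A, hA, hzA⟩ := h.exhaustive z (hVS hz) hzB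
      exact ⟨_, ⟨A, ⟨hA, z, hzA, hz⟩, rfl⟩, hzA⟩
  refine hfam.isEvenlyCovered (hc.restrict hVU) ?_ ?_ hyB
  · exact (ho.comp hVopen.isOpenMap_subtype_val).subtype_mk fun z => hVU z.2
  · obtain ⟨z, hz⟩ := hsurj' ⟨y, hy⟩
    obtain ⟨A, hA, -⟩ := hfam.exhaustive z trivial (by rw [hz]; exact hyB)
    exact ⟨A, hA⟩

end Sheets

/-! ### Manifold structure from a local homeomorphism -/

section Charts

open scoped Manifold ContDiff

variable {𝕜 E X : Type*} [NontriviallyNormedField 𝕜] [NormedAddCommGroup E] [NormedSpace 𝕜 E]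
  [TopologicalSpace X]

/-- A space with a local homeomorphism `f` to a normed space is a manifold for which `f` is a local
diffeomorphism. -/
theorem exists_isManifold_of_isLocalHomeomorph {f : X → E} (hf : IsLocalHomeomorph f) :
    ∃ _ : ChartedSpace E X, IsManifold 𝓘(𝕜, E) ω X ∧
      IsLocalDiffeomorph 𝓘(𝕜, E) 𝓘(𝕜, E) ω f := by
  choose e he hfe using hf
  let cs : ChartedSpace E X :=
    { atlas := Set.range e
      chartAt := e
      mem_chart_source := he
      chart_mem_atlas := fun x => ⟨x, rfl⟩ }
  have hm : IsManifold 𝓘(𝕜, E) ω X := by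
    refine isManifold_of_contDiffOn _ _ _ ?_
    rintro _ _ ⟨x, rfl⟩ ⟨y, rfl⟩
    -- All charts are restrictions of `f` itself, so the transition maps are identities.
    refine contDiffOn_id.congr fun z hz => ?_
    have hz' : z ∈ (e x).target := by
      have := hz.1
      simp only [mfld_simps] at this
      exact this.1
    have : e y ((e x).symm z) = z := by
      rw [← hfe y, hfe x, (e x).right_inv hz']
    simpa [mfld_simps] using this
  refine ⟨cs, hm, fun x => ?_⟩
  refine ⟨⟨(e x).toPartialEquiv, (e x).open_source, (e x).open_target,
    contMDiffOn_chart (x := x), contMDiffOn_chart_symm (x := x)⟩, he x, fun z _ => ?_⟩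
  exact congrFun (hfe x) z

end Charts

end Bridgeland

namespace Bridgeland

open Topology

/-! ### The topology of the space of stability conditions -/

section StabTopology

universe w u

variable {C : Type u} [Category.{w} C] [HasZeroObject C] [HasShift C ℤ] [Preadditive C]
  [∀ n : ℤ, (shiftFunctor C n).Additive] [Pretriangulated C] [IsTriangulated C]
  {Λ : Type*} [AddCommGroup Λ] [Module.Free ℤ Λ] [Module.Finite ℤ Λ] {v : K0 C →+ Λ}

namespace Stab

omit [IsTriangulated C] in
theorem isInducing : IsInducing fun σ : Stab v => (σ.slicing, σ.charge) := ⟨rfl⟩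

omit [IsTriangulated C] in
theorem continuous_slicing : Continuous fun σ : Stab v => σ.slicing :=
  continuous_fst.comp isInducing.continuous

omit [IsTriangulated C] in
theorem continuous_charge : Continuous (Stab.charge (v := v)) :=
  continuous_snd.comp isInducing.continuous

omit [IsTriangulated C] in
theorem isOpen_edist_lt (σ : Stab v) (δ : ℝ≥0∞) :
    IsOpen {τ : Stab v | edist σ.slicing τ.slicing < δ} :=
  isOpen_lt (continuous_const.edist continuous_slicing) continuous_const

omit [IsTriangulated C] in
theorem isOpen_norm_charge_lt (Z : Λ →+ ℂ) (δ : ℝ) :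
    IsOpen {τ : Stab v | ‖τ.charge - Z‖ < δ} :=
  isOpen_lt (continuous_charge.sub continuous_const).norm continuous_const

omit [IsTriangulated C] in
theorem exists_of_mem_nhds {σ : Stab v} {O : Set (Stab v)} (hO : O ∈ 𝓝 σ) :
    ∃ ε : ℝ, 0 < ε ∧ ∀ τ : Stab v, edist σ.slicing τ.slicing ≤ ENNReal.ofReal ε →
      ‖τ.charge - σ.charge‖ < ε → τ ∈ O := by
  rw [nhds_induced, nhds_prod_eq] at hO
  obtain ⟨⟨δ, ε⟩, ⟨hδ, hε⟩, h⟩ :=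
    ((Metric.nhds_basis_closedEBall.prod Metric.nhds_basis_ball).comap _).mem_iff.1 hO
  obtain ⟨δ', hδ', hδ''⟩ : ∃ δ' : ℝ, 0 < δ' ∧ ENNReal.ofReal δ' ≤ δ := by
    obtain ⟨r, hr, hrδ⟩ := ENNReal.lt_iff_exists_nnreal_btwn.1 hδ
    refine ⟨r, by exact_mod_cast hr, ?_⟩
    rw [ENNReal.ofReal_coe_nnreal]
    exact hrδ.le
  refine ⟨min δ' ε, lt_min hδ' hε, fun τ hτ hτ' => h ⟨?_, ?_⟩⟩
  · rw [Metric.mem_closedEBall, edist_comm]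
    exact hτ.trans ((ENNReal.ofReal_le_ofReal (min_le_left _ _)).trans hδ'')
  · rw [mem_ball_iff_norm]
    exact hτ'.trans_le (min_le_right _ _)

/-- Different charges are separated in `Hom(Λ, ℂ)`. For equal charges, rigidity makes the balls of
radius `1 / 2` for the distance of slicings disjoint. -/
instance : T2Space (Stab v) := by
  refine ⟨fun σ τ hne => ?_⟩
  by_cases hZ : σ.charge = τ.charge
  · refine ⟨_, _, isOpen_edist_lt σ 2⁻¹, isOpen_edist_lt τ 2⁻¹, ?_, ?_, ?_⟩
    · simp
    · simp
    · refine Set.disjoint_left.2 fun ρ hσ hτ => hne ?_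
      refine eq_of_edist_lt_one hZ ((edist_triangle_right _ _ ρ.slicing).trans_lt ?_)
      exact (ENNReal.add_lt_add hσ hτ).trans_eq ENNReal.inv_two_add_inv_two
  · obtain ⟨A, B, hA, hB, hσ, hτ, hAB⟩ := t2_separation hZ
    exact ⟨_, _, hA.preimage continuous_charge, hB.preimage continuous_charge, hσ, hτ,
      hAB.preimage _⟩

omit [Module.Free ℤ Λ] [Module.Finite ℤ Λ] in
theorem eq_of_edist_le {σ τ ρ : Stab v} {a b : ℝ} (hab : a + b < 1) (ha : 0 ≤ a) (hb : 0 ≤ b)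
    (hZ : σ.charge = τ.charge)
    (hσ : edist σ.slicing ρ.slicing ≤ ENNReal.ofReal a)
    (hτ : edist ρ.slicing τ.slicing ≤ ENNReal.ofReal b) : σ = τ := by
  refine eq_of_edist_lt_one hZ ((edist_triangle _ ρ.slicing _).trans_lt ?_)
  refine (add_le_add hσ hτ).trans_lt ?_
  rw [← ENNReal.ofReal_add ha hb]
  exact ENNReal.ofReal_lt_one.2 hab

theorem isOpenMap_charge : IsOpenMap (Stab.charge (v := v)) := by
  refine fun O hO => isOpen_iff_mem_nhds.2 ?_
  rintro _ ⟨σ, hσ, rfl⟩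
  obtain ⟨Q, hQ⟩ := σ.support
  obtain ⟨ε, hε, h⟩ := exists_of_mem_nhds (hO.mem_nhds hσ)
  obtain ⟨ρ, hρ, hdef⟩ := exists_deformation (v := v) hQ.1 hε
  refine Filter.mem_of_superset (Metric.ball_mem_nhds _ (lt_min hε hρ)) fun W hW => ?_
  rw [mem_ball_iff_norm, lt_min_iff] at hW
  obtain ⟨τ, rfl, -, hτ⟩ := hdef σ W hQ (by simpa [charge] using hρ) hW.2
  exact ⟨τ, h τ hτ hW.1, rfl⟩

/-- Rigidity makes the charge injective on balls of radius `1 / 4` for the distance of slicings, and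
deformation makes it open. -/
theorem isLocalHomeomorph_charge : IsLocalHomeomorph (Stab.charge (v := v)) := by
  refine isLocalHomeomorph_iff_isOpenEmbedding_restrict.2 fun σ => ?_
  have hO := isOpen_edist_lt σ (ENNReal.ofReal (1 / 4))
  refine ⟨_, hO.mem_nhds (by simp), .of_continuous_injective_isOpenMap
    (continuous_charge.comp continuous_subtype_val) ?_
    (isOpenMap_charge.comp hO.isOpenMap_subtype_val)⟩
  rintro ⟨τ, hτ⟩ ⟨τ', hτ'⟩ hZ
  refine Subtype.ext (eq_of_edist_le (a := 1 / 4) (b := 1 / 4) (ρ := σ) (by norm_num)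
    (by norm_num) (by norm_num) hZ ?_ (le_of_lt hτ'))
  rw [edist_comm]
  exact le_of_lt hτ

/-- Support property propagates to nearby stability conditions with nearby central charge. -/
theorem exists_supportWrt_of_near {Q : QuadraticForm ℝ (ℝ ⊗[ℤ] Λ)} {Z₀ : Λ →+ ℂ}
    (hZ₀ : NegDefOnKer Q Z₀) :
    ∃ ρ : ℝ, 0 < ρ ∧ ∀ σ τ : Stab v, σ.SupportWrt Q → ‖σ.charge - Z₀‖ < ρ →
      ‖τ.charge - Z₀‖ < ρ → edist σ.slicing τ.slicing ≤ ENNReal.ofReal (1 / 4) →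
      τ.SupportWrt Q := by
  obtain ⟨ρ, hρ, hdef⟩ := exists_deformation (v := v) hZ₀ (ε := 1 / 4) (by norm_num)
  refine ⟨ρ, hρ, fun σ τ hσ hσZ hτZ hστ => ?_⟩
  obtain ⟨τ', hZ, hτ'Q, hτ'⟩ := hdef σ τ.charge hσ hσZ hτZ
  rw [edist_comm] at hτ'
  -- The deformation of `σ` to the charge of `τ` is within `1 / 4 + 1 / 4 < 1` of `τ`, so it is `τ`
  -- by rigidity.
  rwa [← eq_of_edist_le (by norm_num) (by norm_num) (by norm_num) hZ hτ' hστ]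

theorem isOpen_supportWrt (Q : QuadraticForm ℝ (ℝ ⊗[ℤ] Λ)) :
    IsOpen {σ : Stab v | σ.SupportWrt Q} := by
  refine isOpen_iff_mem_nhds.2 fun σ hσ => ?_
  obtain ⟨ρ, hρ, h⟩ := exists_supportWrt_of_near (v := v) hσ.1
  refine Filter.mem_of_superset (Filter.inter_mem
    ((isOpen_edist_lt σ (ENNReal.ofReal (1 / 4))).mem_nhds (by simp))
    ((isOpen_norm_charge_lt σ.charge ρ).mem_nhds (by simpa using hρ))) fun τ hτ => ?_
  exact h σ τ hσ (by simpa [charge] using hρ) hτ.2 (le_of_lt hτ.1)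

/-- The radius is attached to the charge of the limit `τ`, not to the approximating stability
conditions, so one of these is close enough to deform to `τ`. -/
theorem supportWrt_of_mem_closure {Q : QuadraticForm ℝ (ℝ ⊗[ℤ] Λ)} {τ : Stab v}
    (hτ : τ ∈ closure {σ : Stab v | σ.SupportWrt Q}) (hZ : NegDefOnKer Q τ.charge) :
    τ.SupportWrt Q := by
  obtain ⟨ρ, hρ, h⟩ := exists_supportWrt_of_near (v := v) hZ
  obtain ⟨σ, ⟨hσ, hσZ⟩, hσQ⟩ := mem_closure_iff.1 hτ _
    ((isOpen_edist_lt τ (ENNReal.ofReal (1 / 4))).inter (isOpen_norm_charge_lt τ.charge ρ))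
    ⟨by simp, by simpa using hρ⟩
  refine h σ τ hσQ hσZ (by simpa using hρ) ?_
  rw [edist_comm]
  exact le_of_lt hσ

/-- The sheets are indexed by the points over `Z₀` supported by `Q`. Deforming from `Z₀` shows that
a sheet covers the ball, deforming back to `Z₀` shows that every supported point over the ball lies
in a sheet, and rigidity gives injectivity and disjointness. -/
theorem exists_isSheetFamily {Q : QuadraticForm ℝ (ℝ ⊗[ℤ] Λ)} {Z₀ : Λ →+ ℂ}
    (hZ₀ : NegDefOnKer Q Z₀) :
    ∃ B 𝒜, Z₀ ∈ B ∧ IsSheetFamily (Stab.charge (v := v)) {σ | σ.SupportWrt Q} B 𝒜 := by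
  -- Deformations move by at most `1 / 8`, strictly inside the sheet radius `1 / 4`; two such radii
  -- still add up to less than 1.
  obtain ⟨ρ, hρ, hdef⟩ := exists_deformation (v := v) hZ₀ (ε := 1 / 8) (by norm_num)
  let sheet (τ : Stab v) : Set (Stab v) :=
    {σ | σ.SupportWrt Q ∧ edist τ.slicing σ.slicing < ENNReal.ofReal (1 / 4) ∧
      ‖σ.charge - Z₀‖ < ρ}
  have hlt : ENNReal.ofReal (1 / 8) < ENNReal.ofReal (1 / 4) :=
    (ENNReal.ofReal_lt_ofReal_iff (by norm_num)).2 (by norm_num)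
  refine ⟨Metric.ball Z₀ ρ, sheet '' {τ | τ.SupportWrt Q ∧ τ.charge = Z₀},
    Metric.mem_ball_self hρ, Metric.isOpen_ball, ?_, ?_, ?_, ?_, ?_, ?_⟩
  · rintro _ ⟨τ, -, rfl⟩
    exact (isOpen_supportWrt Q).inter
      ((isOpen_edist_lt τ _).inter (isOpen_norm_charge_lt Z₀ ρ))
  · rintro _ ⟨τ, -, rfl⟩ σ ⟨hσ, -, hσZ⟩
    exact ⟨hσ, mem_ball_iff_norm.2 hσZ⟩
  · rintro _ ⟨τ, -, rfl⟩ σ hσ σ' hσ' hZ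
    refine eq_of_edist_le (a := 1 / 4) (b := 1 / 4) (ρ := τ) (by norm_num) (by norm_num)
      (by norm_num) hZ ?_ (le_of_lt hσ'.2.1)
    rw [edist_comm]
    exact le_of_lt hσ.2.1
  · rintro _ ⟨τ, ⟨hτ, hτZ⟩, rfl⟩ W hW
    rw [mem_ball_iff_norm] at hW
    obtain ⟨σ, rfl, hσ, hτσ⟩ := hdef τ W hτ (by simpa [hτZ] using hρ) hW
    exact ⟨σ, ⟨hσ, hτσ.trans_lt hlt, hW⟩, rfl⟩
  · rintro _ ⟨τ, ⟨hτ, hτZ⟩, rfl⟩ _ ⟨τ', ⟨hτ', hτZ'⟩, rfl⟩ hne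
    refine Set.disjoint_left.2 fun σ hσ hσ' => hne (congrArg sheet ?_)
    refine eq_of_edist_le (a := 1 / 4) (b := 1 / 4) (ρ := σ) (by norm_num) (by norm_num)
      (by norm_num) (hτZ.trans hτZ'.symm) (le_of_lt hσ.2.1) ?_
    rw [edist_comm]
    exact le_of_lt hσ'.2.1
  · intro σ hσ hσZ
    rw [mem_ball_iff_norm] at hσZ
    obtain ⟨τ, hτZ, hτ, hστ⟩ := hdef σ Z₀ hσ hσZ (by simpa using hρ)
    rw [edist_comm] at hστ
    exact ⟨_, ⟨τ, ⟨hτ, hτZ⟩, rfl⟩, hσ, hστ.trans_lt hlt, hσZ⟩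

end Stab

end StabTopology

end Bridgeland

theorem mainTheorem1 {C : Type*} [Category C] [HasZeroObject C] [HasShift C ℤ] [Preadditive C]
    [∀ n : ℤ, (shiftFunctor C n).Additive] [Pretriangulated C] [IsTriangulated C]
    {Λ : Type*} [AddCommGroup Λ] [Module.Free ℤ Λ] [Module.Finite ℤ Λ] (v : K0 C →+ Λ) :
    (∀ (Q : QuadraticForm ℝ (ℝ ⊗[ℤ] Λ)) (σ : Stab v), σ.SupportWrt Q →
      ∀ (U' U : Set (Λ →+ ℂ)) (V : Set (Stab v)),
        U' = {Z' : Λ →+ ℂ | NegDefOnKer Q Z'} →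
        U = connectedComponentIn U' σ.charge →
        V = connectedComponentIn (Stab.charge ⁻¹' U) σ →
        IsOpen U' ∧
        (∃ hVU : Set.MapsTo (Stab.charge (v := v)) V U,
          IsCoveringMap (hVU.restrict Stab.charge V U) ∧
          Function.Surjective (hVU.restrict Stab.charge V U)) ∧
        ∀ τ ∈ V, τ.SupportWrt Q) ∧
    T2Space (Stab v) ∧
    ∃ _ : ChartedSpace (Λ →+ ℂ) (Stab v),
      IsManifold 𝓘(ℂ, Λ →+ ℂ) ω (Stab v) ∧
      IsLocalDiffeomorph 𝓘(ℂ, Λ →+ ℂ) 𝓘(ℂ, Λ →+ ℂ) ω (Stab.charge (v := v)) := by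
  refine ⟨?_, inferInstance, exists_isManifold_of_isLocalHomeomorph Stab.isLocalHomeomorph_charge⟩
  rintro Q σ hσ U' U V rfl hU hV
  -- Local connectedness comes from convexity of balls, for which the underlying real normed space
  -- is used.
  have : LocallyConnectedSpace (Λ →+ ℂ) :=
    let _ : NormedSpace ℝ (Λ →+ ℂ) := NormedSpace.complexToReal
    inferInstance
  obtain ⟨hVS, hcov⟩ := isCoveringMap_restrict_connectedComponentIn Stab.continuous_charge
    Stab.isOpenMap_charge (isOpen_negDefOnKer Q) (Stab.isOpen_supportWrt Q)
    (fun τ hτ hZ => Stab.supportWrt_of_mem_closure hτ hZ)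
    (fun Z hZ => Stab.exists_isSheetFamily hZ) hσ hσ.1 hU hV
  exact ⟨isOpen_negDefOnKer Q, hcov, hVS⟩
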